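/- Let $\hat W:\mathbb R\to[0,\infty)$ be an even, measurable, integrable function with $\int_{\mathbb R}\hat W>0$ and $\lim_{x\to\pm\infty}|x|^{-1}\log\hat W(x)=-\infty$ (with $\log 0=-\infty$), let $\mathfrak a>0$, let $n\ge 0$ be an integer, and put $W(x)=\hat W(x)e^{\mathfrak a x}$, $W^{\rm odd}(x)=|x|W(x)$. For a weight $w$ and $\gamma\in\mathbb R$ let $$\langle f,g\rangle_{w,\gamma}=\int_{\mathbb R}f(x)g(x)\,\big(1_{x\ge 0}+\gamma\,1_{x<0}\big)\,w(x)\,dx ,$$ and let $p_j=p_j^{w,\gamma}$, $q_k=q_k^{w,\gamma}$ ($j,k\ge 0$) be monic polynomials, of degrees $j$ and $k$, such that $\langle p_j(x),q_k(x^2)\rangle_{w,\gamma}=\delta_{jk}h_j^{w,\gamma}$ with all $h_j^{w,\gamma}\ne 0$. Set $$K^{w,\gamma}_m(x,y)=\sum_{k=0}^{m-1}\frac{1}{h_k^{w,\gamma}}\,p_k^{w,\gamma}(x)\,q_k^{w,\gamma}(y^2)\,\big(1_{x\ge0}+\gamma\,1_{x<0}\big)\,w(x),\qquad \hat K^{w,\gamma}_m(x,y)=K^{w,\gamma}_m(x,y)+K^{w,\gamma}_m(-x,y).$$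 Let $A=\mathrm{diag}(\mathfrak a,\dots,\mathfrak a,-\mathfrak a,\dots,-\mathfrak a)$ with $n$ entries of each sign, and let $M$ be the random $2n\times 2n$ Hermitian matrix with law $$\frac1Z\det\big(\hat W(M)\big)\,e^{\mathrm{Tr}(AM)}\,dM ,$$ where $dM$ is Lebesgue measure on the Hermitian matrices. Let $\phi_1,\dots,\phi_{2n}$ be any linearly independent functions with span $\mathrm{span}\{x^j:0\le j<2n\}$, and $\psi_1,\dots,\psi_{2n}$ any linearly independent functions with span $\mathrm{span}\{x^je^{\mathfrak ax},\,x^je^{-\mathfrak ax}:0\le j<n\}$. Let $\mathcal M=(m_{j,k})$ with $m_{j,k}=\int_{\mathbb R}\phi_j\psi_k\hat W\,dx$, and $$K^{\rm ext}_{2n}(x,y)=(\phi_1(y),\dots,\phi_{2n}(y))\,(\mathcal M^{-1})^{T}\,(\psi_1(x),\dots,\psi_{2n}(x))^{T}\,\hat W(x).$$ Then: 1. The biorthogonal systems for $(W,1)$ and for $(W^{\rm odd},-1)$ exist and are unique. 2. The law of $M$ is a well-defined probability measure (that is, $0<Z<\infty$), the integrals $m_{j,k}$ converge absolutely, and $\mathcal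 M$ is invertible. 3. $K^{\rm ext}_{2n}$ is a correlation kernel of the eigenvalues of $M$: for every $k\ge 0$ the $k$-point correlation function of the eigenvalues is $\det\big(K^{\rm ext}_{2n}(x_i,x_j)\big)_{i,j=1}^k$. 4. For all real $x,y$, $$K^{\rm ext}_{2n}(x,y)=\tfrac12\,\hat K^{W,1}_n(x,y)+\frac{y}{2x}\,\hat K^{W^{\rm odd},-1}_n(x,y),$$ where the second term is read as $0$ when $x=0$. -/

import Mathlib

open MeasureTheory Filter
open scoped ENNReal Polynomial Matrix

noncomputable section

namespace ExternalSource

/-! Weights and the generalized Muttalib–Borodin biorthogonal systems. -/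

/-- An admissible even weight on the real line: even, non-negative, measurable, integrable, not
almost everywhere zero, and with `|x|⁻¹ log (w x) → -∞` as `x → ±∞`. The last condition is written
without logarithms (`log (w x) ≤ -c |x|` eventually, for every `c`), so that `log 0 = -∞`. -/
structure IsEvenWeight (w : ℝ → ℝ) : Prop where
  even : Function.Even w
  nonneg : ∀ x, 0 ≤ w x
  measurable : Measurable w
  integrable : Integrable w
  integral_pos : 0 < ∫ x, w x
  decay : ∀ c : ℝ, ∀ᶠ x in cocompact ℝ, w x ≤ Real.exp (-c * |x|)

/-- The function equal to `1` on `[0, ∞)` and to `γ` on `(-∞, 0)`. -/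
def halfLine (γ x : ℝ) : ℝ := if 0 ≤ x then 1 else γ

/-- The bilinear pairing `⟨f, g⟩_{W, γ}`. -/
def pairing (W : ℝ → ℝ) (γ : ℝ) (f g : ℝ → ℝ) : ℝ :=
  ∫ x, f x * g x * halfLine γ x * W x

/-- `⟨p(x), q(x²)⟩_{W, γ}` for polynomials `p` and `q`. -/
def polyPairing (W : ℝ → ℝ) (γ : ℝ) (p q : ℝ[X]) : ℝ :=
  pairing W γ (fun x => p.eval x) (fun x => q.eval (x ^ 2))

/-- `(p_j)`, `(q_k)` are sequences of monic polynomials, of degrees `j` and `k`, such that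
`⟨p_j(x), q_k(x²)⟩_{W, γ} = δ_{jk} h_j` with all `h_j ≠ 0` (and all these integrals converge). -/
structure IsBiorthogonalSystem (W : ℝ → ℝ) (γ : ℝ) (p q : ℕ → ℝ[X]) : Prop where
  monic_left : ∀ j, (p j).Monic
  natDegree_left : ∀ j, (p j).natDegree = j
  monic_right : ∀ k, (q k).Monic
  natDegree_right : ∀ k, (q k).natDegree = k
  integrable : ∀ j k,
    Integrable fun x => (p j).eval x * (q k).eval (x ^ 2) * halfLine γ x * W x
  orthogonal : ∀ j k, j ≠ k → polyPairing W γ (p j) (q k) = 0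
  norm_ne_zero : ∀ j, polyPairing W γ (p j) (q j) ≠ 0

/-- The system exists and is unique. -/
def BiorthogonalWellDefined (W : ℝ → ℝ) (γ : ℝ) : Prop :=
  ∃! pq : (ℕ → ℝ[X]) × (ℕ → ℝ[X]), IsBiorthogonalSystem W γ pq.1 pq.2

/-- The biorthogonal system of `W` and `γ` (arbitrary if there is none). -/
def biorthogonalSystem (W : ℝ → ℝ) (γ : ℝ) : (ℕ → ℝ[X]) × (ℕ → ℝ[X]) :=
  Classical.epsilon fun pq => IsBiorthogonalSystem W γ pq.1 pq.2

/-- `p_k^{W, γ}`. -/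
def biorthP (W : ℝ → ℝ) (γ : ℝ) (k : ℕ) : ℝ[X] := (biorthogonalSystem W γ).1 k

/-- `q_k^{W, γ}`. -/
def biorthQ (W : ℝ → ℝ) (γ : ℝ) (k : ℕ) : ℝ[X] := (biorthogonalSystem W γ).2 k

/-- `h_k^{W, γ}`. -/
def biorthH (W : ℝ → ℝ) (γ : ℝ) (k : ℕ) : ℝ :=
  polyPairing W γ (biorthP W γ k) (biorthQ W γ k)

/-- The reproducing kernel `K_m^{W, γ}(x, y)`. -/
def mbKernel (W : ℝ → ℝ) (γ : ℝ) (m : ℕ) (x y : ℝ) : ℝ :=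
  ∑ k ∈ Finset.range m, 1 / biorthH W γ k * (biorthP W γ k).eval x *
    (biorthQ W γ k).eval (y ^ 2) * halfLine γ x * W x

/-- The symmetrized kernel `K_m^{W, γ}(x, y) + K_m^{W, γ}(-x, y)`. -/
def symKernel (W : ℝ → ℝ) (γ : ℝ) (m : ℕ) (x y : ℝ) : ℝ :=
  mbKernel W γ m x y + mbKernel W γ m (-x) y

/-- `W(x) = w(x) e^{a x}`. -/
def tilt (w : ℝ → ℝ) (a x : ℝ) : ℝ := w x * Real.exp (a * x)

/-- `W^odd(x) = |x| W(x)`. -/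
def oddWeight (W : ℝ → ℝ) (x : ℝ) : ℝ := |x| * W x

/-! The external source kernel, from arbitrary bases of the two function spaces. -/

/-- The space spanned by `1, x, …, x^(2n-1)`. -/
def polySpace (n : ℕ) : Submodule ℝ (ℝ → ℝ) :=
  Submodule.span ℝ {f | ∃ j < 2 * n, f = fun x => x ^ j}

/-- The space spanned by the functions `x^j e^{a x}` and `x^j e^{-a x}`, `0 ≤ j < n`. -/
def expSpace (n : ℕ) (a : ℝ) : Submodule ℝ (ℝ → ℝ) :=
  Submodule.span ℝ
    ({f | ∃ j < n, f = fun x => x ^ j * Real.exp (a * x)} ∪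
      {f | ∃ j < n, f = fun x => x ^ j * Real.exp (-a * x)})

/-- The matrix with entries `⟨φ_j, ψ_k⟩_ext = ∫ φ_j ψ_k w`. -/
def momentMatrix {N : ℕ} (w : ℝ → ℝ) (φ ψ : Fin N → ℝ → ℝ) : Matrix (Fin N) (Fin N) ℝ :=
  Matrix.of fun j k => ∫ x, φ j x * ψ k x * w x

/-- `(φ_1(y), …, φ_N(y)) (M⁻¹)ᵀ (ψ_1(x), …, ψ_N(x))ᵀ w(x)`, with `M` the matrix of the `⟨φ_j, ψ_k⟩`. -/
def extKernel {N : ℕ} (w : ℝ → ℝ) (φ ψ : Fin N → ℝ → ℝ) (x y : ℝ) : ℝ :=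
  ((fun j => φ j y) ⬝ᵥ (((momentMatrix w φ ψ)⁻¹)ᵀ *ᵥ fun k => ψ k x)) * w x

/-! The random matrix model. -/

/-- Coordinates on the space of `N × N` Hermitian matrices: the diagonal entries and the entries
above the diagonal. Its `volume` is Lebesgue measure `∏ dM_ii ∏_{i<j} dRe M_ij dIm M_ij`. -/
abbrev HermCoord (N : ℕ) : Type :=
  (Fin N → ℝ) × ({p : Fin N × Fin N // p.1 < p.2} → ℂ)

/-- The Hermitian matrix with given coordinates. -/
def hermMatrix {N : ℕ} (c : HermCoord N) : Matrix (Fin N) (Fin N) ℂ :=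
  Matrix.of fun i j =>
    if h : i < j then c.2 ⟨(i, j), h⟩
    else if h : j < i then star (c.2 ⟨(j, i), h⟩)
    else (c.1 i : ℂ)

theorem hermMatrix_isHermitian {N : ℕ} (c : HermCoord N) : (hermMatrix c).IsHermitian := by
  ext i j
  rcases lt_trichotomy i j with h | h | h
  · simp [hermMatrix, h, h.not_gt]
  · subst h; simp [hermMatrix]
  · simp [hermMatrix, h, h.not_gt]

/-- The eigenvalues of the Hermitian matrix with coordinates `c`, repeated with multiplicity. -/
def eigs {N : ℕ} (c : HermCoord N) : Fin N → ℝ := (hermMatrix_isHermitian c).eigenvalues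

/-- `A = diag(a, …, a, -a, …, -a)`, with `n` entries of each sign. -/
def sourceMatrix (n : ℕ) (a : ℝ) : Matrix (Fin (2 * n)) (Fin (2 * n)) ℂ :=
  Matrix.diagonal fun i => if (i : ℕ) < n then (a : ℂ) else -(a : ℂ)

/-- The unnormalized density `det(w(M)) e^{Tr(A M)}`, where `w(M)` is given by the functional
calculus of the Hermitian matrix `M` (the expression is a real number, as `w` and `A` are real). -/
def extDensity (w : ℝ → ℝ) (n : ℕ) (a : ℝ) (c : HermCoord (2 * n)) : ℝ :=
  (((hermMatrix_isHermitian c).cfc w).det *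
    Complex.exp (sourceMatrix n a * hermMatrix c).trace).re

/-- The normalization constant `Z`. -/
def partitionFn (w : ℝ → ℝ) (n : ℕ) (a : ℝ) : ℝ≥0∞ :=
  ∫⁻ c, ENNReal.ofReal (extDensity w n a c)

/-- The law `Z⁻¹ det(w(M)) e^{Tr(A M)} dM` of the random matrix. -/
def extLaw (w : ℝ → ℝ) (n : ℕ) (a : ℝ) : Measure (HermCoord (2 * n)) :=
  (partitionFn w n a)⁻¹ • volume.withDensity fun c => ENNReal.ofReal (extDensity w n a c)

/-- `K` is a correlation kernel of the random points `X ω 0, …, X ω (N-1)`: for every `k`, the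
`k`-point correlation function is `det (K(x_i, x_j))`, tested against bounded measurable functions
(the sum runs over all `k`-tuples of points with distinct indices). -/
def IsCorrelationKernel {Ω : Type*} [MeasurableSpace Ω] (P : Measure Ω) {N : ℕ}
    (X : Ω → Fin N → ℝ) (K : ℝ → ℝ → ℝ) : Prop :=
  ∀ (k : ℕ) (f : (Fin k → ℝ) → ℝ), Measurable f → (∃ C : ℝ, ∀ x, |f x| ≤ C) →
    Integrable (fun ω => ∑ e : Fin k ↪ Fin N, f fun i => X ω (e i)) P ∧
    Integrable (fun x : Fin k → ℝ => f x * (Matrix.of fun i j => K (x i) (x j)).det) ∧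
    ∫ ω, ∑ e : Fin k ↪ Fin N, f (fun i => X ω (e i)) ∂P =
      ∫ x : Fin k → ℝ, f x * (Matrix.of fun i j => K (x i) (x j)).det

end ExternalSource

end

/-! Write V for the Vandermonde determinant. The eigenvalues of M, with their labels symmetrized,
have density proportional to V(x) det(θ_j(x_i)) ∏ w(x_i), where the θ_j are the functions x^r e^{ax}
and x^r e^{-ax}, r < n. The determinantal structure follows from this density, and the splitting of
the kernel follows from the evenness of w.

The density is usually derived from Weyl integration and the Harish-Chandra–Itzykson–Zuber formula.
Here it comes from algebra on Gaussian matrices. For the density exp(Tr BM - Tr M²/2), integration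
by parts reads E[M_ij p] = B_ij E[p] + E[∂_ji p]. This recursion forces the expectation to be, up to
its total mass, exp(Δ/2) evaluated at B (`eq_heatSum_of_stein`). The same holds for vectors with
density exp(β·x - |x|²/2). On trace polynomials the matrix Laplacian becomes V⁻¹ Δ V in the
eigenvalues, because V is harmonic (`exists_radial_laplacian`). Hence integrating V g over vectors
gives, up to a constant, V(β) times the integral of g(eigenvalues) over matrices, for symmetric g
and B = diag β (`stein_functionals_eq`). Symmetrizing over permutations turns the vector density
into V(x) det(e^{β_j x_i}) e^{-|x|²/2}. Exponential moments are finite, so polynomial moments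
determine the symmetrized law (`measure_ext_of_moments`). The degenerate source is the limit of ±a +
εr as ε → 0, where both sides carry the same power of ε. Multiplying by det(w(M)) e^{Tr M²/2}, a
function of the eigenvalues, replaces the Gaussian by w (`lintegral_eigs_weight`).

Andréief's identity then gives Z = κ (2n)! det 𝓜 for a constant κ. Since Z ≠ 0, the matrix 𝓜 is
invertible (`det_sourceGram_ne_zero`). After biorthonormalizing the two bases, integrating out
variables one at a time gives the correlation functions (`isCorrelationKernel_pairKernel`).

Reflection exchanges x^r e^{ax} and x^r e^{-ax} up to sign. A combination of n monomials of one
parity that is orthogonal to all x^r e^{ax} is therefore orthogonal to the whole exponential space,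
hence zero. So the moment determinants of both half-size pairings are nonzero, and both biorthogonal
systems exist and are unique. Finally q_k(y²), y q_k(y²) on one side and p_k(x)e^{ax} ±
p_k(-x)e^{-ax} on the other have diagonal Gram matrix with entries 2h_k. The external source kernel
does not depend on the bases, so it can be read off from these (`extKernel_eq_symKernel`). -/

noncomputable section

namespace ExternalSource

/-! ### Joint law of the eigenvalues of a Gaussian Hermitian matrix with diagonal source. -/

section EigenvalueLaw

open MvPolynomial

/-! ### Second order operators on polynomial rings -/

section Laplacian

/-- The commutator of two derivations is again a derivation, and this one kills every variable. -/
theorem pderiv_pderiv_comm {ι : Type*} (i j : ι) (p : MvPolynomial ι ℂ) :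
    pderiv i (pderiv j p) = pderiv j (pderiv i p) := by
  classical
  have h : ⁅pderiv (R := ℂ) i, pderiv (R := ℂ) j⁆ =
      (0 : Derivation ℂ (MvPolynomial ι ℂ) (MvPolynomial ι ℂ)) := by
    apply MvPolynomial.derivation_ext
    intro k
    rw [Derivation.commutator_apply]
    simp [pderiv_X, Pi.single_apply, apply_ite]
  have := congrArg (fun D => D p) h
  simpa [Derivation.commutator_apply, sub_eq_zero] using this

variable {ι : Type*} [Fintype ι]

/-- The operator `∑ i, ∂_i ∂_{τ i}`. -/
def twistedLaplacian (τ : ι → ι) : MvPolynomial ι ℂ →ₗ[ℂ] MvPolynomial ι ℂ :=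
  ∑ i, (pderiv i).toLinearMap ∘ₗ (pderiv (τ i)).toLinearMap

/-- The bilinear form `∑ i, ∂_i p ∂_{τ i} q`. -/
def gradForm (τ : ι → ι) (p q : MvPolynomial ι ℂ) : MvPolynomial ι ℂ :=
  ∑ i, pderiv i p * pderiv (τ i) q

theorem twistedLaplacian_apply (τ : ι → ι) (p : MvPolynomial ι ℂ) :
    twistedLaplacian τ p = ∑ i, pderiv i (pderiv (τ i) p) := by
  simp [twistedLaplacian]

theorem gradForm_comm {τ : ι → ι} (hτ : Function.Involutive τ) (p q : MvPolynomial ι ℂ) :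
    gradForm τ p q = gradForm τ q p := by
  unfold gradForm
  rw [← Equiv.sum_comp hτ.toPerm]
  refine Finset.sum_congr rfl fun i _ => ?_
  simp [hτ i, mul_comm]

theorem gradForm_mul_left (τ : ι → ι) (p q r : MvPolynomial ι ℂ) :
    gradForm τ (p * q) r = p * gradForm τ q r + q * gradForm τ p r := by
  simp only [gradForm, Derivation.leibniz, smul_eq_mul, Finset.mul_sum, ← Finset.sum_add_distrib]
  exact Finset.sum_congr rfl fun i _ => by ring

theorem gradForm_mul_right (τ : ι → ι) (p q r : MvPolynomial ι ℂ) :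
    gradForm τ p (q * r) = q * gradForm τ p r + r * gradForm τ p q := by
  simp only [gradForm, Derivation.leibniz, smul_eq_mul, Finset.mul_sum, ← Finset.sum_add_distrib]
  exact Finset.sum_congr rfl fun i _ => by ring

theorem gradForm_add_left (τ : ι → ι) (p q r : MvPolynomial ι ℂ) :
    gradForm τ (p + q) r = gradForm τ p r + gradForm τ q r := by
  simp [gradForm, add_mul, Finset.sum_add_distrib]

theorem gradForm_add_right (τ : ι → ι) (p q r : MvPolynomial ι ℂ) :
    gradForm τ p (q + r) = gradForm τ p q + gradForm τ p r := by
  simp [gradForm, mul_add, Finset.sum_add_distrib]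

@[simp] theorem gradForm_algebraMap_left (τ : ι → ι) (c : ℂ) (q : MvPolynomial ι ℂ) :
    gradForm τ (algebraMap ℂ _ c) q = 0 := by
  simp [gradForm]

@[simp] theorem gradForm_algebraMap_right (τ : ι → ι) (c : ℂ) (p : MvPolynomial ι ℂ) :
    gradForm τ p (algebraMap ℂ _ c) = 0 := by
  simp [gradForm]

/-- Leibniz rule of a second order operator. The two cross terms coincide because `τ` is an
involution, which produces the factor 2. -/
theorem twistedLaplacian_mul {τ : ι → ι} (hτ : Function.Involutive τ) (p q : MvPolynomial ι ℂ) :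
    twistedLaplacian τ (p * q) =
      p * twistedLaplacian τ q + q * twistedLaplacian τ p + 2 * gradForm τ p q := by
  have h : twistedLaplacian τ (p * q) = p * twistedLaplacian τ q + q * twistedLaplacian τ p +
      (gradForm τ p q + gradForm τ q p) := by
    simp only [gradForm, twistedLaplacian_apply, Derivation.leibniz, smul_eq_mul, map_add,
      Finset.mul_sum, ← Finset.sum_add_distrib]
    exact Finset.sum_congr rfl fun i _ => by ring
  rw [h, gradForm_comm hτ q p]
  ring

theorem twistedLaplacian_X_mul {τ : ι → ι} (hτ : Function.Involutive τ) (i : ι)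
    (p : MvPolynomial ι ℂ) :
    twistedLaplacian τ (X i * p) = X i * twistedLaplacian τ p + 2 * pderiv (τ i) p := by
  classical
  have h1 : twistedLaplacian τ (X i) = 0 := by
    rw [twistedLaplacian_apply]
    refine Finset.sum_eq_zero fun j _ => ?_
    simp [pderiv_X, Pi.single_apply, apply_ite]
  have h2 : gradForm τ (X i) p = pderiv (τ i) p := by
    unfold gradForm
    rw [Finset.sum_eq_single i]
    · simp
    · intro j _ hj
      simp [pderiv_X, Ne.symm hj]
    · simp
  rw [twistedLaplacian_mul hτ, h1, h2]
  ring

theorem twistedLaplacian_pderiv (τ : ι → ι) (i : ι) (p : MvPolynomial ι ℂ) :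
    twistedLaplacian τ (pderiv i p) = pderiv i (twistedLaplacian τ p) := by
  simp only [twistedLaplacian_apply, map_sum]
  refine Finset.sum_congr rfl fun j _ => ?_
  rw [pderiv_pderiv_comm (τ j) i, pderiv_pderiv_comm j i]

theorem iterate_twistedLaplacian_pderiv (τ : ι → ι) (i : ι) (k : ℕ) (p : MvPolynomial ι ℂ) :
    (twistedLaplacian τ ^ k) (pderiv i p) = pderiv i ((twistedLaplacian τ ^ k) p) := by
  induction k with
  | zero => simp
  | succ k ih => rw [pow_succ', Module.End.mul_apply, ih, twistedLaplacian_pderiv]; rfl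

/-- The commutator of the operator with multiplication by `X i` is `2 ∂_{τ i}`, which commutes with
the operator. Each further power therefore contributes one more such term. -/
theorem iterate_twistedLaplacian_X_mul {τ : ι → ι} (hτ : Function.Involutive τ) (i : ι) (k : ℕ)
    (p : MvPolynomial ι ℂ) :
    (twistedLaplacian τ ^ (k + 1)) (X i * p) = X i * (twistedLaplacian τ ^ (k + 1)) p +
      (2 * (k + 1) : ℂ) • pderiv (τ i) ((twistedLaplacian τ ^ k) p) := by
  induction k with
  | zero =>
    have h2 : (2 : MvPolynomial ι ℂ) = C 2 := (map_ofNat C 2).symm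
    simp [twistedLaplacian_X_mul hτ, MvPolynomial.smul_eq_C_mul, h2]
  | succ k ih =>
    have e (m : ℕ) (q : MvPolynomial ι ℂ) : (twistedLaplacian τ ^ (m + 1)) q =
        twistedLaplacian τ ((twistedLaplacian τ ^ m) q) := by rw [pow_succ']; rfl
    rw [e (k + 1) (X i * p), ih, map_add, map_smul, twistedLaplacian_X_mul hτ,
      twistedLaplacian_pderiv, ← e, ← e]
    have : (2 : MvPolynomial ι ℂ) * pderiv (τ i) ((twistedLaplacian τ ^ (k + 1)) p) =
      (2 : ℂ) • pderiv (τ i) ((twistedLaplacian τ ^ (k + 1)) p) := by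
      rw [MvPolynomial.smul_eq_C_mul, map_ofNat]
    rw [this, add_assoc, ← add_smul]
    congr 2
    push_cast
    ring

/-- The first `K` terms of `exp (½ ∑ ∂_i ∂_{τ i}) p`, evaluated at `a`. -/
def heatSum (τ : ι → ι) (a : ι → ℂ) (K : ℕ) : MvPolynomial ι ℂ →ₗ[ℂ] ℂ :=
  ∑ k ∈ Finset.range K, (1 / (2 ^ k * (Nat.factorial k : ℂ))) •
    ((aeval a).toLinearMap ∘ₗ (twistedLaplacian τ ^ k))

theorem heatSum_apply (τ : ι → ι) (a : ι → ℂ) (K : ℕ) (p : MvPolynomial ι ℂ) :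
    heatSum τ a K p = ∑ k ∈ Finset.range K, (1 / (2 ^ k * (Nat.factorial k : ℂ))) *
      aeval a ((twistedLaplacian τ ^ k) p) := by
  simp [heatSum]

/-- The weights `1/(2^k k!)` absorb the factor `2(k+1)` of the commutator. The truncated heat
operator thus obeys the Gaussian integration by parts recursion, at the cost of one order of
truncation in the derivative term. -/
theorem heatSum_succ_X_mul {τ : ι → ι} (hτ : Function.Involutive τ) (a : ι → ℂ) (K : ℕ) (i : ι)
    (p : MvPolynomial ι ℂ) :
    heatSum τ a (K + 1) (X i * p) =
      a i * heatSum τ a (K + 1) p + heatSum τ a K (pderiv (τ i) p) := by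
  rw [heatSum_apply, heatSum_apply, heatSum_apply, Finset.sum_range_succ', Finset.sum_range_succ',
    mul_add, Finset.mul_sum, add_right_comm, ← Finset.sum_add_distrib]
  congr 1
  · refine Finset.sum_congr rfl fun k _ => ?_
    rw [iterate_twistedLaplacian_X_mul hτ, iterate_twistedLaplacian_pderiv]
    simp only [map_add, map_mul, aeval_X, map_smul, smul_eq_mul, Nat.factorial_succ]
    have : ((k : ℂ) + 1) ≠ 0 := by exact_mod_cast Nat.succ_ne_zero k
    have : (Nat.factorial k : ℂ) ≠ 0 := by exact_mod_cast Nat.factorial_ne_zero k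
    push_cast
    field_simp
    ring
  · simp

/-- A functional satisfying the Gaussian integration by parts formula is given by the heat
operator. -/
theorem eq_heatSum_of_stein {τ : ι → ι} (hτ : Function.Involutive τ) (a : ι → ℂ)
    (Φ : MvPolynomial ι ℂ →ₗ[ℂ] ℂ)
    (hΦ : ∀ i p, Φ (X i * p) = a i * Φ p + Φ (pderiv (τ i) p)) (p : MvPolynomial ι ℂ) :
    ∃ K₀, ∀ K ≥ K₀, Φ p = Φ 1 * heatSum τ a K p := by
  classical
  -- The recursion expresses a monomial through monomials of lower degree, so everything reduces to
  -- `Φ 1`. Truncating at order `d + 1` is enough: when the order drops by one, the degree has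
  -- dropped by two.
  have key : ∀ d : ℕ, ∀ s : ι →₀ ℕ, s.degree = d → ∀ K ≥ d + 1,
      Φ (monomial s 1) = Φ 1 * heatSum τ a K (monomial s 1) := by
    intro d
    induction d using Nat.strong_induction_on with
    | _ d ih =>
    intro s hs K hK
    by_cases h0 : s = 0
    · subst h0
      have h1 : (monomial (0 : ι →₀ ℕ) (1 : ℂ)) = 1 := rfl
      rw [h1]
      obtain ⟨K, rfl⟩ : ∃ K', K = K' + 1 := ⟨K - 1, by omega⟩
      rw [heatSum_apply, Finset.sum_range_succ', Finset.sum_eq_zero]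
      · simp
      · intro k _
        have : twistedLaplacian τ (1 : MvPolynomial ι ℂ) = 0 := by
          simp [twistedLaplacian_apply]
        rw [pow_succ (twistedLaplacian τ), Module.End.mul_apply, this]
        simp
    · obtain ⟨i, hi⟩ := Finsupp.ne_iff.1 h0
      have hi' : 1 ≤ s i := Nat.one_le_iff_ne_zero.2 hi
      obtain ⟨t, rfl⟩ : ∃ t, s = Finsupp.single i 1 + t :=
        ⟨s - Finsupp.single i 1, (add_tsub_cancel_of_le (by
          simpa [Finsupp.single_le_iff] using hi')).symm⟩
      have hmon : (monomial (Finsupp.single i 1 + t) (1 : ℂ)) = X i * monomial t 1 := by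
        simp [X, monomial_mul]
      have hdeg : t.degree + 1 = d := by
        rw [← hs, map_add, Finsupp.degree_single, add_comm]
      obtain ⟨K, rfl⟩ : ∃ K', K = K' + 1 := ⟨K - 1, by omega⟩
      rw [hmon, hΦ, heatSum_succ_X_mul hτ, ih t.degree (by omega) t rfl (K + 1) (by omega)]
      have h2 : Φ (pderiv (τ i) (monomial t 1)) =
          Φ 1 * heatSum τ a K (pderiv (τ i) (monomial t 1)) := by
        rw [pderiv_monomial, one_mul]
        by_cases ht : t (τ i) = 0
        · simp [ht]
        · have hle : Finsupp.single (τ i) 1 ≤ t := by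
            simpa [Finsupp.single_le_iff] using Nat.one_le_iff_ne_zero.2 ht
          have hd2 : (t - Finsupp.single (τ i) 1).degree + 1 = t.degree := by
            conv_rhs => rw [← tsub_add_cancel_of_le hle, map_add, Finsupp.degree_single]
          have := ih _ (by omega) (t - Finsupp.single (τ i) 1) rfl K (by omega)
          have hm : monomial (t - Finsupp.single (τ i) 1) ((t (τ i) : ℂ)) =
              (t (τ i) : ℂ) • monomial (t - Finsupp.single (τ i) 1) 1 := by
            simp [smul_monomial]
          rw [hm, map_smul, map_smul, this, smul_eq_mul, smul_eq_mul]
          ring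
      rw [h2]
      ring
  refine ⟨p.totalDegree + 1, fun K hK => ?_⟩
  rw [p.as_sum, map_sum, map_sum, Finset.mul_sum]
  refine Finset.sum_congr rfl fun s hs => ?_
  have hm : monomial s (coeff s p) = coeff s p • monomial s (1 : ℂ) := by simp [smul_monomial]
  have hd : s.degree ≤ p.totalDegree := by
    have := le_totalDegree hs
    rwa [Finsupp.degree_apply]
  rw [hm, map_smul, map_smul, key _ s rfl K (by omega), smul_eq_mul, smul_eq_mul]
  ring

end Laplacian

/-! ### Trace polynomials and power sums -/

section TracePolynomials

theorem derivation_prod_eq {A ι : Type*} [CommRing A] [Algebra ℂ A] (D : Derivation ℂ A A)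
    (s : Finset ι) (f h : ι → A) (hf : ∀ i ∈ s, D (f i) = f i * h i) :
    D (∏ i ∈ s, f i) = (∏ i ∈ s, f i) * ∑ i ∈ s, h i := by
  classical
  induction s using Finset.induction_on with
  | empty => simp
  | insert i s hi ih =>
    rw [Finset.prod_insert hi, Finset.sum_insert hi, Derivation.leibniz,
      ih fun j hj => hf j (Finset.mem_insert_of_mem hj), hf i (Finset.mem_insert_self i s)]
    simp only [smul_eq_mul]
    ring

theorem derivation_det_eq_zero {A n : Type*} [CommRing A] [Algebra ℂ A] [Fintype n] [DecidableEq n]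
    (D : Derivation ℂ A A) (M : Matrix n n A) (hM : ∀ i j, D (M i j) = 0) : D M.det = 0 := by
  rw [Matrix.det_apply, map_sum]
  refine Finset.sum_eq_zero fun σ _ => ?_
  have h : D (∏ i, M (σ i) i) = 0 := by
    rw [derivation_prod_eq D _ _ 0 fun i _ => by simp [hM]]
    simp
  rcases Int.units_eq_one_or (Equiv.Perm.sign σ) with hs | hs <;> simp [hs, h]

variable (N : ℕ)

/-- The generic `N × N` matrix. -/
abbrev genericMatrix : Matrix (Fin N) (Fin N) (MvPolynomial (Fin N × Fin N) ℂ) :=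
  Matrix.mvPolynomialX (Fin N) (Fin N) ℂ

/-- The Vandermonde determinant as a polynomial. -/
def vandermondePoly : MvPolynomial (Fin N) ℂ := (Matrix.vandermonde (X : Fin N → _)).det

variable {N}

theorem pderiv_genericMatrix_pow (p q : Fin N) (m : ℕ) (i j : Fin N) :
    pderiv (p, q) ((genericMatrix N ^ m) i j) =
      ∑ a ∈ Finset.range m, (genericMatrix N ^ a) i p * (genericMatrix N ^ (m - 1 - a)) q j := by
  induction m generalizing i j with
  | zero => by_cases h : i = j <;> simp [h]
  | succ m ih =>
    rw [pow_succ, Matrix.mul_apply, map_sum, Finset.sum_range_succ]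
    simp only [Derivation.leibniz, smul_eq_mul, ih, Finset.sum_add_distrib]
    rw [add_comm]
    congr 1
    · simp only [Finset.mul_sum]
      rw [Finset.sum_comm]
      refine Finset.sum_congr rfl fun a ha => ?_
      have : m + 1 - 1 - a = (m - 1 - a) + 1 := by
        have := Finset.mem_range.1 ha
        omega
      rw [this, pow_succ, Matrix.mul_apply, Finset.mul_sum]
      exact Finset.sum_congr rfl fun l _ => by ring
    · rw [Finset.sum_eq_single p]
      · have : m + 1 - 1 - m = 0 := by omega
        have h2 : pderiv (p, q) (genericMatrix N p j) =
            (1 : Matrix (Fin N) (Fin N) (MvPolynomial (Fin N × Fin N) ℂ)) q j := by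
          rw [genericMatrix, Matrix.mvPolynomialX_apply, pderiv_X, Matrix.one_apply]
          by_cases h : q = j
          · simp [h]
          · have : (p, q) ≠ (p, j) := fun h' => h (Prod.ext_iff.1 h').2
            simp [h, Ne.symm this]
        rw [this, pow_zero, h2]
      · intro l _ hl
        simp [Matrix.mvPolynomialX_apply, pderiv_X, Prod.ext_iff, hl]
      · simp

theorem pderiv_trace_genericMatrix_pow (p q : Fin N) (m : ℕ) :
    pderiv (p, q) (genericMatrix N ^ m).trace =
      (m : MvPolynomial (Fin N × Fin N) ℂ) * (genericMatrix N ^ (m - 1)) q p := by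
  simp only [Matrix.trace, Matrix.diag, map_sum, pderiv_genericMatrix_pow]
  rw [Finset.sum_comm]
  have : ∀ a ∈ Finset.range m, ∑ i, (genericMatrix N ^ a) i p *
      (genericMatrix N ^ (m - 1 - a)) q i = (genericMatrix N ^ (m - 1)) q p := by
    intro a ha
    have h : m - 1 = (m - 1 - a) + a := by
      have := Finset.mem_range.1 ha
      omega
    conv_rhs => rw [h, pow_add, Matrix.mul_apply]
    exact Finset.sum_congr rfl fun l _ => by ring
  rw [Finset.sum_congr rfl this]
  simp

theorem gradForm_trace_genericMatrix_pow (k l : ℕ) :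
    gradForm Prod.swap (genericMatrix N ^ k).trace (genericMatrix N ^ l).trace =
      ((k * l : ℂ)) • (genericMatrix N ^ (k - 1 + (l - 1))).trace := by
  simp only [gradForm, Fintype.sum_prod_type, Prod.swap, pderiv_trace_genericMatrix_pow]
  rw [pow_add, Matrix.trace, Finset.smul_sum, Finset.sum_comm]
  refine Finset.sum_congr rfl fun p _ => ?_
  rw [Matrix.diag_apply, Matrix.mul_apply, Finset.smul_sum]
  refine Finset.sum_congr rfl fun q _ => ?_
  rw [MvPolynomial.smul_eq_C_mul]
  simp only [map_mul, map_natCast]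
  ring

/-- Differentiating a power of the matrix cuts it into two factors, and contracting the indices
closes each of them into a trace. These products of traces have no counterpart in the Laplacian of a
power sum; the Vandermonde factor will supply them. -/
theorem twistedLaplacian_trace_genericMatrix_pow (m : ℕ) :
    twistedLaplacian Prod.swap (genericMatrix N ^ m).trace =
      (m : ℂ) • ∑ a ∈ Finset.range (m - 1),
        (genericMatrix N ^ a).trace * (genericMatrix N ^ (m - 1 - 1 - a)).trace := by
  simp only [twistedLaplacian_apply, Fintype.sum_prod_type, Prod.swap,
    pderiv_trace_genericMatrix_pow, Derivation.leibniz, smul_eq_mul, Derivation.map_natCast,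
    mul_zero, add_zero, pderiv_genericMatrix_pow]
  rw [MvPolynomial.smul_eq_C_mul, map_natCast]
  simp only [← Finset.mul_sum]
  congr 1
  rw [Finset.sum_congr rfl fun p _ => Finset.sum_comm, Finset.sum_comm]
  refine Finset.sum_congr rfl fun a _ => ?_
  simp only [Matrix.trace, Matrix.diag, Finset.sum_mul_sum]

theorem pderiv_psum (i : Fin N) (k : ℕ) :
    pderiv i (psum (Fin N) ℂ k) = (k : MvPolynomial (Fin N) ℂ) * X i ^ (k - 1) := by
  rw [psum, map_sum, Finset.sum_eq_single i]
  · simp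
  · intro j _ hj
    simp [pderiv_X, hj]
  · simp

theorem gradForm_psum_psum (k l : ℕ) :
    gradForm id (psum (Fin N) ℂ k) (psum (Fin N) ℂ l) =
      ((k * l : ℂ)) • psum (Fin N) ℂ (k - 1 + (l - 1)) := by
  simp only [gradForm, id, pderiv_psum]
  rw [psum, Finset.smul_sum]
  refine Finset.sum_congr rfl fun q _ => ?_
  rw [MvPolynomial.smul_eq_C_mul, pow_add]
  simp only [map_mul, map_natCast]
  ring

theorem twistedLaplacian_psum (m : ℕ) :
    twistedLaplacian id (psum (Fin N) ℂ m) =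
      (m : MvPolynomial (Fin N) ℂ) * (((m - 1 : ℕ) : MvPolynomial (Fin N) ℂ) *
        psum (Fin N) ℂ (m - 1 - 1)) := by
  simp only [twistedLaplacian_apply, id, pderiv_psum, Derivation.leibniz, smul_eq_mul,
    Derivation.map_natCast, mul_zero, add_zero]
  rw [← Finset.mul_sum, psum, Finset.mul_sum _ _ ((m - 1 : ℕ) : MvPolynomial (Fin N) ℂ)]
  congr 1
  exact Finset.sum_congr rfl fun q _ => by simp

theorem two_mul_sum_Ioi_eq {A : Type*} [CommRing A] (h : Fin N → Fin N → A)
    (hs : ∀ i j, h i j = h j i) :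
    2 * ∑ i, ∑ j ∈ Finset.Ioi i, h i j = ∑ i, ∑ j, h i j - ∑ i, h i i := by
  have h1 : ∑ i, ∑ j, h i j =
      ∑ i, ∑ j ∈ Finset.Ioi i, h i j + ∑ i, ∑ j ∈ Finset.Iio i, h i j + ∑ i, h i i := by
    rw [← Finset.sum_add_distrib, ← Finset.sum_add_distrib]
    refine Finset.sum_congr rfl fun i _ => ?_
    have : (Finset.univ : Finset (Fin N)) = insert i (Finset.Ioi i ∪ Finset.Iio i) := by
      ext j
      simp only [Finset.mem_univ, Finset.mem_insert, Finset.mem_union, Finset.mem_Ioi,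
        Finset.mem_Iio, true_iff]
      rcases lt_trichotomy i j with h | h | h <;> simp [h]
    rw [this, Finset.sum_insert (by simp), Finset.sum_union, add_comm]
    rw [Finset.disjoint_left]
    intro j hj hj'
    exact absurd (Finset.mem_Ioi.1 hj) (not_lt.2 (Finset.mem_Iio.1 hj').le)
  have h2 : ∑ i, ∑ j ∈ Finset.Iio i, h i j = ∑ i, ∑ j ∈ Finset.Ioi i, h i j := by
    rw [Finset.sum_comm' (t' := Finset.univ) (s' := fun j => Finset.Ioi j)]
    · exact Finset.sum_congr rfl fun i _ => Finset.sum_congr rfl fun j _ => hs _ _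
    · simp
  rw [h1, h2]
  ring

/-- The derivation `∑ X_i^m ∂_i` multiplies each factor `X_j - X_i` by the geometric sum `(X_j^m -
X_i^m)/(X_j - X_i)`. Summed over all ordered pairs these give products of power sums. The factor 2
passes from `i < j` to ordered pairs, and the diagonal is subtracted. -/
theorem two_mul_sum_X_pow_mul_pderiv_vandermondePoly (m : ℕ) :
    2 * ∑ i, X i ^ m * pderiv i (vandermondePoly N) =
      vandermondePoly N * (∑ a ∈ Finset.range m, psum (Fin N) ℂ a * psum (Fin N) ℂ (m - 1 - a) -
        (m : MvPolynomial (Fin N) ℂ) * psum (Fin N) ℂ (m - 1)) := by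
  let D : Derivation ℂ (MvPolynomial (Fin N) ℂ) (MvPolynomial (Fin N) ℂ) :=
    ∑ i, (X i ^ m : MvPolynomial (Fin N) ℂ) • pderiv i
  have hD : ∀ p, D p = ∑ i, X i ^ m * pderiv i p := by
    intro p
    simp only [D, ← Derivation.coeFnAddMonoidHom_apply, map_sum, Finset.sum_apply]
    rfl
  have hX : ∀ j, D (X j) = X j ^ m := by
    intro j
    rw [hD, Finset.sum_eq_single j]
    · simp
    · intro i _ hi
      simp [pderiv_X, hi.symm]
    · simp
  let h : Fin N → Fin N → MvPolynomial (Fin N) ℂ :=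
    fun i j => ∑ a ∈ Finset.range m, X j ^ a * X i ^ (m - 1 - a)
  have hsymm : ∀ i j, h i j = h j i := by
    intro i j
    simp only [h]
    rw [← Finset.sum_range_reflect]
    refine Finset.sum_congr rfl fun a ha => ?_
    have h2 : m - 1 - (m - 1 - a) = a := by
      have := Finset.mem_range.1 ha
      omega
    rw [h2, mul_comm]
  have hfac : D (vandermondePoly N) =
      vandermondePoly N * ∑ i, ∑ j ∈ Finset.Ioi i, h i j := by
    rw [vandermondePoly, Matrix.det_vandermonde]
    refine derivation_prod_eq D _ _ _ fun i _ => derivation_prod_eq D _ _ _ fun j _ => ?_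
    rw [map_sub, hX, hX]
    exact ((Commute.all (X j) (X i)).mul_geom_sum₂ m).symm
  rw [← hD, hfac, mul_left_comm, two_mul_sum_Ioi_eq h hsymm]
  congr 2
  · simp only [h, psum, Finset.sum_mul_sum]
    rw [Finset.sum_congr rfl fun p _ => Finset.sum_comm, Finset.sum_comm]
    refine Finset.sum_congr rfl fun a _ => ?_
    rw [Finset.sum_comm]
  · simp only [h, psum]
    rw [Finset.mul_sum]
    refine Finset.sum_congr rfl fun i _ => ?_
    rw [Finset.sum_congr rfl fun a ha => ?_, Finset.sum_const, Finset.card_range, nsmul_eq_mul]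
    have := Finset.mem_range.1 ha
    rw [← pow_add]
    congr 1
    omega

/-- Expand along row `k`. The cofactors of that row do not involve `X k`, so `∂_k²` acts only on its
entries and turns `X_k^j` into `j(j-1) X_k^(j-2)`. Summing over `k` gives the off-diagonal entry
`(j, j-2)` of adjugate times matrix, which is zero. -/
theorem twistedLaplacian_vandermondePoly : twistedLaplacian id (vandermondePoly N) = 0 := by
  set V : Matrix (Fin N) (Fin N) (MvPolynomial (Fin N) ℂ) := Matrix.vandermonde X with hV
  have hadj : ∀ k j, pderiv k (V.adjugate j k) = 0 := by
    intro k j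
    rw [Matrix.adjugate_apply]
    refine derivation_det_eq_zero _ _ fun i l => ?_
    by_cases hik : i = k
    · subst hik
      by_cases hl : l = j
      · subst hl; simp
      · simp [hl]
    · rw [Matrix.updateRow_ne hik, hV, Matrix.vandermonde_apply, pderiv_pow,
        pderiv_X_of_ne hik, mul_zero]
  have h1 : ∀ k, pderiv k (pderiv k V.det) = ∑ j : Fin N,
      ((j : ℕ) * ((j : ℕ) - 1 : ℕ) : MvPolynomial (Fin N) ℂ) *
        (V.adjugate j k * X k ^ ((j : ℕ) - 1 - 1)) := by
    intro k
    rw [Matrix.det_eq_sum_mul_adjugate_row V k, map_sum, map_sum]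
    refine Finset.sum_congr rfl fun j _ => ?_
    simp only [hV, Matrix.vandermonde_apply, Derivation.leibniz, smul_eq_mul, map_add]
    rw [← hV]
    simp only [hadj, pderiv_pow, pderiv_X_self, Derivation.leibniz, smul_eq_mul,
      Derivation.map_natCast, mul_zero, zero_add, mul_one, add_zero, map_zero]
    ring
  rw [twistedLaplacian_apply]
  simp only [id]
  rw [vandermondePoly, ← hV, Finset.sum_congr rfl fun k _ => h1 k, Finset.sum_comm]
  refine Finset.sum_eq_zero fun j _ => ?_
  rw [← Finset.mul_sum]
  by_cases hj : (j : ℕ) ≤ 1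
  · have : (j : ℕ) - 1 = 0 := by omega
    simp [this]
  -- Column `j - 2`; it exists because columns with `j ≤ 1` have been treated separately.
  · let l : Fin N := ⟨(j : ℕ) - 1 - 1, by omega⟩
    have h2 : ∑ k, V.adjugate j k * X k ^ ((j : ℕ) - 1 - 1) = (V.adjugate * V) j l := by
      rw [Matrix.mul_apply]
      rfl
    have hne : j ≠ l := by
      intro h
      have := congrArg Fin.val h
      simp only [l] at this
      omega
    rw [h2, Matrix.adjugate_mul]
    simp [hne]

variable (N) in
/-- The algebra generated by the pairs of the polynomial `Tr M ^ k` in the entries of a matrix and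
the power sum of degree `k`. -/
def traceAlgebra : Subalgebra ℂ (MvPolynomial (Fin N × Fin N) ℂ × MvPolynomial (Fin N) ℂ) :=
  Algebra.adjoin ℂ (Set.range fun k => ((genericMatrix N ^ k).trace, psum (Fin N) ℂ k))

theorem trace_psum_mem_traceAlgebra (k : ℕ) :
    ((genericMatrix N ^ k).trace, psum (Fin N) ℂ k) ∈ traceAlgebra N :=
  Algebra.subset_adjoin ⟨k, rfl⟩

/-- On generators both components have the same structure constant `k l` and the same resulting
degree; the Leibniz rules extend this to the algebra. Working with pairs tracks a matrix polynomial
and its expression in the eigenvalues together, so no map between the two rings has to be shown well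
defined. -/
theorem gradForm_mem_traceAlgebra
    {x y : MvPolynomial (Fin N × Fin N) ℂ × MvPolynomial (Fin N) ℂ}
    (hx : x ∈ traceAlgebra N) (hy : y ∈ traceAlgebra N) :
    (gradForm Prod.swap x.1 y.1, gradForm id x.2 y.2) ∈ traceAlgebra N := by
  have hright : ∀ k, ∀ y ∈ traceAlgebra N,
      (gradForm Prod.swap (genericMatrix N ^ k).trace y.1,
        gradForm id (psum (Fin N) ℂ k) y.2) ∈ traceAlgebra N := by
    intro k y hy
    induction hy using Algebra.adjoin_induction with
    | mem y hy =>
      obtain ⟨l, rfl⟩ := hy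
      simp only
      rw [gradForm_trace_genericMatrix_pow, gradForm_psum_psum]
      exact Subalgebra.smul_mem _ (trace_psum_mem_traceAlgebra (k - 1 + (l - 1))) (k * l : ℂ)
    | algebraMap r =>
      simp only [Prod.algebraMap_apply, gradForm_algebraMap_right]
      exact Subalgebra.zero_mem _
    | add x z _ _ h1 h2 =>
      rw [Prod.fst_add, Prod.snd_add, gradForm_add_right, gradForm_add_right, ← Prod.mk_add_mk]
      exact Subalgebra.add_mem _ h1 h2
    | mul x z hx hz h1 h2 =>
      rw [Prod.fst_mul, Prod.snd_mul, gradForm_mul_right, gradForm_mul_right, ← Prod.mk_add_mk,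
        ← Prod.mk_mul_mk, ← Prod.mk_mul_mk]
      exact Subalgebra.add_mem _ (Subalgebra.mul_mem _ hx h2) (Subalgebra.mul_mem _ hz h1)
  induction hx using Algebra.adjoin_induction with
  | mem x hx =>
    obtain ⟨k, rfl⟩ := hx
    exact hright k y hy
  | algebraMap r =>
    simp only [Prod.algebraMap_apply, gradForm_algebraMap_left]
    exact Subalgebra.zero_mem _
  | add x z _ _ h1 h2 =>
    rw [Prod.fst_add, Prod.snd_add, gradForm_add_left, gradForm_add_left, ← Prod.mk_add_mk]
    exact Subalgebra.add_mem _ h1 h2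
  | mul x z hx hz h1 h2 =>
    rw [Prod.fst_mul, Prod.snd_mul, gradForm_mul_left, gradForm_mul_left, ← Prod.mk_add_mk,
      ← Prod.mk_mul_mk, ← Prod.mk_mul_mk]
    exact Subalgebra.add_mem _ (Subalgebra.mul_mem _ hx h2) (Subalgebra.mul_mem _ hz h1)

/-- The radial part of the Laplacian on Hermitian matrices. -/
theorem exists_radial_laplacian
    {x : MvPolynomial (Fin N × Fin N) ℂ × MvPolynomial (Fin N) ℂ} (hx : x ∈ traceAlgebra N) :
    ∃ z ∈ traceAlgebra N, z.1 = twistedLaplacian Prod.swap x.1 ∧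
      vandermondePoly N * z.2 = twistedLaplacian id (vandermondePoly N * x.2) := by
  have hsw : Function.Involutive (Prod.swap : Fin N × Fin N → Fin N × Fin N) := Prod.swap_swap
  have hid : Function.Involutive (id : Fin N → Fin N) := fun _ => rfl
  induction hx using Algebra.adjoin_induction with
  | mem x hx =>
    obtain ⟨m, rfl⟩ := hx
    refine ⟨(m : ℂ) • ∑ a ∈ Finset.range (m - 1),
      ((genericMatrix N ^ a).trace, psum (Fin N) ℂ a) *
      ((genericMatrix N ^ (m - 1 - 1 - a)).trace, psum (Fin N) ℂ (m - 1 - 1 - a)), ?_, ?_, ?_⟩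
    · exact Subalgebra.smul_mem _ (Subalgebra.sum_mem _ fun a _ => Subalgebra.mul_mem _
        (trace_psum_mem_traceAlgebra _) (trace_psum_mem_traceAlgebra _)) _
    · rw [twistedLaplacian_trace_genericMatrix_pow]
      simp [Prod.fst_sum]
    -- Since the Vandermonde polynomial is harmonic, only `V Δp_m` and the cross term remain. The
    -- diagonal part of the cross term is `-m(m-1) p_{m-2}`, which cancels `Δp_m` and leaves exactly
    -- the products found on the matrix side.
    · have hg : gradForm id (vandermondePoly N) (psum (Fin N) ℂ m) =
          (m : MvPolynomial (Fin N) ℂ) *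
            ∑ i, X i ^ (m - 1) * pderiv i (vandermondePoly N) := by
        simp only [gradForm, id, pderiv_psum, Finset.mul_sum]
        exact Finset.sum_congr rfl fun i _ => by ring
      rw [twistedLaplacian_mul hid, twistedLaplacian_vandermondePoly, twistedLaplacian_psum, hg,
        mul_left_comm (2 : MvPolynomial (Fin N) ℂ), two_mul_sum_X_pow_mul_pderiv_vandermondePoly]
      simp only [Prod.smul_snd, Prod.snd_sum, Prod.mk_mul_mk, MvPolynomial.smul_eq_C_mul,
        map_natCast]
      ring
  | algebraMap r =>
    refine ⟨0, Subalgebra.zero_mem _, ?_, ?_⟩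
    · simp [twistedLaplacian_apply]
    · rw [twistedLaplacian_mul hid, twistedLaplacian_vandermondePoly]
      simp [twistedLaplacian_apply, gradForm]
  | add x y _ _ h1 h2 =>
    obtain ⟨z1, hz1, e1, f1⟩ := h1
    obtain ⟨z2, hz2, e2, f2⟩ := h2
    exact ⟨z1 + z2, Subalgebra.add_mem _ hz1 hz2, by simp [e1, e2], by simp [mul_add, f1, f2]⟩
  | mul x y hx hy h1 h2 =>
    obtain ⟨z1, hz1, e1, f1⟩ := h1
    obtain ⟨z2, hz2, e2, f2⟩ := h2
    -- Conjugating by `V` does not change the second order part. Both sides therefore satisfy the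
    -- same product rule, with `gradForm` as cross term.
    refine ⟨x * z2 + y * z1 +
      (2 : ℂ) • (gradForm Prod.swap x.1 y.1, gradForm id x.2 y.2), ?_, ?_, ?_⟩
    · exact Subalgebra.add_mem _ (Subalgebra.add_mem _ (Subalgebra.mul_mem _ hx hz2)
        (Subalgebra.mul_mem _ hy hz1)) (Subalgebra.smul_mem _ (gradForm_mem_traceAlgebra hx hy) _)
    · rw [Prod.fst_mul, twistedLaplacian_mul hsw, ← e1, ← e2]
      simp only [Prod.fst_add, Prod.fst_mul, Prod.smul_fst, MvPolynomial.smul_eq_C_mul, map_ofNat]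
    · have f2' := f2
      rw [twistedLaplacian_mul hid, twistedLaplacian_vandermondePoly] at f2'
      rw [Prod.snd_mul, ← mul_assoc, twistedLaplacian_mul hid, ← f1, gradForm_mul_left]
      simp only [Prod.snd_add, Prod.snd_mul, Prod.smul_snd, MvPolynomial.smul_eq_C_mul, map_ofNat]
      linear_combination x.2 * f2'

theorem exists_iterate_radial_laplacian
    {x : MvPolynomial (Fin N × Fin N) ℂ × MvPolynomial (Fin N) ℂ} (hx : x ∈ traceAlgebra N)
    (k : ℕ) :
    ∃ z ∈ traceAlgebra N, z.1 = (twistedLaplacian Prod.swap ^ k) x.1 ∧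
      vandermondePoly N * z.2 = (twistedLaplacian id ^ k) (vandermondePoly N * x.2) := by
  induction k with
  | zero => exact ⟨x, hx, rfl, rfl⟩
  | succ k ih =>
    obtain ⟨z, hz, e, f⟩ := ih
    obtain ⟨z', hz', e', f'⟩ := exists_radial_laplacian hz
    refine ⟨z', hz', ?_, ?_⟩
    · rw [e', e, pow_succ']; rfl
    · rw [f', f, pow_succ']; rfl

/-- Equality on generators is the hypothesis on traces. It is applied to a Hermitian matrix with its
eigenvalues and to a diagonal matrix with its diagonal. -/
theorem aeval_eq_of_mem_traceAlgebra
    {x : MvPolynomial (Fin N × Fin N) ℂ × MvPolynomial (Fin N) ℂ} (hx : x ∈ traceAlgebra N)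
    (A : Matrix (Fin N) (Fin N) ℂ) (v : Fin N → ℂ) (h : ∀ k, (A ^ k).trace = ∑ i, v i ^ k) :
    aeval (fun p : Fin N × Fin N => A p.1 p.2) x.1 = aeval v x.2 := by
  induction hx using Algebra.adjoin_induction with
  | mem x hx =>
    obtain ⟨k, rfl⟩ := hx
    have h1 : aeval (fun p : Fin N × Fin N => A p.1 p.2) (genericMatrix N ^ k).trace =
        (A ^ k).trace := by
      have h2 : (genericMatrix N).map (aeval fun p : Fin N × Fin N => A p.1 p.2) = A := by
        ext i j
        simp [Matrix.mvPolynomialX_apply]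
      conv_rhs => rw [← h2, ← AlgHom.mapMatrix_apply, ← map_pow]
      simp [Matrix.trace]
    simp only [h1, h, psum, map_sum, map_pow, aeval_X]
  | algebraMap r => simp
  | add x y _ _ h1 h2 => rw [Prod.fst_add, Prod.snd_add, map_add, map_add, h1, h2]
  | mul x y _ _ h1 h2 => rw [Prod.fst_mul, Prod.snd_mul, map_mul, map_mul, h1, h2]

/-- Symmetric polynomials are polynomials in the elementary ones. Newton's identities express those
through power sums, the division by `k` being possible over `ℂ`. -/
theorem exists_mem_traceAlgebra_of_isSymmetric {g : MvPolynomial (Fin N) ℂ} (hg : g.IsSymmetric) :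
    ∃ f, (f, g) ∈ traceAlgebra N := by
  let B : Subalgebra ℂ (MvPolynomial (Fin N) ℂ) := (traceAlgebra N).map (AlgHom.snd ℂ _ _)
  have hps : ∀ k, psum (Fin N) ℂ k ∈ B := fun k => ⟨_, trace_psum_mem_traceAlgebra k, rfl⟩
  have hes : ∀ k, esymm (Fin N) ℂ k ∈ B := by
    intro k
    induction k using Nat.strong_induction_on with
    | _ k ih =>
    rcases Nat.eq_zero_or_pos k with rfl | hk
    · simp
    · have h1 := mul_esymm_eq_sum (Fin N) ℂ k
      have h2 : esymm (Fin N) ℂ k = (1 / k : ℂ) • ((k : MvPolynomial (Fin N) ℂ) *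
          esymm (Fin N) ℂ k) := by
        rw [MvPolynomial.smul_eq_C_mul, ← mul_assoc, ← map_natCast C, ← map_mul, one_div,
          inv_mul_cancel₀ (by exact_mod_cast hk.ne'), map_one, one_mul]
      rw [h2, h1]
      refine B.smul_mem (B.mul_mem (B.pow_mem (B.neg_mem B.one_mem) _) (B.sum_mem fun a ha => ?_)) _
      exact B.mul_mem (B.mul_mem (B.pow_mem (B.neg_mem B.one_mem) _)
        (ih _ (Finset.mem_filter.1 ha).2)) (hps _)
  have hq : ∀ q : MvPolynomial (Fin N) ℂ,
      aeval (fun i : Fin N => esymm (Fin N) ℂ ((i : ℕ) + 1)) q ∈ B := by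
    intro q
    induction q using MvPolynomial.induction_on with
    | C r =>
      rw [aeval_C]
      exact B.algebraMap_mem r
    | add p q hp hq =>
      rw [map_add]
      exact B.add_mem hp hq
    | mul_X p i hp =>
      rw [map_mul, aeval_X]
      exact B.mul_mem hp (hes _)
  obtain ⟨q, h⟩ := esymmAlgHom_surjective (σ := Fin N) (n := N) ℂ (by simp) ⟨g, hg⟩
  have hgB : g ∈ B := by
    have h3 := congrArg Subtype.val h
    rw [esymmAlgHom_apply] at h3
    rw [← show _ = g from h3]
    exact hq q
  obtain ⟨⟨f, g'⟩, hm, rfl⟩ := hgB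
  exact ⟨f, hm⟩

/-- Two Gaussian functionals, on matrices and on vectors, agree on symmetric polynomials up to a
Vandermonde factor. -/
theorem stein_functionals_eq (Φ : MvPolynomial (Fin N × Fin N) ℂ →ₗ[ℂ] ℂ)
    (Ψ : MvPolynomial (Fin N) ℂ →ₗ[ℂ] ℂ) (b : Fin N → ℂ)
    (hΦ : ∀ i p, Φ (X i * p) = Matrix.diagonal b i.1 i.2 * Φ p + Φ (pderiv i.swap p))
    (hΨ : ∀ i p, Ψ (X i * p) = b i * Ψ p + Ψ (pderiv i p))
    {x : MvPolynomial (Fin N × Fin N) ℂ × MvPolynomial (Fin N) ℂ} (hx : x ∈ traceAlgebra N) :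
    Ψ (vandermondePoly N * x.2) * Φ 1 = aeval b (vandermondePoly N) * Φ x.1 * Ψ 1 := by
  obtain ⟨K₁, h1⟩ := eq_heatSum_of_stein (τ := Prod.swap) Prod.swap_swap
    (fun p : Fin N × Fin N => Matrix.diagonal b p.1 p.2) Φ hΦ x.1
  obtain ⟨K₂, h2⟩ := eq_heatSum_of_stein (τ := id) (fun _ => rfl) b Ψ hΨ (vandermondePoly N * x.2)
  rw [h1 _ (le_max_left K₁ K₂), h2 _ (le_max_right K₁ K₂)]
  -- Term by term in the heat series: each `Δ^k (V g)` is `V` times the second component of a pair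
  -- whose first component is the iterated matrix Laplacian. At the diagonal matrix `b` the two
  -- components take the same value.
  have h3 : heatSum id b (max K₁ K₂) (vandermondePoly N * x.2) = aeval b (vandermondePoly N) *
      heatSum Prod.swap (fun p : Fin N × Fin N => Matrix.diagonal b p.1 p.2) (max K₁ K₂) x.1 := by
    rw [heatSum_apply, heatSum_apply, Finset.mul_sum]
    refine Finset.sum_congr rfl fun k _ => ?_
    obtain ⟨z, hz, e, f⟩ := exists_iterate_radial_laplacian hx k
    rw [← e, ← f, map_mul, aeval_eq_of_mem_traceAlgebra hz (Matrix.diagonal b) b]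
    · ring
    · intro k
      simp [Matrix.diagonal_pow, Matrix.trace_diagonal]
  rw [h3]
  ring

end TracePolynomials

/-! ### Gaussian integrals over vectors and Hermitian matrices -/

section Gaussian

/-- The rate `δ` is arbitrary so that the induction can spend `δ / 2` on each factor, and so that a
polynomial uses up only part of the Gaussian decay. -/
theorem exists_norm_aeval_le {ι : Type*} [Fintype ι] (p : MvPolynomial ι ℂ) :
    ∀ δ > 0, ∃ C : ℝ, ∀ z : ι → ℂ, ‖aeval z p‖ ≤ C * Real.exp (δ * ∑ i, ‖z i‖ ^ 2) := by
  induction p using MvPolynomial.induction_on with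
  | C r =>
    intro δ hδ
    refine ⟨‖r‖, fun z => ?_⟩
    have : 1 ≤ Real.exp (δ * ∑ i, ‖z i‖ ^ 2) := Real.one_le_exp (by positivity)
    simpa using le_mul_of_one_le_right (norm_nonneg r) this
  | add p q hp hq =>
    intro δ hδ
    obtain ⟨C, hC⟩ := hp δ hδ
    obtain ⟨D, hD⟩ := hq δ hδ
    refine ⟨C + D, fun z => ?_⟩
    rw [map_add, add_mul]
    exact (norm_add_le _ _).trans (add_le_add (hC z) (hD z))
  | mul_X p i hp =>
    intro δ hδ
    obtain ⟨C, hC⟩ := hp (δ / 2) (by positivity)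
    have hC0 : 0 ≤ C := by
      have := (norm_nonneg _).trans (hC 0)
      simpa using this
    -- The constant is chosen so that `(1 + 2/δ)(δ/2 t² + 1)` contains `t² + 1`, which dominates
    -- `t`.
    refine ⟨C * (1 + 2 / δ), fun z => ?_⟩
    rw [map_mul, aeval_X, norm_mul]
    have h1 : ‖z i‖ ^ 2 ≤ ∑ j, ‖z j‖ ^ 2 :=
      Finset.single_le_sum (f := fun j => ‖z j‖ ^ 2) (fun j _ => by positivity)
        (Finset.mem_univ i)
    have h2 : ‖z i‖ ≤ (1 + 2 / δ) * Real.exp (δ / 2 * ∑ j, ‖z j‖ ^ 2) := by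
      have h3 : δ / 2 * ‖z i‖ ^ 2 + 1 ≤ Real.exp (δ / 2 * ∑ j, ‖z j‖ ^ 2) :=
        (by gcongr : δ / 2 * ‖z i‖ ^ 2 + 1 ≤ δ / 2 * ∑ j, ‖z j‖ ^ 2 + 1).trans
          (Real.add_one_le_exp _)
      have h4 : ‖z i‖ ≤ (1 + 2 / δ) * (δ / 2 * ‖z i‖ ^ 2 + 1) := by
        have e : (1 + 2 / δ) * (δ / 2 * ‖z i‖ ^ 2 + 1) =
            ‖z i‖ ^ 2 + 1 + δ / 2 * ‖z i‖ ^ 2 + 2 / δ := by field_simp; ring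
        have : 0 ≤ δ / 2 * ‖z i‖ ^ 2 := by positivity
        have : 0 ≤ 2 / δ := by positivity
        rw [e]
        nlinarith [sq_nonneg (‖z i‖ - 1)]
      exact h4.trans (mul_le_mul_of_nonneg_left h3 (by positivity))
    calc ‖aeval z p‖ * ‖z i‖
        ≤ (C * Real.exp (δ / 2 * ∑ j, ‖z j‖ ^ 2)) *
            ((1 + 2 / δ) * Real.exp (δ / 2 * ∑ j, ‖z j‖ ^ 2)) := by
          gcongr
          exact hC z
      _ = C * (1 + 2 / δ) * Real.exp (δ * ∑ j, ‖z j‖ ^ 2) := by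
          rw [mul_mul_mul_comm, ← Real.exp_add]
          congr 2
          ring

/-- Integration by parts for a polynomial in linear forms against a density. -/
theorem integral_aeval_mul_score {V ι : Type*} [NormedAddCommGroup V] [NormedSpace ℝ V]
    [FiniteDimensional ℝ V] [MeasurableSpace V] [BorelSpace V] (μ : Measure V)
    [μ.IsAddHaarMeasure] [Fintype ι] (L : V →ₗ[ℝ] (ι → ℂ)) (ρ : V → ℝ)
    (hint : ∀ p : MvPolynomial ι ℂ, Integrable (fun x => aeval (L x) p * (ρ x : ℂ)) μ)
    (v : V) (s : MvPolynomial ι ℂ)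
    (hs : ∀ x, HasLineDerivAt ℝ (fun y => (ρ y : ℂ)) (aeval (L x) s * (ρ x : ℂ)) x v)
    (p : MvPolynomial ι ℂ) :
    ∫ x, aeval (L x) (p * s) * (ρ x : ℂ) ∂μ =
      -∫ x, aeval (L x) (∑ i, L v i • pderiv i p) * (ρ x : ℂ) ∂μ := by
  have hderiv : ∀ q : MvPolynomial ι ℂ, ∀ x, HasLineDerivAt ℝ (fun y => aeval (L y) q)
      (aeval (L x) (∑ i, L v i • pderiv i q)) x v := by
    intro q x
    unfold HasLineDerivAt
    induction q using MvPolynomial.induction_on with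
    | C r => simpa using hasDerivAt_const (0 : ℝ) r
    | add p q hp hq =>
      have h := hp.add hq
      rw [← map_add, ← Finset.sum_add_distrib] at h
      simp only [map_add _ p q, smul_add]
      exact h
    | mul_X p i hp =>
      have h1 : HasDerivAt (fun t : ℝ => L (x + t • v) i) (L v i) 0 := by
        have h2 : HasDerivAt (fun t : ℝ => (t : ℂ) * L v i) (1 * L v i) 0 :=
          HasDerivAt.mul_const (by simpa using (hasDerivAt_id (0 : ℝ)).ofReal_comp) _
        simpa using h2.const_add (L x i)
      have h3 := hp.mul h1
      simp only [map_mul, aeval_X]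
      convert! h3 using 1
      classical
      simp only [Derivation.leibniz, smul_add, Finset.sum_add_distrib, map_add, map_sum, map_smul,
        smul_eq_mul, map_mul, aeval_X, pderiv_X, zero_smul, add_zero]
      rw [add_comm, Finset.sum_mul]
      congr 1
      · exact Finset.sum_congr rfl fun j _ => by ring
      · rw [Finset.sum_eq_single i]
        · simp [mul_comm]
        · intro j _ hj
          simp [hj.symm]
        · simp
  have hmain := integral_bilinear_hasLineDerivAt_right_eq_neg_left_of_integrable (μ := μ)
    (f := fun x => aeval (L x) p) (f' := fun x => aeval (L x) (∑ i, L v i • pderiv i p))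
    (g := fun x => (ρ x : ℂ)) (g' := fun x => aeval (L x) s * (ρ x : ℂ)) (v := v)
    (B := ContinuousLinearMap.mul ℝ ℂ) (hint _)
    ((hint (p * s)).congr (Eventually.of_forall fun x => by simp [mul_assoc])) (hint p)
    (fun x _ => hderiv p x) (fun x _ => hs x)
  refine Eq.trans ?_ hmain
  refine integral_congr_ae (Eventually.of_forall fun x => ?_)
  simp [mul_assoc]

variable {N : ℕ}

instance : (volume : Measure (HermCoord N)).IsAddHaarMeasure :=
  Measure.prod.instIsAddHaarMeasure (volume : Measure (Fin N → ℝ))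
    (volume : Measure ({p : Fin N × Fin N // p.1 < p.2} → ℂ))

/-- The Gaussian density on vectors with source `β`. -/
def vecDensity (β : Fin N → ℝ) (x : Fin N → ℝ) : ℝ :=
  Real.exp (∑ i, (β i * x i - x i ^ 2 / 2))

/-- `∑ |M_ij|²` for the Hermitian matrix with coordinates `c`. -/
def hermNormSq (c : HermCoord N) : ℝ := ∑ i, ∑ j, ‖hermMatrix c i j‖ ^ 2

/-- The Gaussian density on Hermitian matrices with source `diag β`. -/
def hermDensity (β : Fin N → ℝ) (c : HermCoord N) : ℝ :=
  Real.exp (∑ i, β i * c.1 i - hermNormSq c / 2)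

theorem hermMatrix_self (c : HermCoord N) (i : Fin N) : hermMatrix c i i = (c.1 i : ℂ) := by
  simp [hermMatrix]

theorem hermMatrix_lt (c : HermCoord N) (p : {p : Fin N × Fin N // p.1 < p.2}) :
    hermMatrix c p.1.1 p.1.2 = c.2 p := by
  simp [hermMatrix, p.2]

theorem hermMatrix_gt (c : HermCoord N) (p : {p : Fin N × Fin N // p.1 < p.2}) :
    hermMatrix c p.1.2 p.1.1 = star (c.2 p) := by
  simp [hermMatrix, p.2, p.2.not_gt]

theorem hermNormSq_eq (c : HermCoord N) :
    hermNormSq c = ∑ i, c.1 i ^ 2 + 2 * ∑ p, ‖c.2 p‖ ^ 2 := by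
  have hs : ∀ i j, ‖hermMatrix c i j‖ ^ 2 = ‖hermMatrix c j i‖ ^ 2 := by
    intro i j
    rw [← (hermMatrix_isHermitian c).apply i j, norm_star]
  have h := two_mul_sum_Ioi_eq (fun i j => ‖hermMatrix c i j‖ ^ 2) hs
  have h2 : ∑ i, ∑ j ∈ Finset.Ioi i, ‖hermMatrix c i j‖ ^ 2 = ∑ p, ‖c.2 p‖ ^ 2 := by
    have h3 : ∀ p, ‖c.2 p‖ ^ 2 = ‖hermMatrix c p.1.1 p.1.2‖ ^ 2 := fun p => by
      rw [hermMatrix_lt c p]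
    rw [Finset.sum_sigma', Finset.sum_congr rfl fun p _ => h3 p]
    refine Finset.sum_bij' (fun x hx => ⟨(x.1, x.2), by simpa using hx⟩)
      (fun p _ => ⟨p.1.1, p.1.2⟩) ?_ ?_ ?_ ?_ ?_
    · simp
    · rintro ⟨⟨i, j⟩, hp⟩ _
      simpa using hp
    · simp
    · simp
    · simp
  unfold hermNormSq
  rw [← h2]
  simp only [hermMatrix_self, Complex.norm_real, Real.norm_eq_abs, sq_abs] at h
  linarith

/-- The entries of a Hermitian matrix as a real-linear map. -/
def hermEntries : HermCoord N →ₗ[ℝ] (Fin N × Fin N → ℂ) where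
  toFun c p := hermMatrix c p.1 p.2
  map_add' c d := by
    ext ⟨i, j⟩
    rcases lt_trichotomy i j with h | h | h
    · simp [hermMatrix, h]
    · subst h; simp [hermMatrix]
    · simp [hermMatrix, h, h.not_gt]
  map_smul' r c := by
    ext ⟨i, j⟩
    rcases lt_trichotomy i j with h | h | h
    · simp [hermMatrix, h]
    · subst h; simp [hermMatrix]
    · simp [hermMatrix, h, h.not_gt]

theorem hermEntries_apply (c : HermCoord N) (p : Fin N × Fin N) :
    hermEntries c p = hermMatrix c p.1 p.2 := rfl

/-- The coordinates of a real vector as complex numbers. -/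
def vecEntries : (Fin N → ℝ) →ₗ[ℝ] (Fin N → ℂ) where
  toFun x i := (x i : ℂ)
  map_add' x y := by ext; simp
  map_smul' r x := by ext; simp

theorem vecEntries_apply (x : Fin N → ℝ) (i : Fin N) : vecEntries x i = (x i : ℂ) := rfl

theorem integrable_exp_linear_sub_sq {s : ℝ} (hs : 0 < s) (b : ℝ) :
    Integrable fun x : ℝ => Real.exp (b * x - s * x ^ 2) := by
  have h := integrable_cexp_quadratic (b := (s : ℂ)) (by simpa using hs) (b : ℂ) 0
  refine (h.norm).congr (Eventually.of_forall fun x => ?_)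
  simp only [Complex.norm_exp]
  congr 1
  simp [pow_two]
  ring

theorem integrable_exp_neg_mul_norm_sq {s : ℝ} (hs : 0 < s) :
    Integrable fun z : ℂ => Real.exp (-s * ‖z‖ ^ 2) := by
  rw [← Complex.volume_preserving_equiv_real_prod.symm.integrable_comp_emb
    Complex.measurableEquivRealProd.symm.measurableEmbedding]
  have h := (integrable_exp_neg_mul_sq hs).mul_prod (integrable_exp_neg_mul_sq hs)
  refine h.congr (Eventually.of_forall fun x => ?_)
  simp only [Function.comp, ← Real.exp_add]
  congr 1
  rw [← Complex.normSq_eq_norm_sq, Complex.normSq_apply]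
  simp [Complex.measurableEquivRealProd_symm_apply]
  ring

theorem integrable_vecGaussian {s : ℝ} (hs : 0 < s) (β : Fin N → ℝ) :
    Integrable fun x : Fin N → ℝ => Real.exp (∑ i, (β i * x i - s * x i ^ 2)) := by
  simp only [Real.exp_sum]
  exact Integrable.fintype_prod (f := fun i (x : ℝ) => Real.exp (β i * x - s * x ^ 2))
    fun i => integrable_exp_linear_sub_sq hs (β i)

theorem integrable_hermGaussian {s : ℝ} (hs : 0 < s) (β : Fin N → ℝ) :
    Integrable fun c : HermCoord N => Real.exp (∑ i, β i * c.1 i - s * hermNormSq c) := by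
  have h1 := integrable_vecGaussian hs β
  have h2 : Integrable fun z : {p : Fin N × Fin N // p.1 < p.2} → ℂ =>
      ∏ p, Real.exp (-(2 * s) * ‖z p‖ ^ 2) :=
    Integrable.fintype_prod (f := fun _ (z : ℂ) => Real.exp (-(2 * s) * ‖z‖ ^ 2))
      fun _ => integrable_exp_neg_mul_norm_sq (by positivity)
  refine (h1.mul_prod h2).congr (Eventually.of_forall fun c => ?_)
  simp only
  rw [← Real.exp_sum, ← Real.exp_add, hermNormSq_eq]
  congr 1
  rw [Finset.sum_sub_distrib, ← Finset.mul_sum, ← Finset.mul_sum]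
  ring

theorem continuous_hermMatrix_apply (i j : Fin N) :
    Continuous fun c : HermCoord N => hermMatrix c i j := by
  exact ((LinearMap.proj (i, j)).comp hermEntries).continuous_of_finiteDimensional

theorem continuous_hermNormSq : Continuous (hermNormSq : HermCoord N → ℝ) := by
  unfold hermNormSq
  have := continuous_hermMatrix_apply (N := N)
  fun_prop

theorem continuous_hermDensity (β : Fin N → ℝ) : Continuous (hermDensity β) := by
  unfold hermDensity
  have := continuous_hermNormSq (N := N)
  fun_prop

theorem continuous_vecDensity (β : Fin N → ℝ) : Continuous (vecDensity β) := by
  unfold vecDensity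
  fun_prop

theorem continuous_aeval {V ι : Type*} [TopologicalSpace V] (p : MvPolynomial ι ℂ) (f : V → ι → ℂ)
    (hf : ∀ i, Continuous fun x => f x i) : Continuous fun x => aeval (f x) p := by
  induction p using MvPolynomial.induction_on with
  | C r => simpa using continuous_const
  | add p q hp hq =>
    simp only [map_add]
    exact hp.add hq
  | mul_X p i hp =>
    simp only [map_mul, aeval_X]
    exact hp.mul (hf i)

theorem integrable_aeval_mul_hermDensity (β : Fin N → ℝ) (p : MvPolynomial (Fin N × Fin N) ℂ) :
    Integrable fun c : HermCoord N => aeval (hermEntries c) p * (hermDensity β c : ℂ) := by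
  -- Half of the quadratic decay `1/2` pays for the polynomial, and `1/4` is left for integrability.
  obtain ⟨C, hC⟩ := exists_norm_aeval_le p (1 / 4) (by norm_num)
  refine Integrable.mono' ((integrable_hermGaussian (s := 1 / 4) (by norm_num) β).const_mul C)
    ?_ (Eventually.of_forall fun c => ?_)
  · refine (Continuous.mul ?_ ?_).aestronglyMeasurable
    · exact continuous_aeval p _ fun i => continuous_hermMatrix_apply i.1 i.2
    · exact Complex.continuous_ofReal.comp (continuous_hermDensity β)
  · rw [norm_mul, Complex.norm_real, Real.norm_eq_abs, hermDensity, Real.abs_exp]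
    refine (mul_le_mul_of_nonneg_right (hC _) (Real.exp_pos _).le).trans_eq ?_
    rw [mul_assoc, ← Real.exp_add]
    congr 2
    simp only [Fintype.sum_prod_type, hermEntries_apply]
    rw [← hermNormSq]
    ring

theorem integrable_aeval_mul_vecDensity (β : Fin N → ℝ) (p : MvPolynomial (Fin N) ℂ) :
    Integrable fun x : Fin N → ℝ => aeval (vecEntries x) p * (vecDensity β x : ℂ) := by
  obtain ⟨C, hC⟩ := exists_norm_aeval_le p (1 / 4) (by norm_num)
  refine Integrable.mono' ((integrable_vecGaussian (s := 1 / 4) (by norm_num) β).const_mul C)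
    ?_ (Eventually.of_forall fun x => ?_)
  · refine (Continuous.mul ?_ ?_).aestronglyMeasurable
    · exact continuous_aeval p _ fun i => Complex.continuous_ofReal.comp (continuous_apply i)
    · exact Complex.continuous_ofReal.comp (continuous_vecDensity β)
  · rw [norm_mul, Complex.norm_real, Real.norm_eq_abs, vecDensity, Real.abs_exp]
    refine (mul_le_mul_of_nonneg_right (hC _) (Real.exp_pos _).le).trans_eq ?_
    rw [mul_assoc, ← Real.exp_add]
    congr 2
    simp only [vecEntries_apply, Complex.norm_real, Real.norm_eq_abs, sq_abs]
    rw [Finset.mul_sum, ← Finset.sum_add_distrib]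
    exact Finset.sum_congr rfl fun i _ => by ring

/-- Integration of polynomials in the entries against the Gaussian density. -/
def hermFunctional (β : Fin N → ℝ) : MvPolynomial (Fin N × Fin N) ℂ →ₗ[ℂ] ℂ where
  toFun p := ∫ c : HermCoord N, aeval (hermEntries c) p * (hermDensity β c : ℂ)
  map_add' p q := by
    simp only [map_add, add_mul]
    exact integral_add (integrable_aeval_mul_hermDensity β p) (integrable_aeval_mul_hermDensity β q)
  map_smul' r p := by
    simp only [map_smul, smul_eq_mul, mul_assoc, RingHom.id_apply]
    exact integral_const_mul _ _

/-- Integration of polynomials in the coordinates against the Gaussian density. -/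
def vecFunctional (β : Fin N → ℝ) : MvPolynomial (Fin N) ℂ →ₗ[ℂ] ℂ where
  toFun p := ∫ x : Fin N → ℝ, aeval (vecEntries x) p * (vecDensity β x : ℂ)
  map_add' p q := by
    simp only [map_add, add_mul]
    exact integral_add (integrable_aeval_mul_vecDensity β p) (integrable_aeval_mul_vecDensity β q)
  map_smul' r p := by
    simp only [map_smul, smul_eq_mul, mul_assoc, RingHom.id_apply]
    exact integral_const_mul _ _

theorem hasLineDerivAt_cexp_quadratic {V : Type*} [AddCommGroup V] [Module ℝ V] (Q : V → ℝ)
    (x v : V) (d : ℝ) (h : HasDerivAt (fun t : ℝ => Q (x + t • v)) d 0) :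
    HasLineDerivAt ℝ (fun y => ((Real.exp (Q y) : ℝ) : ℂ)) ((d : ℂ) * (Real.exp (Q x) : ℝ)) x v := by
  unfold HasLineDerivAt
  have := (h.exp).ofReal_comp
  simpa [mul_comm] using this

theorem vecFunctional_X_mul (β : Fin N → ℝ) (i : Fin N) (p : MvPolynomial (Fin N) ℂ) :
    vecFunctional β (X i * p) = (β i : ℂ) * vecFunctional β p + vecFunctional β (pderiv i p) := by
  have h := integral_aeval_mul_score volume vecEntries (vecDensity β)
    (integrable_aeval_mul_vecDensity β) (Pi.single i 1) (C (β i : ℂ) - X i) (fun x => ?_) p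
  · have hsum : ∑ j, (vecEntries (Pi.single i 1 : Fin N → ℝ) j) • pderiv j p = pderiv i p := by
      rw [Finset.sum_eq_single i]
      · simp [vecEntries_apply]
      · intro j _ hj
        simp [vecEntries_apply, hj]
      · simp
    rw [hsum] at h
    have h' : vecFunctional β (p * (C (β i : ℂ) - X i)) = -vecFunctional β (pderiv i p) := h
    have e : p * (C (β i : ℂ) - X i) = (β i : ℂ) • p - X i * p := by
      rw [MvPolynomial.smul_eq_C_mul]; ring
    rw [e, map_sub, map_smul, smul_eq_mul] at h'
    linear_combination -h'
  · have h1 : HasDerivAt (fun t : ℝ => ∑ j, (β j * (x + t • (Pi.single i 1 : Fin N → ℝ)) j -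
        (x + t • (Pi.single i 1 : Fin N → ℝ)) j ^ 2 / 2)) (β i - x i) 0 := by
      have h2 : ∀ j, HasDerivAt (fun t : ℝ => (x + t • (Pi.single i 1 : Fin N → ℝ)) j)
          ((Pi.single i 1 : Fin N → ℝ) j) 0 := by
        intro j
        simpa using ((hasDerivAt_id (0 : ℝ)).mul_const
          ((Pi.single i 1 : Fin N → ℝ) j)).const_add (x j)
      have h3 := HasDerivAt.fun_sum (u := Finset.univ) fun j _ =>
        (((h2 j).const_mul (β j)).sub (((h2 j).pow 2).div_const 2))
      convert! h3 using 1
      rw [Finset.sum_eq_single i]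
      · simp
      · intro j _ hj
        simp [hj]
      · simp
    have h4 := hasLineDerivAt_cexp_quadratic
      (fun y : Fin N → ℝ => ∑ j, (β j * y j - y j ^ 2 / 2)) x (Pi.single i 1) _ h1
    simpa [vecDensity, vecEntries_apply] using h4

/-- Here `d` is the derivative of the exponent of the density in direction `v`, and `s` is the
polynomial representing it. Off-diagonal coordinates enter `Tr M²` twice, whence the factor 2. -/
theorem hermFunctional_score (β : Fin N → ℝ) (v : HermCoord N)
    (s : MvPolynomial (Fin N × Fin N) ℂ) (d : HermCoord N → ℝ)
    (hd : ∀ c : HermCoord N, d c = ∑ i, v.1 i * (β i - c.1 i) -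
      2 * ∑ p, ((c.2 p).re * (v.2 p).re + (c.2 p).im * (v.2 p).im))
    (hs : ∀ c : HermCoord N, aeval (hermEntries c) s = (d c : ℂ))
    (p : MvPolynomial (Fin N × Fin N) ℂ) :
    hermFunctional β (p * s) = -hermFunctional β (∑ i, hermEntries v i • pderiv i p) := by
  refine integral_aeval_mul_score volume hermEntries (hermDensity β)
    (integrable_aeval_mul_hermDensity β) v s (fun c => ?_) p
  rw [hs]
  refine hasLineDerivAt_cexp_quadratic
    (fun c : HermCoord N => ∑ i, β i * c.1 i - hermNormSq c / 2) c v _ ?_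
  have hlin : ∀ a b : ℝ, HasDerivAt (fun t : ℝ => a + t * b) b 0 := by
    intro a b
    simpa using ((hasDerivAt_id (0 : ℝ)).mul_const b).const_add a
  have h1 := HasDerivAt.fun_sum (u := Finset.univ) fun (j : Fin N) _ =>
    ((hlin (c.1 j) (v.1 j)).const_mul (β j))
  have h2 := HasDerivAt.fun_sum (u := Finset.univ) fun (j : Fin N) _ =>
    ((hlin (c.1 j) (v.1 j)).pow 2)
  have h3 := HasDerivAt.fun_sum (u := Finset.univ)
    fun (q : {p : Fin N × Fin N // p.1 < p.2}) _ =>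
    ((hlin (c.2 q).re (v.2 q).re).pow 2).add ((hlin (c.2 q).im (v.2 q).im).pow 2)
  have h4 := h1.sub ((h2.add (h3.const_mul 2)).div_const 2)
  convert! h4 using 1
  · ext t
    simp only [hermNormSq_eq, ← Complex.normSq_eq_norm_sq, Complex.normSq_apply]
    simp [pow_two]
  · rw [hd]
    have e1 : ∑ i, v.1 i * (β i - c.1 i) = ∑ i, β i * v.1 i - ∑ i, c.1 i * v.1 i := by
      rw [← Finset.sum_sub_distrib]
      exact Finset.sum_congr rfl fun i _ => by ring
    have e2 : ∑ i, ((2 : ℕ) : ℝ) * (c.1 i + 0 * v.1 i) ^ (2 - 1) * v.1 i =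
        2 * ∑ i, c.1 i * v.1 i := by
      rw [Finset.mul_sum]
      exact Finset.sum_congr rfl fun i _ => by simp; ring
    have e3 : ∑ q : {p : Fin N × Fin N // p.1 < p.2},
        (((2 : ℕ) : ℝ) * ((c.2 q).re + 0 * (v.2 q).re) ^ (2 - 1) * (v.2 q).re +
          ((2 : ℕ) : ℝ) * ((c.2 q).im + 0 * (v.2 q).im) ^ (2 - 1) * (v.2 q).im) =
        2 * ∑ p, ((c.2 p).re * (v.2 p).re + (c.2 p).im * (v.2 p).im) := by
      rw [Finset.mul_sum]
      exact Finset.sum_congr rfl fun i _ => by simp; ring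
    rw [e1, e2, e3]
    ring

theorem hermFunctional_X_mul_diag (β : Fin N → ℝ) (i : Fin N)
    (p : MvPolynomial (Fin N × Fin N) ℂ) :
    hermFunctional β (X (i, i) * p) =
      (β i : ℂ) * hermFunctional β p + hermFunctional β (pderiv (i, i) p) := by
  have h := hermFunctional_score β (Pi.single i 1, 0) (C (β i : ℂ) - X (i, i))
    (fun c => β i - c.1 i) (fun c => ?_) (fun c => ?_) p
  · have hsum : ∑ j, (hermEntries (Pi.single i 1, 0) j) • pderiv j p = pderiv (i, i) p := by
      rw [Finset.sum_eq_single (i, i)]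
      · simp [hermEntries_apply, hermMatrix_self]
      · rintro ⟨j, k⟩ _ hj
        have : hermMatrix ((Pi.single i 1, 0) : HermCoord N) j k = 0 := by
          by_cases hjk : j = k
          · subst hjk
            have : j ≠ i := by rintro rfl; exact hj rfl
            simp [hermMatrix_self, this]
          · simp [hermMatrix]
            rcases lt_or_gt_of_ne hjk with h | h <;> simp [h]
        simp [hermEntries_apply, this]
      · simp
    rw [hsum] at h
    have e : p * (C (β i : ℂ) - X (i, i)) = (β i : ℂ) • p - X (i, i) * p := by
      rw [MvPolynomial.smul_eq_C_mul]; ring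
    rw [e, map_sub, map_smul, smul_eq_mul] at h
    linear_combination -h
  · rw [Finset.sum_eq_single i]
    · simp
    · intro j _ hj
      simp [hj]
    · simp
  · simp [hermEntries_apply, hermMatrix_self]

theorem sum_hermEntries_offDiag (q : {p : Fin N × Fin N // p.1 < p.2}) (z : ℂ)
    (p : MvPolynomial (Fin N × Fin N) ℂ) :
    ∑ j, (hermEntries ((0, Pi.single q z) : HermCoord N) j) • pderiv j p =
      z • pderiv q.1 p + (star z) • pderiv q.1.swap p := by
  obtain ⟨⟨i, k⟩, hik⟩ := q
  have hne : (i, k) ≠ (k, i) := by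
    intro h
    exact (ne_of_lt hik) (Prod.ext_iff.1 h).1
  rw [Fintype.sum_eq_add (i, k) (k, i) hne]
  · have h1 := hermMatrix_lt ((0, Pi.single ⟨(i, k), hik⟩ z) : HermCoord N) ⟨(i, k), hik⟩
    have h2 := hermMatrix_gt ((0, Pi.single ⟨(i, k), hik⟩ z) : HermCoord N) ⟨(i, k), hik⟩
    simp only [Pi.single_eq_same] at h1 h2
    simp only [hermEntries_apply, h1, h2, Prod.swap]
  · rintro ⟨a, b⟩ ⟨hab1, hab2⟩
    have : hermMatrix ((0, Pi.single ⟨(i, k), hik⟩ z) : HermCoord N) a b = 0 := by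
      rcases lt_trichotomy a b with h | h | h
      · rw [hermMatrix_lt _ ⟨(a, b), h⟩]
        simp [hab1]
      · subst h
        simp [hermMatrix_self]
      · rw [hermMatrix_gt _ ⟨(b, a), h⟩]
        have : (b, a) ≠ (i, k) := by
          intro h'
          apply hab2
          rw [Prod.ext_iff] at h' ⊢
          exact ⟨h'.2, h'.1⟩
        simp [this]
    simp [hermEntries_apply, this]

/-- A real direction in an off-diagonal coordinate moves the entry and its conjugate together, so
integration by parts yields only a combination of the two identities. The directions `1` and `I`
give two independent combinations, which are then solved. -/
theorem hermFunctional_X_mul_offDiag (β : Fin N → ℝ) (q : {p : Fin N × Fin N // p.1 < p.2})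
    (p : MvPolynomial (Fin N × Fin N) ℂ) :
    hermFunctional β (X q.1 * p) = hermFunctional β (pderiv q.1.swap p) ∧
      hermFunctional β (X q.1.swap * p) = hermFunctional β (pderiv q.1 p) := by
  have key : ∀ z : ℂ, hermFunctional β (p * (-(z • X q.1.swap) - star z • X q.1)) =
      -hermFunctional β (z • pderiv q.1 p + (star z) • pderiv q.1.swap p) := by
    intro z
    have h := hermFunctional_score β (0, Pi.single q z) (-(z • X q.1.swap) - star z • X q.1)
      (fun c => -2 * ((c.2 q).re * z.re + (c.2 q).im * z.im)) (fun c => ?_) (fun c => ?_) p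
    · rw [h, sum_hermEntries_offDiag]
    · rw [Finset.sum_eq_single (f := fun r : {p : Fin N × Fin N // p.1 < p.2} => _) q]
      · simp
      · intro r _ hr
        simp [hr]
      · simp
    · have h1 := hermMatrix_lt c q
      have h2 := hermMatrix_gt c q
      simp only [map_sub, map_neg, map_smul, aeval_X, hermEntries_apply, Prod.fst_swap,
        Prod.snd_swap, h1, h2, smul_eq_mul]
      apply Complex.ext <;> simp <;> ring
  have h1 := key 1
  have h2 := key Complex.I
  have e1 : p * (-((1 : ℂ) • X q.1.swap) - star (1 : ℂ) • X q.1) =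
      -(X q.1.swap * p) - X q.1 * p := by
    simp only [one_smul, star_one]; ring
  have e2 : p * (-(Complex.I • X q.1.swap) - star Complex.I • X q.1) =
      Complex.I • (X q.1 * p - X q.1.swap * p) := by
    simp only [Complex.star_def, Complex.conj_I, neg_smul, MvPolynomial.smul_eq_C_mul]; ring
  rw [e1] at h1
  rw [e2] at h2
  simp only [one_smul, star_one, Complex.star_def, Complex.conj_I, neg_smul, map_add, map_sub,
    map_neg, map_smul, smul_eq_mul] at h1 h2
  have h3 := mul_left_cancel₀ Complex.I_ne_zero (h2.trans (by ring :
    _ = Complex.I * (hermFunctional β (pderiv q.1.swap p) - hermFunctional β (pderiv q.1 p))))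
  constructor
  · linear_combination (h3 - h1) / 2
  · linear_combination (-h1 - h3) / 2

/-- The Gaussian covariance couples entry `(i, j)` with entry `(j, i)` only. This is why the
relevant involution on matrix entries is `Prod.swap`. -/
theorem hermFunctional_X_mul (β : Fin N → ℝ) (i : Fin N × Fin N)
    (p : MvPolynomial (Fin N × Fin N) ℂ) :
    hermFunctional β (X i * p) = Matrix.diagonal (fun j => (β j : ℂ)) i.1 i.2 * hermFunctional β p +
      hermFunctional β (pderiv i.swap p) := by
  obtain ⟨i, j⟩ := i
  rcases lt_trichotomy i j with h | h | h
  · have := (hermFunctional_X_mul_offDiag β ⟨(i, j), h⟩ p).1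
    simp [this, h.ne]
  · subst h
    simpa using hermFunctional_X_mul_diag β i p
  · have := (hermFunctional_X_mul_offDiag β ⟨(j, i), h⟩ p).2
    simp only [Prod.swap] at this
    simp [this, h.ne']

theorem trace_hermMatrix_pow (c : HermCoord N) (k : ℕ) :
    (hermMatrix c ^ k).trace = ∑ i, ((eigs c i : ℝ) : ℂ) ^ k := by
  have h := (hermMatrix_isHermitian c).spectral_theorem
  conv_lhs => rw [h, ← map_pow]
  rw [Unitary.conjStarAlgAut_apply, Matrix.trace_mul_cycle]
  simp [Matrix.diagonal_pow, Matrix.trace_diagonal, eigs]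

theorem sum_eigs_sq (c : HermCoord N) : ∑ i, eigs c i ^ 2 = hermNormSq c := by
  have h := trace_hermMatrix_pow c 2
  have h2 : (hermMatrix c ^ 2).trace = ((hermNormSq c : ℝ) : ℂ) := by
    rw [pow_two, Matrix.trace, hermNormSq]
    push_cast
    refine Finset.sum_congr rfl fun i _ => ?_
    rw [Matrix.diag_apply, Matrix.mul_apply]
    refine Finset.sum_congr rfl fun j _ => ?_
    rw [← (hermMatrix_isHermitian c).apply j i, Complex.star_def, Complex.mul_conj]
    rw [Complex.normSq_eq_norm_sq]
    push_cast
    rfl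
  rw [h2] at h
  exact_mod_cast h.symm

/-- Completing the square is the translation by `diag β`. The resulting factor is the same as for
vectors, so the ratio of the two masses does not depend on the source. -/
theorem integral_hermDensity (β : Fin N → ℝ) : ∫ c : HermCoord N, hermDensity β c =
    Real.exp (∑ i, β i ^ 2 / 2) * ∫ c : HermCoord N, hermDensity 0 c := by
  rw [← integral_const_mul]
  conv_rhs => rw [← integral_sub_right_eq_self _ ((β, 0) : HermCoord N)]
  refine integral_congr_ae (Eventually.of_forall fun c => ?_)
  simp only [hermDensity]
  rw [← Real.exp_add]
  congr 1
  simp only [hermNormSq_eq, Prod.fst_sub, Prod.snd_sub, Pi.sub_apply, sub_zero, Pi.zero_apply,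
    zero_mul, Finset.sum_const_zero, zero_sub]
  have : ∑ i, (c.1 i - β i) ^ 2 = ∑ i, c.1 i ^ 2 - 2 * ∑ i, β i * c.1 i + 2 * ∑ i, β i ^ 2 / 2 := by
    rw [Finset.mul_sum, Finset.mul_sum, ← Finset.sum_sub_distrib, ← Finset.sum_add_distrib]
    exact Finset.sum_congr rfl fun i _ => by ring
  rw [this]
  ring

theorem integral_vecDensity (β : Fin N → ℝ) : ∫ x, vecDensity β x =
    Real.exp (∑ i, β i ^ 2 / 2) * ∫ x : Fin N → ℝ, vecDensity 0 x := by
  rw [← integral_const_mul]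
  conv_rhs => rw [← integral_sub_right_eq_self _ β]
  refine integral_congr_ae (Eventually.of_forall fun c => ?_)
  simp only [vecDensity]
  rw [← Real.exp_add, ← Finset.sum_add_distrib]
  congr 1
  refine Finset.sum_congr rfl fun i _ => ?_
  simp
  ring

variable (N) in
/-- The ratio of the total masses of the standard Gaussian densities on vectors and matrices. -/
def gaussianRatio : ℝ := (∫ x : Fin N → ℝ, vecDensity 0 x) / ∫ c : HermCoord N, hermDensity 0 c

theorem integral_hermDensity_pos : 0 < ∫ c : HermCoord N, hermDensity 0 c := by
  have : NeZero (volume : Measure (HermCoord N)) := ⟨fun h =>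
    (isOpen_univ.measure_pos (volume : Measure (HermCoord N)) Set.univ_nonempty).ne'
      (by rw [h]; rfl)⟩
  refine integral_exp_pos ?_
  simpa [hermDensity, div_eq_inv_mul] using
    integrable_hermGaussian (N := N) (s := 1 / 2) (by norm_num) 0

theorem integral_vecDensity_pos : 0 < ∫ x : Fin N → ℝ, vecDensity 0 x := by
  refine integral_exp_pos ?_
  simpa [vecDensity, div_eq_inv_mul] using
    integrable_vecGaussian (N := N) (s := 1 / 2) (by norm_num) 0

theorem gaussianRatio_pos : 0 < gaussianRatio N :=
  div_pos integral_vecDensity_pos integral_hermDensity_pos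

/-- The joint law of the eigenvalues of a Gaussian matrix with a diagonal source, tested against
symmetric polynomials. -/
theorem integral_symmetric_eigs (β : Fin N → ℝ) {g : MvPolynomial (Fin N) ℂ}
    (hg : g.IsSymmetric) :
    ∫ x : Fin N → ℝ, aeval (vecEntries x) (vandermondePoly N * g) * (vecDensity β x : ℂ) =
      (gaussianRatio N : ℂ) * aeval (vecEntries β) (vandermondePoly N) *
        ∫ c : HermCoord N, aeval (vecEntries (eigs c)) g * (hermDensity β c : ℂ) := by
  obtain ⟨f, hf⟩ := exists_mem_traceAlgebra_of_isSymmetric hg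
  have h := stein_functionals_eq (hermFunctional β) (vecFunctional β) (fun i => (β i : ℂ))
    (hermFunctional_X_mul β) (vecFunctional_X_mul β) hf
  have h1 : hermFunctional β 1 = ((∫ c : HermCoord N, hermDensity β c : ℝ) : ℂ) := by
    rw [← integral_complex_ofReal]
    simp [hermFunctional]
  have h2 : vecFunctional β 1 = ((∫ c : Fin N → ℝ, vecDensity β c : ℝ) : ℂ) := by
    rw [← integral_complex_ofReal]
    simp [vecFunctional]
  have h3 : hermFunctional β f =
      ∫ c : HermCoord N, aeval (vecEntries (eigs c)) g * (hermDensity β c : ℂ) := by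
    refine integral_congr_ae (Eventually.of_forall fun c => ?_)
    simp only
    congr 1
    exact aeval_eq_of_mem_traceAlgebra hf (hermMatrix c) (vecEntries (eigs c))
      (trace_hermMatrix_pow c)
  have h4 : vecFunctional β (vandermondePoly N * g) =
    ∫ x : Fin N → ℝ, aeval (vecEntries x) (vandermondePoly N * g) * (vecDensity β x : ℂ) := rfl
  rw [h1, h2, h3, integral_hermDensity, integral_vecDensity] at h
  rw [← h4, gaussianRatio]
  have e1 := (integral_hermDensity_pos (N := N)).ne'
  have e2 := (Real.exp_pos (∑ i, β i ^ 2 / 2)).ne'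
  have e1' : ((∫ c : HermCoord N, hermDensity 0 c : ℝ) : ℂ) ≠ 0 := by exact_mod_cast e1
  have e2' : ((Real.exp (∑ i, β i ^ 2 / 2) : ℝ) : ℂ) ≠ 0 := by exact_mod_cast e2
  have hb : (fun i => (β i : ℂ)) = vecEntries β := rfl
  rw [hb] at h
  simp only [Complex.ofReal_mul, Complex.ofReal_div] at h ⊢
  field_simp
  refine mul_right_cancel₀ e2' ?_
  linear_combination h

end Gaussian

/-! ### Measures determined by their moments -/

section Moments

variable {N : ℕ}

theorem continuous_aeval_vecEntries (p : MvPolynomial (Fin N) ℂ) :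
    Continuous fun x : Fin N → ℝ => aeval (vecEntries x) p :=
  continuous_aeval p _ fun i => Complex.continuous_ofReal.comp (continuous_apply i)

theorem exists_norm_aeval_vecEntries_le (p : MvPolynomial (Fin N) ℂ) :
    ∃ C c : ℝ, ∀ x : Fin N → ℝ, ‖aeval (vecEntries x) p‖ ≤ C * Real.exp (c * ∑ i, |x i|) := by
  induction p using MvPolynomial.induction_on with
  | C r => exact ⟨‖r‖, 0, fun x => by simp⟩
  | add p q hp hq =>
    obtain ⟨C, c, h⟩ := hp
    obtain ⟨D, d, h'⟩ := hq
    have hC : 0 ≤ C := by simpa using (norm_nonneg _).trans (h 0)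
    have hD : 0 ≤ D := by simpa using (norm_nonneg _).trans (h' 0)
    refine ⟨C + D, max c d, fun x => ?_⟩
    have hx : 0 ≤ ∑ i, |x i| := Finset.sum_nonneg fun i _ => abs_nonneg _
    rw [map_add, add_mul]
    refine (norm_add_le _ _).trans (add_le_add ((h x).trans ?_) ((h' x).trans ?_))
    · gcongr
      exact le_max_left _ _
    · gcongr
      exact le_max_right _ _
  | mul_X p i hp =>
    obtain ⟨C, c, h⟩ := hp
    have hC : 0 ≤ C := by simpa using (norm_nonneg _).trans (h 0)
    refine ⟨C, c + 1, fun x => ?_⟩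
    have h1 : |x i| ≤ ∑ j, |x j| :=
      Finset.single_le_sum (f := fun j => |x j|) (fun j _ => abs_nonneg _) (Finset.mem_univ i)
    have h2 : |x i| ≤ Real.exp (∑ j, |x j|) := by
      linarith [Real.add_one_le_exp (∑ j, |x j|)]
    rw [map_mul, aeval_X, norm_mul, vecEntries_apply, Complex.norm_real, Real.norm_eq_abs,
      add_mul, one_mul, Real.exp_add, ← mul_assoc]
    gcongr
    exact h x

theorem integrable_aeval_vecEntries {μ : Measure (Fin N → ℝ)}
    (hμ : ∀ c : ℝ, Integrable (fun x => Real.exp (c * ∑ i, |x i|)) μ)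
    (p : MvPolynomial (Fin N) ℂ) : Integrable (fun x => aeval (vecEntries x) p) μ := by
  obtain ⟨C, c, h⟩ := exists_norm_aeval_vecEntries_le p
  exact ((hμ c).const_mul C).mono' (continuous_aeval_vecEntries p).aestronglyMeasurable
    (Eventually.of_forall h)

/-- Finite measures with exponential moments are determined by their moments. -/
theorem measure_ext_of_moments {μ ν : Measure (Fin N → ℝ)} [IsFiniteMeasure μ] [IsFiniteMeasure ν]
    (hμ : ∀ c : ℝ, Integrable (fun x => Real.exp (c * ∑ i, |x i|)) μ)
    (hν : ∀ c : ℝ, Integrable (fun x => Real.exp (c * ∑ i, |x i|)) ν)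
    (h : ∀ p : MvPolynomial (Fin N) ℂ,
      ∫ x, aeval (vecEntries x) p ∂μ = ∫ x, aeval (vecEntries x) p ∂ν) : μ = ν := by
  refine Measure.ext_of_charFunDual (funext fun L => ?_)
  let a : Fin N → ℝ := fun i => L (Pi.single i 1)
  have hL : ∀ x, L x = ∑ i, x i * a i := by
    intro x
    conv_lhs => rw [← Finset.univ_sum_single x, map_sum]
    refine Finset.sum_congr rfl fun i _ => ?_
    have : (Pi.single i (x i) : Fin N → ℝ) = x i • Pi.single i 1 := by
      ext j
      by_cases hj : j = i
      · subst hj; simp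
      · simp [hj]
    rw [this, map_smul, smul_eq_mul]
  let c : ℝ := ∑ i, |a i|
  have hLc : ∀ x, |L x| ≤ c * ∑ i, |x i| := by
    intro x
    rw [hL]
    refine (Finset.abs_sum_le_sum_abs _ _).trans ?_
    rw [Finset.mul_sum]
    refine Finset.sum_le_sum fun i _ => ?_
    rw [abs_mul, mul_comm]
    gcongr
    exact Finset.single_le_sum (f := fun j => |a j|) (fun j _ => abs_nonneg _) (Finset.mem_univ i)
  -- The terms of the series of `e^{iL}` as polynomials. Exponential moments dominate the whole
  -- series by `e^{|L|}`, so the characteristic function is a sum of moments.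
  let P : ℕ → MvPolynomial (Fin N) ℂ := fun k =>
    (1 / (Nat.factorial k : ℂ)) • (∑ i, (a i * Complex.I) • X i) ^ k
  have hP : ∀ k x, aeval (vecEntries x) (P k) =
      ((L x : ℂ) * Complex.I) ^ k / (Nat.factorial k : ℂ) := by
    intro k x
    have : ∑ i, (a i : ℂ) * Complex.I * (vecEntries x i) = (L x : ℂ) * Complex.I := by
      rw [hL]
      push_cast
      rw [Finset.sum_mul]
      exact Finset.sum_congr rfl fun i _ => by rw [vecEntries_apply]; ring
    simp only [P, map_smul, map_pow, map_sum, aeval_X, smul_eq_mul, this]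
    ring
  have key : ∀ ρ : Measure (Fin N → ℝ),
      (∀ c : ℝ, Integrable (fun x => Real.exp (c * ∑ i, |x i|)) ρ) →
      HasSum (fun k => ∫ x, aeval (vecEntries x) (P k) ∂ρ) (charFunDual ρ L) := by
    intro ρ hρ
    rw [charFunDual_apply]
    have hexp : ∀ t : ℝ, HasSum (fun k : ℕ => |t| ^ k / (Nat.factorial k : ℝ)) (Real.exp |t|) := by
      intro t
      rw [Real.exp_eq_exp_ℝ]
      exact NormedSpace.expSeries_div_hasSum_exp |t|
    refine hasSum_integral_of_dominated_convergence
      (fun k x => |L x| ^ k / (Nat.factorial k : ℝ)) (fun k => ?_) (fun k => ?_) ?_ ?_ ?_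
    · exact (continuous_aeval_vecEntries (P k)).aestronglyMeasurable
    · refine Eventually.of_forall fun x => le_of_eq ?_
      rw [hP]
      simp
    · exact Eventually.of_forall fun x => (hexp (L x)).summable
    · have : (fun x => ∑' k : ℕ, |L x| ^ k / (Nat.factorial k : ℝ)) =
          fun x => Real.exp |L x| := funext fun x => (hexp (L x)).tsum_eq
      rw [this]
      refine (hρ c).mono' ?_ (Eventually.of_forall fun x => ?_)
      · exact (Real.continuous_exp.comp (continuous_abs.comp L.continuous)).aestronglyMeasurable
      · rw [Real.norm_eq_abs, Real.abs_exp]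
        exact Real.exp_le_exp.2 (hLc x)
    · refine Eventually.of_forall fun x => ?_
      simp only [hP]
      rw [Complex.exp_eq_exp_ℂ]
      exact NormedSpace.expSeries_div_hasSum_exp ((L x : ℂ) * Complex.I)
  have h1 := key μ hμ
  have h2 := key ν hν
  simp only [h] at h1
  exact h1.unique h2

theorem integrable_withDensity_ofReal {α E : Type*} [MeasurableSpace α] {μ : Measure α}
    [NormedAddCommGroup E] [NormedSpace ℝ E]
    {r : α → ℝ} (hr : Measurable r) (g : α → E) :
    Integrable g (μ.withDensity fun x => ENNReal.ofReal (r x)) ↔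
      Integrable (fun x => (max (r x) 0) • g x) μ := by
  rw [integrable_withDensity_iff_integrable_smul' hr.ennreal_ofReal
    (Eventually.of_forall fun x => ENNReal.ofReal_lt_top)]
  simp only [ENNReal.toReal_ofReal']

theorem integral_withDensity_ofReal {α E : Type*} [MeasurableSpace α] {μ : Measure α}
    [NormedAddCommGroup E] [NormedSpace ℝ E]
    {r : α → ℝ} (hr : Measurable r) (g : α → E) :
    ∫ x, g x ∂(μ.withDensity fun x => ENNReal.ofReal (r x)) = ∫ x, (max (r x) 0) • g x ∂μ := by
  rw [integral_withDensity_eq_integral_toReal_smul hr.ennreal_ofReal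
    (Eventually.of_forall fun x => ENNReal.ofReal_lt_top)]
  simp only [ENNReal.toReal_ofReal']

/-- A finite measure with the moments of a signed density has that density, which is
non-negative. -/
theorem measure_eq_withDensity_of_moments {μ : Measure (Fin N → ℝ)} [IsFiniteMeasure μ]
    (hμ : ∀ c : ℝ, Integrable (fun x => Real.exp (c * ∑ i, |x i|)) μ)
    {r : (Fin N → ℝ) → ℝ} (hr : Measurable r)
    (hr' : ∀ c : ℝ, Integrable (fun x => Real.exp (c * ∑ i, |x i|) * r x))
    (h : ∀ p : MvPolynomial (Fin N) ℂ,
      ∫ x, aeval (vecEntries x) p ∂μ = ∫ x, aeval (vecEntries x) p * (r x : ℂ)) :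
    (∀ᵐ x, 0 ≤ r x) ∧ μ = volume.withDensity fun x => ENNReal.ofReal (r x) := by
  have hgen : ∀ s : (Fin N → ℝ) → ℝ, Measurable s → (∀ x, |max (s x) 0| ≤ |r x|) →
      ∀ c : ℝ, Integrable (fun x => Real.exp (c * ∑ i, |x i|))
        (volume.withDensity fun x => ENNReal.ofReal (s x)) := by
    intro s hs hsr c
    rw [integrable_withDensity_ofReal hs]
    refine (hr' c).mono ?_ (Eventually.of_forall fun x => ?_)
    · have : Measurable fun x => max (s x) 0 := hs.max measurable_const
      fun_prop
    · rw [norm_smul, norm_mul, mul_comm, Real.norm_eq_abs (max _ _), Real.norm_eq_abs (r x)]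
      exact mul_le_mul_of_nonneg_left (hsr x) (norm_nonneg _)
  have hr_neg : Measurable fun x => -r x := hr.neg
  have hp := hgen r hr fun x => by
    rcases le_total (r x) 0 with h0 | h0 <;> simp [h0]
  have hn := hgen (fun x => -r x) hr_neg fun x => by
    rcases le_total (r x) 0 with h0 | h0
    · rw [max_eq_left (by linarith), abs_neg]
    · rw [max_eq_right (by linarith)]; simp
  have hfin : ∀ ν : Measure (Fin N → ℝ),
      (∀ c : ℝ, Integrable (fun x => Real.exp (c * ∑ i, |x i|)) ν) → IsFiniteMeasure ν := by
    intro ν hν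
    have := hν 0
    simp only [zero_mul, Real.exp_zero] at this
    exact (integrable_const_iff_isFiniteMeasure one_ne_zero).1 this
  have := hfin _ hp
  have := hfin _ hn
  -- The density `r` is not known to be non-negative, so its negative part is moved to the other
  -- side. This leaves two positive measures with the same moments.
  have hmeas : μ + (volume.withDensity fun x => ENNReal.ofReal (-r x)) =
      volume.withDensity fun x => ENNReal.ofReal (r x) := by
    refine measure_ext_of_moments (fun c => (hμ c).add_measure (hn c)) hp fun p => ?_
    have hnp := integrable_aeval_vecEntries hn p
    have hpp := integrable_aeval_vecEntries hp p
    rw [integral_add_measure (integrable_aeval_vecEntries hμ p) hnp, h,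
      integral_withDensity_ofReal hr_neg, integral_withDensity_ofReal hr, ← sub_eq_zero,
      add_sub_assoc, ← integral_sub, ← integral_add]
    · refine (integral_congr_ae (Eventually.of_forall fun x => ?_)).trans
        (integral_zero (Fin N → ℝ) ℂ)
      simp only [Complex.real_smul]
      rcases le_total (r x) 0 with h0 | h0
      · rw [max_eq_left (by linarith), max_eq_right (by linarith)]
        push_cast; ring
      · rw [max_eq_right (by linarith), max_eq_left (by linarith)]
        push_cast; ring
    · obtain ⟨C, c, hC⟩ := exists_norm_aeval_vecEntries_le p
      refine ((hr' c).norm.const_mul C).mono' ?_ (Eventually.of_forall fun x => ?_)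
      · have := (continuous_aeval_vecEntries p).measurable
        fun_prop
      · rw [norm_mul, norm_mul, Complex.norm_real, Real.norm_eq_abs (Real.exp _), Real.abs_exp,
          ← mul_assoc]
        gcongr
        exact hC x
    · exact ((integrable_withDensity_ofReal hr_neg _).1 hnp).sub
        ((integrable_withDensity_ofReal hr _).1 hpp)
    · exact (integrable_withDensity_ofReal hr_neg _).1 hnp
    · exact (integrable_withDensity_ofReal hr _).1 hpp
  have hset : MeasurableSet {x | r x < 0} := measurableSet_lt hr measurable_const
  -- The right-hand side of `hmeas` gives no mass to `{r < 0}`, hence neither does the negative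
  -- part, which lives there.
  have hzero : (volume.withDensity fun x => ENNReal.ofReal (-r x)) {x | r x < 0} = 0 := by
    have h1 : (volume.withDensity fun x => ENNReal.ofReal (r x)) {x | r x < 0} = 0 := by
      rw [withDensity_apply _ hset, setLIntegral_congr_fun hset (g := fun _ => 0)]
      · simp
      · intro x hx
        exact ENNReal.ofReal_of_nonpos (le_of_lt hx)
    rw [← hmeas, Measure.add_apply] at h1
    exact (add_eq_zero.1 h1).2
  have hae : ∀ᵐ x, 0 ≤ r x := by
    rw [withDensity_apply_eq_zero hr_neg.ennreal_ofReal] at hzero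
    rw [ae_iff]
    refine measure_mono_null (fun x hx => ?_) hzero
    simp only [not_le, Set.mem_ofPred_eq] at hx
    exact ⟨by simpa using hx, hx⟩
  refine ⟨hae, ?_⟩
  have hz : (volume.withDensity fun x => ENNReal.ofReal (-r x)) = 0 := by
    rw [withDensity_congr_ae (g := 0), withDensity_zero]
    filter_upwards [hae] with x hx
    exact ENNReal.ofReal_of_nonpos (by linarith)
  rw [← hmeas, hz, add_zero]

end Moments

/-! ### Measurability of the eigenvalues -/

section Measurability

variable {N : ℕ}

/-- Power sums of the eigenvalues are traces of powers, hence continuous in the matrix. -/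
theorem measurable_sum_eval_eigs (p : ℝ[X]) :
    Measurable fun c : HermCoord N => ∑ i, p.eval (eigs c i) := by
  have h : ∀ k, Measurable fun c : HermCoord N => ∑ i, eigs c i ^ k := by
    intro k
    have h1 : (fun c : HermCoord N => ∑ i, eigs c i ^ k) =
        fun c => (hermMatrix c ^ k).trace.re := by
      ext c
      rw [trace_hermMatrix_pow]
      norm_cast
    rw [h1]
    have h2 : Continuous fun c : HermCoord N => hermMatrix c := by
      refine continuous_matrix fun i j => continuous_hermMatrix_apply i j
    exact (Complex.continuous_re.comp (h2.pow k).matrix_trace).measurable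
  have h3 : (fun c : HermCoord N => ∑ i, p.eval (eigs c i)) =
      fun c => ∑ k ∈ Finset.range (p.natDegree + 1), p.coeff k * ∑ i, eigs c i ^ k := by
    ext c
    simp only [Polynomial.eval_eq_sum_range, Finset.mul_sum]
    rw [Finset.sum_comm]
  rw [h3]
  exact Finset.measurable_sum _ fun k _ => (h k).const_mul _

/-- By Weierstrass, polynomials approximate `g` on `[-m, m]` to within `1/(m+1)`; for a given matrix
this interval eventually contains all eigenvalues. -/
theorem measurable_sum_continuous_eigs {g : ℝ → ℝ} (hg : Continuous g) :
    Measurable fun c : HermCoord N => ∑ i, g (eigs c i) := by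
  have hp : ∀ m : ℕ, ∃ p : ℝ[X], ∀ x ∈ Set.Icc (-(m : ℝ)) m, |p.eval x - g x| < 1 / (m + 1) :=
    fun m => exists_polynomial_near_of_continuousOn _ _ g hg.continuousOn _ (by positivity)
  choose p hp using hp
  refine measurable_of_tendsto_metrizable (fun m => measurable_sum_eval_eigs (p m)) ?_
  rw [tendsto_pi_nhds]
  intro c
  refine tendsto_finsetSum _ fun i _ => ?_
  rw [tendsto_iff_norm_sub_tendsto_zero]
  refine squeeze_zero' (Eventually.of_forall fun m => norm_nonneg _) ?_
    (tendsto_one_div_add_atTop_nhds_zero_nat (𝕜 := ℝ))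
  filter_upwards [eventually_ge_atTop ⌈|eigs c i|⌉₊] with m hm
  have : |eigs c i| ≤ m := (Nat.le_ceil _).trans (by exact_mod_cast hm)
  exact (hp m _ (abs_le.1 this)).le

/-- The indicator of `[t, ∞)` is a pointwise limit of piecewise linear ramps supported ever closer
to it. -/
theorem measurable_card_eigs_ge (t : ℝ) :
    Measurable fun c : HermCoord N => ∑ i, (Set.Ici t).indicator (fun _ => (1 : ℝ)) (eigs c i) := by
  let g : ℕ → ℝ → ℝ := fun m x => max 0 (1 - m * max 0 (t - x))
  refine measurable_of_tendsto_metrizable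
    (fun m => measurable_sum_continuous_eigs (g := g m) (by fun_prop)) ?_
  rw [tendsto_pi_nhds]
  intro c
  refine tendsto_finsetSum _ fun i _ => tendsto_const_nhds.congr' ?_
  by_cases hx : t ≤ eigs c i
  · filter_upwards with m
    have h1 : t - eigs c i ≤ 0 := by linarith
    simp [g, h1, hx]
  · push Not at hx
    filter_upwards [eventually_ge_atTop ⌈1 / (t - eigs c i)⌉₊] with m hm
    have h1 : 0 < t - eigs c i := by linarith
    have h2 : 1 / (t - eigs c i) ≤ m := (Nat.le_ceil _).trans (by exact_mod_cast hm)
    have h3 : 1 ≤ m * (t - eigs c i) := by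
      rwa [div_le_iff₀ h1] at h2
    have h4 : eigs c i ∉ Set.Ici t := by simpa using hx
    simp only [g, Set.indicator_of_notMem h4]
    rw [max_eq_right h1.le, max_eq_left (by linarith)]

/-- The eigenvalues are listed in decreasing order, so the one of rank `i` (counted from 0) is at
least `t` exactly when more than `i` of them are. -/
theorem measurable_eigs : Measurable (eigs : HermCoord N → Fin N → ℝ) := by
  refine measurable_pi_lambda _ fun i => measurable_of_Ici fun t => ?_
  let e : Fin (Fintype.card (Fin N)) ≃ Fin N := Fintype.equivOfCardEq (Fintype.card_fin _)
  have h0 : ∀ (c : HermCoord N) (j : Fin N),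
      eigs c j = (hermMatrix_isHermitian c).eigenvalues₀ (e.symm j) := fun c j => rfl
  have h1 : (fun c : HermCoord N => eigs c i) ⁻¹' Set.Ici t = {c | (((e.symm i : ℕ) : ℝ)) <
      ∑ j, (Set.Ici t).indicator (fun _ => (1 : ℝ)) (eigs c j)} := by
    ext c
    have h2 := Tuple.lt_card_ge_iff_apply_ge_of_antitone (j := e.symm i) (a := t)
      (hermMatrix_isHermitian c).eigenvalues₀_antitone
    have h3 : ∑ j, (Set.Ici t).indicator (fun _ => (1 : ℝ)) (eigs c j) =
        (Finset.card {k | t ≤ (hermMatrix_isHermitian c).eigenvalues₀ k} : ℝ) := by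
      simp only [h0]
      rw [Equiv.sum_comp e.symm (fun k => (Set.Ici t).indicator (fun _ => (1 : ℝ))
        ((hermMatrix_isHermitian c).eigenvalues₀ k))]
      simp [Set.indicator_apply]
    simp only [Set.mem_preimage, Set.mem_Ici, Set.mem_ofPred_eq]
    rw [h3, h0, Nat.cast_lt]
    exact h2.symm
  rw [h1]
  exact measurableSet_lt measurable_const (measurable_card_eigs_ge t)

end Measurability

/-! ### The law of the eigenvalues -/

section EigenvalueLaw

variable {N : ℕ}

theorem measurePreserving_comp_perm (σ : Equiv.Perm (Fin N)) :
    MeasurePreserving (fun x : Fin N → ℝ => x ∘ σ) := by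
  have h := volume_measurePreserving_piCongrLeft (fun _ : Fin N => ℝ) σ.symm
  convert! h using 1
  ext x i
  have := MeasurableEquiv.piCongrLeft_apply_apply (β := fun _ : Fin N => ℝ) σ.symm x (σ i)
  simpa using this.symm

/-- The Gaussian measure on Hermitian matrices with source `diag β`. -/
def hermGaussian (β : Fin N → ℝ) : Measure (HermCoord N) :=
  volume.withDensity fun c => ENNReal.ofReal (hermDensity β c)

theorem integrable_exp_sum_abs_eigs (β : Fin N → ℝ) (k : ℝ) :
    Integrable fun c : HermCoord N => Real.exp (k * ∑ i, |eigs c i|) * hermDensity β c := by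
  refine ((integrable_hermGaussian (s := 1 / 4) (by norm_num) β).const_mul
    (Real.exp (N * k ^ 2))).mono' ?_ (Eventually.of_forall fun c => ?_)
  · have := measurable_eigs (N := N)
    have h2 : ∀ i, Measurable fun c : HermCoord N => eigs c i := fun i =>
      (measurable_pi_apply i).comp this
    have h3 : Measurable fun c : HermCoord N => ∑ i, |eigs c i| :=
      Finset.measurable_sum _ fun i _ => (h2 i).abs
    exact ((Real.measurable_exp.comp (h3.const_mul k)).mul
      (continuous_hermDensity β).measurable).aestronglyMeasurable
  · rw [norm_mul, Real.norm_eq_abs, Real.norm_eq_abs, Real.abs_exp, hermDensity, Real.abs_exp,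
      ← Real.exp_add, ← Real.exp_add, Real.exp_le_exp]
    -- From `k|λ| ≤ k² + λ²/4` for each eigenvalue, together with `∑ λ² = hermNormSq c`.
    have h1 : k * ∑ i, |eigs c i| ≤ N * k ^ 2 + 1 / 4 * hermNormSq c := by
      rw [← sum_eigs_sq, Finset.mul_sum, Finset.mul_sum]
      have : (N : ℝ) * k ^ 2 = ∑ _i : Fin N, k ^ 2 := by simp
      rw [this, ← Finset.sum_add_distrib]
      refine Finset.sum_le_sum fun i _ => ?_
      nlinarith [sq_nonneg (k - |eigs c i| / 2), sq_abs (eigs c i)]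
    linarith

/-- If the symmetric moments of the eigenvalues are given by a symmetric density, then so is their
symmetrized law. -/
theorem eigenvalue_law_of_moments (β : Fin N → ℝ) {r : (Fin N → ℝ) → ℝ} (hr : Measurable r)
    (hsymm : ∀ (σ : Equiv.Perm (Fin N)) x, r (x ∘ σ) = r x)
    (hr' : ∀ c : ℝ, Integrable (fun x => Real.exp (c * ∑ i, |x i|) * r x))
    (h : ∀ g : MvPolynomial (Fin N) ℂ, g.IsSymmetric →
      ∫ c : HermCoord N, aeval (vecEntries (eigs c)) g * (hermDensity β c : ℂ) =
        ∫ x, aeval (vecEntries x) g * (r x : ℂ)) :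
    (∀ᵐ x, 0 ≤ r x) ∧ ∀ F : (Fin N → ℝ) → ℝ≥0∞, Measurable F →
      (∀ (σ : Equiv.Perm (Fin N)) x, F (x ∘ σ) = F x) →
      ∫⁻ c : HermCoord N, F (eigs c) * ENNReal.ofReal (hermDensity β c) =
        ∫⁻ x, F x * ENNReal.ofReal (r x) := by
  have hpos : ∀ c : HermCoord N, max (hermDensity β c) 0 = hermDensity β c := fun c =>
    max_eq_left (Real.exp_pos _).le
  have hdm := (continuous_hermDensity β).measurable
  have hem : ∀ σ : Equiv.Perm (Fin N), Measurable fun c : HermCoord N => eigs c ∘ σ := fun σ =>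
    (measurePreserving_comp_perm σ).measurable.comp measurable_eigs
  -- Only symmetric moments are known, so the law is summed over all relabellings. The resulting
  -- measure has the moments of `N! r`.
  let μ : Measure (Fin N → ℝ) :=
    ∑ σ : Equiv.Perm (Fin N), (hermGaussian β).map fun c => eigs c ∘ σ
  have hintσ : ∀ (c : ℝ) (σ : Equiv.Perm (Fin N)),
      Integrable (fun x : Fin N → ℝ => Real.exp (c * ∑ i, |x i|))
        ((hermGaussian β).map fun c => eigs c ∘ σ) := by
    intro c σ
    have hcont : Continuous fun x : Fin N → ℝ => Real.exp (c * ∑ i, |x i|) := by fun_prop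
    rw [integrable_map_measure hcont.aestronglyMeasurable (hem σ).aemeasurable, hermGaussian,
      integrable_withDensity_ofReal hdm]
    refine (integrable_exp_sum_abs_eigs β c).congr (Eventually.of_forall fun d => ?_)
    simp only [Function.comp, hpos, smul_eq_mul]
    rw [Equiv.sum_comp σ fun i => |eigs d i|, mul_comm]
  have hμ : ∀ c : ℝ, Integrable (fun x => Real.exp (c * ∑ i, |x i|)) μ := fun c =>
    integrable_finsetSum_measure.2 fun σ _ => hintσ c σ
  have hfin : IsFiniteMeasure μ := by
    have := hμ 0
    simp only [zero_mul, Real.exp_zero] at this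
    exact (integrable_const_iff_isFiniteMeasure one_ne_zero).1 this
  have hren : ∀ (σ : Equiv.Perm (Fin N)) (x : Fin N → ℝ) (p : MvPolynomial (Fin N) ℂ),
      aeval (vecEntries x) (rename σ p) = aeval (vecEntries (x ∘ σ)) p := by
    intro σ x p
    rw [aeval_rename]
    rfl
  have hcard : (0 : ℝ) < Fintype.card (Equiv.Perm (Fin N)) := by
    exact_mod_cast Fintype.card_pos
  have hintr : ∀ p : MvPolynomial (Fin N) ℂ,
      Integrable fun x => aeval (vecEntries x) p * (r x : ℂ) := by
    intro p
    obtain ⟨C, c, hC⟩ := exists_norm_aeval_vecEntries_le p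
    refine ((hr' c).norm.const_mul C).mono' ?_ (Eventually.of_forall fun x => ?_)
    · have := (continuous_aeval_vecEntries p).measurable
      fun_prop
    · rw [norm_mul, norm_mul, Complex.norm_real, Real.norm_eq_abs (Real.exp _), Real.abs_exp,
        ← mul_assoc]
      gcongr
      exact hC x
  obtain ⟨hae, hμr⟩ := measure_eq_withDensity_of_moments hμ
    (r := fun x => Fintype.card (Equiv.Perm (Fin N)) * r x) (hr.const_mul _)
    (fun c => by
      refine ((hr' c).const_mul (Fintype.card (Equiv.Perm (Fin N)) : ℝ)).congr
        (Eventually.of_forall fun x => ?_)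
      ring) (fun p => by
      -- An arbitrary `p` is replaced by the sum of its renamings. Each renaming has the same moment
      -- against the symmetric density `r`.
      have hg : (∑ σ : Equiv.Perm (Fin N), rename σ p).IsSymmetric := by
        intro τ
        rw [map_sum]
        simp only [rename_rename]
        exact Equiv.sum_comp (Equiv.mulLeft τ) fun σ : Equiv.Perm (Fin N) => rename σ p
      have h1 := h _ hg
      simp only [map_sum, hren, Finset.sum_mul] at h1
      have hinth : ∀ σ : Equiv.Perm (Fin N), Integrable fun c : HermCoord N =>
          aeval (vecEntries (eigs c ∘ σ)) p * (hermDensity β c : ℂ) := by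
        intro σ
        have := integrable_aeval_vecEntries (fun c => hintσ c σ) p
        rw [integrable_map_measure (continuous_aeval_vecEntries p).aestronglyMeasurable
          (hem σ).aemeasurable, hermGaussian, integrable_withDensity_ofReal hdm] at this
        refine this.congr (Eventually.of_forall fun d => ?_)
        simp only [Function.comp_apply, hpos, Complex.real_smul]
        ring
      have hmp : ∀ σ : Equiv.Perm (Fin N), (∫ x : Fin N → ℝ,
          aeval (vecEntries (x ∘ σ)) p * (r x : ℂ)) =
          ∫ x, aeval (vecEntries x) p * (r x : ℂ) := by
        intro σ
        have hemb : MeasurableEmbedding (fun x : Fin N → ℝ => x ∘ σ) := by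
          refine MeasurableEquiv.measurableEmbedding
            ⟨⟨fun x => x ∘ σ, fun x => x ∘ σ.symm, fun x => ?_, fun x => ?_⟩,
              (measurePreserving_comp_perm σ).measurable,
              (measurePreserving_comp_perm σ.symm).measurable⟩
          · ext; simp
          · ext; simp
        rw [← (measurePreserving_comp_perm σ).integral_comp hemb
          (fun x => aeval (vecEntries x) p * (r x : ℂ))]
        simp only [hsymm]
      have hintx : ∀ σ : Equiv.Perm (Fin N), Integrable fun x : Fin N → ℝ =>
          aeval (vecEntries (x ∘ σ)) p * (r x : ℂ) := by
        intro σ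
        refine (hintr (rename σ p)).congr (Eventually.of_forall fun x => ?_)
        simp only [hren]
      rw [integral_finsetSum _ fun σ _ => hinth σ, integral_finsetSum _ fun σ _ => hintx σ] at h1
      simp only [hmp, Finset.sum_const, Finset.card_univ, nsmul_eq_mul] at h1
      rw [integral_finsetSum_measure fun σ _ => integrable_aeval_vecEntries (fun c => hintσ c σ) p]
      have h2 : ∀ σ : Equiv.Perm (Fin N),
          ∫ x, aeval (vecEntries x) p ∂((hermGaussian β).map fun c => eigs c ∘ σ) =
          ∫ c : HermCoord N, aeval (vecEntries (eigs c ∘ σ)) p * (hermDensity β c : ℂ) := by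
        intro σ
        rw [integral_map (hem σ).aemeasurable
          (continuous_aeval_vecEntries p).aestronglyMeasurable, hermGaussian,
          integral_withDensity_ofReal hdm]
        refine integral_congr_ae (Eventually.of_forall fun d => ?_)
        simp only [hpos, Complex.real_smul]
        ring
      simp only [h2, h1]
      rw [← integral_const_mul]
      refine integral_congr_ae (Eventually.of_forall fun d => ?_)
      push_cast
      ring)
  refine ⟨?_, fun F hF hFs => ?_⟩
  · filter_upwards [hae] with x hx
    exact nonneg_of_mul_nonneg_right hx hcard
  · have h1 : ∫⁻ x, F x ∂μ = Fintype.card (Equiv.Perm (Fin N)) *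
        ∫⁻ c : HermCoord N, F (eigs c) * ENNReal.ofReal (hermDensity β c) := by
      rw [lintegral_finsetSum_measure]
      have h2 : ∀ σ : Equiv.Perm (Fin N),
          ∫⁻ x, F x ∂((hermGaussian β).map fun c => eigs c ∘ σ) =
          ∫⁻ c : HermCoord N, F (eigs c) * ENNReal.ofReal (hermDensity β c) := by
        intro σ
        rw [lintegral_map hF (hem σ), hermGaussian,
          lintegral_withDensity_eq_lintegral_mul _ hdm.ennreal_ofReal
            (g := fun c => F (eigs c ∘ σ)) (hF.comp (hem σ))]
        refine lintegral_congr fun c => ?_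
        simp only [Pi.mul_apply, hFs]
        rw [mul_comm]
      simp only [h2, Finset.sum_const, Finset.card_univ, nsmul_eq_mul]
    have h3 : ∫⁻ x, F x ∂μ = Fintype.card (Equiv.Perm (Fin N)) *
        ∫⁻ x, F x * ENNReal.ofReal (r x) := by
      rw [hμr, lintegral_withDensity_eq_lintegral_mul _ (hr.const_mul _).ennreal_ofReal hF,
        ← lintegral_const_mul _ (f := fun x => F x * ENNReal.ofReal (r x))
          (hF.mul hr.ennreal_ofReal)]
      refine lintegral_congr fun c => ?_
      simp only [Pi.mul_apply]
      rw [ENNReal.ofReal_mul hcard.le, ENNReal.ofReal_natCast]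
      ring
    rw [h1] at h3
    exact (ENNReal.mul_right_inj (by exact_mod_cast hcard.ne') (ENNReal.natCast_ne_top _)).1 h3

end EigenvalueLaw

/-! ### The joint density of the eigenvalues -/

section JointDensity

variable {N : ℕ}

/-- The product of the Vandermonde determinant and `det (θ_j (x_i))`. -/
def jointDet (θ : Fin N → ℝ → ℝ) (x : Fin N → ℝ) : ℝ :=
  (Matrix.vandermonde x).det * (Matrix.of fun i j => θ j (x i)).det

theorem det_vandermonde_comp_perm (σ : Equiv.Perm (Fin N)) (x : Fin N → ℝ) :
    (Matrix.vandermonde (x ∘ σ)).det = (Equiv.Perm.sign σ : ℤ) * (Matrix.vandermonde x).det := by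
  rw [← Matrix.det_permute]
  rfl

theorem sign_mul_sign_cast (σ : Equiv.Perm (Fin N)) :
    (((Equiv.Perm.sign σ : ℤ) : ℝ)) * ((Equiv.Perm.sign σ : ℤ) : ℝ) = 1 := by
  rcases Int.units_eq_one_or (Equiv.Perm.sign σ) with h | h <;> simp [h]

theorem jointDet_comp_perm (θ : Fin N → ℝ → ℝ) (σ : Equiv.Perm (Fin N)) (x : Fin N → ℝ) :
    jointDet θ (x ∘ σ) = jointDet θ x := by
  have h : (Matrix.of fun i j => θ j ((x ∘ σ) i)).det =
      (Equiv.Perm.sign σ : ℤ) * (Matrix.of fun i j => θ j (x i)).det := by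
    rw [← Matrix.det_permute]
    rfl
  rw [jointDet, jointDet, h, det_vandermonde_comp_perm]
  linear_combination ((Matrix.vandermonde x).det * (Matrix.of fun i j => θ j (x i)).det) *
    sign_mul_sign_cast σ

theorem continuous_jointDet {θ : Fin N → ℝ → ℝ} (hθ : ∀ j, Continuous (θ j)) :
    Continuous (jointDet θ) := by
  refine Continuous.mul ?_ ?_
  · refine Continuous.matrix_det (continuous_matrix fun i j => ?_)
    simp only [Matrix.vandermonde_apply]
    fun_prop
  · refine Continuous.matrix_det (continuous_matrix fun i j => ?_)
    simp only [Matrix.of_apply]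
    exact (hθ j).comp (continuous_apply i)

theorem abs_det_le_of_abs_le_exp {θ : Fin N → ℝ → ℝ} {c : ℝ}
    (h : ∀ j y, |θ j y| ≤ Real.exp (c * |y|)) (x : Fin N → ℝ) :
    |(Matrix.of fun i j => θ j (x i)).det| ≤
      Fintype.card (Equiv.Perm (Fin N)) * Real.exp (c * ∑ i, |x i|) := by
  rw [Matrix.det_apply]
  refine (Finset.abs_sum_le_sum_abs _ _).trans ?_
  rw [← Finset.card_univ, ← nsmul_eq_mul]
  refine Finset.sum_le_card_nsmul _ _ _ fun σ _ => ?_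
  have h1 : |Equiv.Perm.sign σ • ∏ i, Matrix.of (fun i j => θ j (x i)) (σ i) i| =
      ∏ i, |θ i (x (σ i))| := by
    rw [← Finset.abs_prod]
    rcases Int.units_eq_one_or (Equiv.Perm.sign σ) with h | h <;> simp [h]
  rw [h1, ← Equiv.sum_comp σ, Finset.mul_sum, Real.exp_sum]
  exact Finset.prod_le_prod (fun i _ => abs_nonneg _) fun i _ => h _ _

theorem aeval_vandermondePoly (x : Fin N → ℝ) : aeval (vecEntries x) (vandermondePoly N) =
    (((Matrix.vandermonde x).det : ℝ) : ℂ) := by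
  rw [vandermondePoly, Matrix.det_vandermonde, Matrix.det_vandermonde]
  simp [vecEntries_apply]

theorem exists_abs_vandermonde_le :
    ∃ C c : ℝ, ∀ x : Fin N → ℝ, |(Matrix.vandermonde x).det| ≤ C * Real.exp (c * ∑ i, |x i|) := by
  obtain ⟨C, c, h⟩ := exists_norm_aeval_vecEntries_le (vandermondePoly N)
  refine ⟨C, c, fun x => ?_⟩
  have := h x
  rwa [aeval_vandermondePoly, Complex.norm_real, Real.norm_eq_abs] at this

theorem integrable_exp_sum_abs_mul_vecDensity (c : ℝ) :
    Integrable fun x : Fin N → ℝ => Real.exp (c * ∑ i, |x i|) * vecDensity 0 x := by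
  refine ((integrable_vecGaussian (s := 1 / 4) (by norm_num) (0 : Fin N → ℝ)).const_mul
    (Real.exp (N * c ^ 2))).mono' ?_ (Eventually.of_forall fun x => ?_)
  · exact ((by fun_prop : Continuous fun x : Fin N → ℝ => Real.exp (c * ∑ i, |x i|)).mul
      (continuous_vecDensity 0)).aestronglyMeasurable
  · rw [norm_mul, Real.norm_eq_abs, Real.norm_eq_abs, Real.abs_exp, vecDensity, Real.abs_exp,
      ← Real.exp_add, ← Real.exp_add, Real.exp_le_exp]
    have : (N : ℝ) * c ^ 2 = ∑ _i : Fin N, c ^ 2 := by simp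
    rw [this, Finset.mul_sum, ← Finset.sum_add_distrib, ← Finset.sum_add_distrib]
    refine Finset.sum_le_sum fun i _ => ?_
    simp only [Pi.zero_apply, zero_mul, zero_sub]
    nlinarith [sq_nonneg (c - |x i| / 2), sq_abs (x i)]

theorem integrable_mul_vecDensity {E : Type*} [NormedAddCommGroup E] [NormedSpace ℝ E]
    {f : (Fin N → ℝ) → E} (hf : Continuous f) {C c : ℝ}
    (h : ∀ x, ‖f x‖ ≤ C * Real.exp (c * ∑ i, |x i|)) :
    Integrable fun x => vecDensity 0 x • f x := by
  refine ((integrable_exp_sum_abs_mul_vecDensity c).const_mul C).mono'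
    ((continuous_vecDensity 0).smul hf).aestronglyMeasurable (Eventually.of_forall fun x => ?_)
  rw [norm_smul, Real.norm_eq_abs, vecDensity, Real.abs_exp, mul_comm, ← mul_assoc]
  gcongr
  exact h x

theorem exists_abs_jointDet_le {θ : Fin N → ℝ → ℝ} {c : ℝ}
    (h : ∀ j y, |θ j y| ≤ Real.exp (c * |y|)) :
    ∃ C d : ℝ, ∀ x, |jointDet θ x| ≤ C * Real.exp (d * ∑ i, |x i|) := by
  obtain ⟨C, d, hC⟩ := exists_abs_vandermonde_le (N := N)
  refine ⟨C * Fintype.card (Equiv.Perm (Fin N)), d + c, fun x => ?_⟩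
  rw [jointDet, abs_mul, add_mul, Real.exp_add, mul_mul_mul_comm]
  exact mul_le_mul (hC x) (abs_det_le_of_abs_le_exp h x) (abs_nonneg _)
    ((abs_nonneg _).trans (hC x))

/-- The law of the eigenvalues of a Gaussian matrix with source, given its symmetric moments. -/
theorem eigenvalue_law_of_jointDet (β : Fin N → ℝ) {θ : Fin N → ℝ → ℝ} {c : ℝ}
    (hθ : ∀ j, Continuous (θ j)) (h : ∀ j y, |θ j y| ≤ Real.exp (c * |y|)) {κ : ℝ} (hκ : κ ≠ 0)
    (hmom : ∀ g : MvPolynomial (Fin N) ℂ, g.IsSymmetric →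
      ∫ x, aeval (vecEntries x) g * ((jointDet θ x * vecDensity 0 x : ℝ) : ℂ) =
        κ * ∫ c : HermCoord N, aeval (vecEntries (eigs c)) g * (hermDensity β c : ℂ)) :
    (∀ᵐ x, 0 ≤ κ⁻¹ * jointDet θ x) ∧ ∀ F : (Fin N → ℝ) → ℝ≥0∞, Measurable F →
      (∀ (σ : Equiv.Perm (Fin N)) x, F (x ∘ σ) = F x) →
      ∫⁻ c : HermCoord N, F (eigs c) * ENNReal.ofReal (hermDensity β c) =
        ∫⁻ x, F x * ENNReal.ofReal (κ⁻¹ * jointDet θ x * vecDensity 0 x) := by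
  have hsd : ∀ (σ : Equiv.Perm (Fin N)) x, vecDensity 0 (x ∘ σ) = vecDensity 0 x := by
    intro σ x
    simp only [vecDensity, Pi.zero_apply, zero_mul, zero_sub, Function.comp_apply]
    rw [Equiv.sum_comp σ fun i => -(x i ^ 2 / 2)]
  have hc : Continuous fun x => κ⁻¹ * jointDet θ x * vecDensity 0 x :=
    ((continuous_jointDet hθ).const_mul _).mul (continuous_vecDensity 0)
  obtain ⟨C, d, hC⟩ := exists_abs_jointDet_le h
  obtain ⟨h1, h2⟩ := eigenvalue_law_of_moments β hc.measurable
    (fun σ x => by rw [jointDet_comp_perm, hsd])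
    (fun k => by
      have := integrable_mul_vecDensity (f := fun x => κ⁻¹ * jointDet θ x *
        Real.exp (k * ∑ i, |x i|)) (C := |κ⁻¹| * C) (c := d + k)
        (((continuous_jointDet hθ).const_mul _).mul (by fun_prop)) (fun x => by
          rw [norm_mul, norm_mul, Real.norm_eq_abs, Real.norm_eq_abs, Real.norm_eq_abs,
            Real.abs_exp, add_mul, Real.exp_add, ← mul_assoc, mul_assoc |κ⁻¹| C]
          gcongr
          exact hC x)
      refine this.congr (Eventually.of_forall fun x => ?_)
      simp only [smul_eq_mul]
      ring)
    (fun g hg => by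
      have hκ' : (κ : ℂ) ≠ 0 := by exact_mod_cast hκ
      rw [← mul_right_inj' hκ', ← hmom g hg, ← integral_const_mul]
      refine integral_congr_ae (Eventually.of_forall fun x => ?_)
      simp only
      push_cast
      field_simp)
  refine ⟨?_, h2⟩
  filter_upwards [h1] with x hx
  exact nonneg_of_mul_nonneg_left hx (Real.exp_pos _)

theorem abs_exp_mul_le (β : Fin N → ℝ) (j : Fin N) (y : ℝ) :
    |Real.exp (β j * y)| ≤ Real.exp ((∑ i, |β i|) * |y|) := by
  rw [Real.abs_exp, Real.exp_le_exp]
  refine (le_abs_self _).trans ?_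
  rw [abs_mul]
  gcongr
  exact Finset.single_le_sum (f := fun j => |β j|) (fun j _ => abs_nonneg _) (Finset.mem_univ j)

/-- The symmetric moments of the eigenvalues, with the density symmetrized. -/
theorem integral_symmetric_jointDet_exp (β : Fin N → ℝ) {g : MvPolynomial (Fin N) ℂ}
    (hg : g.IsSymmetric) :
    ∫ x, aeval (vecEntries x) g *
        ((jointDet (fun j y => Real.exp (β j * y)) x * vecDensity 0 x : ℝ) : ℂ) =
      ((Fintype.card (Equiv.Perm (Fin N)) * gaussianRatio N * (Matrix.vandermonde β).det : ℝ) : ℂ) *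
        ∫ c : HermCoord N, aeval (vecEntries (eigs c)) g * (hermDensity β c : ℂ) := by
  let f : (Fin N → ℝ) → ℂ := fun x =>
    aeval (vecEntries x) (vandermondePoly N * g) * (vecDensity β x : ℂ)
  have hf : Integrable f := integrable_aeval_mul_vecDensity β _
  have hemb : ∀ σ : Equiv.Perm (Fin N), MeasurableEmbedding (fun x : Fin N → ℝ => x ∘ σ) := by
    intro σ
    refine MeasurableEquiv.measurableEmbedding
      ⟨⟨fun x => x ∘ σ, fun x => x ∘ σ.symm, fun x => ?_, fun x => ?_⟩,
        (measurePreserving_comp_perm σ).measurable,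
        (measurePreserving_comp_perm σ.symm).measurable⟩
    · ext; simp
    · ext; simp
  -- Expanding the determinant of exponentials, the sign of each permutation is absorbed by the
  -- Vandermonde determinant, so each term is the unsymmetrized density at permuted coordinates.
  have hsplit : ∀ x, aeval (vecEntries x) g *
      ((jointDet (fun j y => Real.exp (β j * y)) x * vecDensity 0 x : ℝ) : ℂ) =
      ∑ σ : Equiv.Perm (Fin N), f (x ∘ σ) := by
    intro x
    have h1 : ∀ σ : Equiv.Perm (Fin N), aeval (vecEntries (x ∘ σ)) g = aeval (vecEntries x) g := by
      intro σ
      conv_rhs => rw [← hg σ, aeval_rename]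
      rfl
    have h2 : ∀ σ : Equiv.Perm (Fin N), vecDensity β (x ∘ σ) =
        (∏ i, Real.exp (β i * x (σ i))) * vecDensity 0 x := by
      intro σ
      rw [← Real.exp_sum, vecDensity, vecDensity, ← Real.exp_add]
      congr 1
      rw [Finset.sum_sub_distrib]
      simp only [Function.comp_apply, Pi.zero_apply, zero_mul, zero_sub, Finset.sum_neg_distrib]
      rw [Equiv.sum_comp σ fun i => x i ^ 2 / 2]
      ring
    simp only [f, map_mul, aeval_vandermondePoly, h1, h2, det_vandermonde_comp_perm, jointDet]
    generalize (Matrix.vandermonde x).det = V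
    simp only [Matrix.det_apply, Finset.mul_sum, Finset.sum_mul, Complex.ofReal_sum,
      Matrix.of_apply]
    refine Finset.sum_congr rfl fun σ _ => ?_
    rcases Int.units_eq_one_or (Equiv.Perm.sign σ) with h | h <;> simp [h] <;> ring
  simp only [hsplit]
  have hint : ∀ σ : Equiv.Perm (Fin N), Integrable fun x => f (x ∘ σ) := fun σ =>
    ((measurePreserving_comp_perm σ).integrable_comp_emb (hemb σ)).2 hf
  rw [integral_finsetSum _ fun σ _ => hint σ]
  have h3 : ∀ σ : Equiv.Perm (Fin N), ∫ x, f (x ∘ σ) = ∫ x, f x := fun σ =>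
    (measurePreserving_comp_perm σ).integral_comp (hemb σ) f
  simp only [h3, Finset.sum_const, Finset.card_univ, nsmul_eq_mul]
  have h4 := integral_symmetric_eigs β hg
  rw [aeval_vandermondePoly] at h4
  simp only [f, h4]
  push_cast
  ring

end JointDensity

/-! ### Confluence of the source -/

section Confluent

/-- The source with entries `a, …, a, -a, …, -a`. -/
def sourceVec (n : ℕ) (a : ℝ) (j : Fin (2 * n)) : ℝ := if (j : ℕ) < n then a else -a

/-- The source with distinct entries `±a + ε r`, `0 ≤ r < n`. -/
def perturbedSource (n : ℕ) (a ε : ℝ) (j : Fin (2 * n)) : ℝ :=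
  sourceVec n a j + ε * ((j : ℕ) % n : ℕ)

/-- The difference quotient `(e^{ε x} - 1) / ε`, equal to `x` for `ε = 0`. -/
def expQuotient (ε x : ℝ) : ℝ := if ε = 0 then x else (Real.exp (ε * x) - 1) / ε

/-- The functions `e^{±a x} ((e^{ε x} - 1) / ε)^r`, `0 ≤ r < n`. -/
def confluentFun (n : ℕ) (a ε : ℝ) (j : Fin (2 * n)) (x : ℝ) : ℝ :=
  Real.exp (sourceVec n a j * x) * expQuotient ε x ^ ((j : ℕ) % n)

theorem tendsto_expQuotient (x : ℝ) :
    Tendsto (fun ε => expQuotient ε x) (nhdsWithin 0 {0}ᶜ) (nhds x) := by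
  have h : HasDerivAt (fun ε : ℝ => Real.exp (ε * x)) x 0 := by
    simpa using ((hasDerivAt_id (0 : ℝ)).mul_const x).exp
  refine h.tendsto_slope.congr' ?_
  filter_upwards [self_mem_nhdsWithin] with ε hε
  have hε' : ε ≠ 0 := hε
  simp [slope_def_field, expQuotient, hε']

theorem continuous_expQuotient (ε : ℝ) : Continuous (expQuotient ε) := by
  unfold expQuotient
  by_cases h : ε = 0
  · simpa only [h, if_true] using continuous_id'
  · simp only [h, if_false]
    fun_prop

theorem abs_exp_sub_one_le_mul_exp (t : ℝ) : |Real.exp t - 1| ≤ |t| * Real.exp |t| := by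
  rcases le_total 0 t with h | h
  · have h1 : 1 ≤ Real.exp t := Real.one_le_exp h
    rw [abs_of_nonneg (by linarith), abs_of_nonneg h]
    have h2 := Real.add_one_le_exp (-t)
    have h3 : Real.exp (-t) * Real.exp t = 1 := by rw [← Real.exp_add]; simp
    nlinarith [Real.exp_pos t]
  · have h1 : Real.exp t ≤ 1 := Real.exp_le_one_iff.2 h
    rw [abs_of_nonpos (by linarith), abs_of_nonpos h]
    have h2 := Real.add_one_le_exp t
    have h3 : 1 ≤ Real.exp (-t) := Real.one_le_exp (by linarith)
    nlinarith

theorem abs_expQuotient_le {ε : ℝ} (hε : |ε| ≤ 1) (x : ℝ) :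
    |expQuotient ε x| ≤ Real.exp (2 * |x|) := by
  have hx : |x| ≤ Real.exp |x| := by linarith [Real.add_one_le_exp |x|]
  have h2 : |x| * Real.exp |x| ≤ Real.exp (2 * |x|) := by
    rw [two_mul, Real.exp_add]
    gcongr
  refine le_trans ?_ h2
  have h1 : 1 ≤ Real.exp |x| := Real.one_le_exp (abs_nonneg _)
  unfold expQuotient
  split_ifs with h
  · nlinarith [abs_nonneg x]
  · rw [abs_div, div_le_iff₀ (abs_pos.2 h)]
    refine (abs_exp_sub_one_le_mul_exp _).trans ?_
    rw [abs_mul]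
    have : Real.exp (|ε| * |x|) ≤ Real.exp |x| :=
      Real.exp_le_exp.2 (mul_le_of_le_one_left (abs_nonneg _) hε)
    calc |ε| * |x| * Real.exp (|ε| * |x|) ≤ |ε| * |x| * Real.exp |x| := by gcongr
      _ = |x| * Real.exp |x| * |ε| := by ring

theorem abs_sourceVec (n : ℕ) (a : ℝ) (j : Fin (2 * n)) : |sourceVec n a j| = |a| := by
  unfold sourceVec
  split_ifs <;> simp

/-- The bound is uniform in `|ε| ≤ 1`, as dominated convergence for `ε → 0` requires. -/
theorem abs_confluentFun_le (n : ℕ) (a : ℝ) {ε : ℝ} (hε : |ε| ≤ 1) (j : Fin (2 * n)) (x : ℝ) :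
    |confluentFun n a ε j x| ≤ Real.exp ((|a| + 2 * n) * |x|) := by
  have hn : 0 < n := by
    have := j.2
    omega
  have hb : (((j : ℕ) % n : ℕ) : ℝ) ≤ n := by exact_mod_cast (Nat.mod_lt _ hn).le
  rw [confluentFun, abs_mul, Real.abs_exp, abs_pow, add_mul, Real.exp_add]
  refine mul_le_mul ?_ ?_ (by positivity) (by positivity)
  · refine Real.exp_le_exp.2 ((le_abs_self _).trans ?_)
    rw [abs_mul, abs_sourceVec]
  · refine (pow_le_pow_left₀ (abs_nonneg _) (abs_expQuotient_le hε x) _).trans ?_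
    rw [← Real.exp_nat_mul, Real.exp_le_exp]
    nlinarith [abs_nonneg x]

theorem continuous_confluentFun (n : ℕ) (a ε : ℝ) (j : Fin (2 * n)) :
    Continuous (confluentFun n a ε j) := by
  unfold confluentFun
  have := continuous_expQuotient ε
  fun_prop

/-- The transition matrix from the confluent functions to the exponentials. -/
def transitionMatrix (n : ℕ) (ε : ℝ) : Matrix (Fin (2 * n)) (Fin (2 * n)) ℝ :=
  Matrix.of fun l j => if (l : ℕ) / n = (j : ℕ) / n then
    (Nat.choose ((j : ℕ) % n) ((l : ℕ) % n) : ℝ) * ε ^ ((l : ℕ) % n) else 0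

theorem det_transitionMatrix (n : ℕ) (ε : ℝ) :
    (transitionMatrix n ε).det = ∏ j : Fin (2 * n), ε ^ ((j : ℕ) % n) := by
  rw [Matrix.det_of_isUpperTriangular]
  · exact Finset.prod_congr rfl fun j _ => by simp [transitionMatrix]
  · intro l j hlj
    have hlj' : (j : ℕ) < l := hlj
    simp only [transitionMatrix, Matrix.of_apply]
    split_ifs with h
    · have h1 := Nat.div_add_mod (l : ℕ) n
      have h2 := Nat.div_add_mod (j : ℕ) n
      rw [h] at h1
      rw [Nat.choose_eq_zero_of_lt (by omega)]
      simp
    · rfl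

theorem sourceVec_eq_of_div_eq {n : ℕ} (a : ℝ) {i j : Fin (2 * n)}
    (h : (i : ℕ) / n = (j : ℕ) / n) : sourceVec n a i = sourceVec n a j := by
  have hn : 0 < n := by
    have := j.2
    omega
  have : (i : ℕ) < n ↔ (j : ℕ) < n := by
    rw [← Nat.div_eq_zero_iff_lt hn, ← Nat.div_eq_zero_iff_lt hn, h]
  simp [sourceVec, this]

/-- With `q` the difference quotient, `e^{(±a + εr)x} = e^{±ax} (1 + εq)^r`. The binomial expansion
gives a change of functions that is triangular within each block of size `n`. -/
theorem exp_perturbedSource_eq_sum {n : ℕ} (a : ℝ) {ε : ℝ} (hε : ε ≠ 0) (j : Fin (2 * n))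
    (x : ℝ) : Real.exp (perturbedSource n a ε j * x) =
      ∑ l, confluentFun n a ε l x * transitionMatrix n ε l j := by
  have hn : 0 < n := by
    have := j.2
    omega
  have h1 : ∀ l, confluentFun n a ε l x * transitionMatrix n ε l j =
      if (l : ℕ) / n = (j : ℕ) / n then Real.exp (sourceVec n a j * x) *
        ((ε * expQuotient ε x) ^ ((l : ℕ) % n) * (Nat.choose ((j : ℕ) % n) ((l : ℕ) % n) : ℝ))
      else 0 := by
    intro l
    simp only [transitionMatrix, Matrix.of_apply, confluentFun]
    split_ifs with h
    · rw [sourceVec_eq_of_div_eq a h, mul_pow]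
      ring
    · simp
  have h2 : ε * expQuotient ε x + 1 = Real.exp (ε * x) := by
    simp only [expQuotient, hε, if_false]
    field_simp
    ring
  simp only [h1]
  rw [← finProdFinEquiv.sum_comp, Fintype.sum_prod_type,
    Finset.sum_eq_single (j.divNat : Fin 2)]
  · have h3 : ∀ q : Fin n, ((finProdFinEquiv (j.divNat, q) : Fin (2 * n)) : ℕ) % n = q := by
      intro q
      simp [finProdFinEquiv, Nat.mod_eq_of_lt q.2]
    have h4 : ∀ q : Fin n, ((finProdFinEquiv (j.divNat, q) : Fin (2 * n)) : ℕ) / n = j / n := by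
      intro q
      simp [finProdFinEquiv, Nat.add_mul_div_left _ _ hn, Nat.div_eq_of_lt q.2]
    simp only [h3, h4, if_true]
    rw [Fin.sum_univ_eq_sum_range (fun q => Real.exp (sourceVec n a j * x) *
      ((ε * expQuotient ε x) ^ q * (Nat.choose ((j : ℕ) % n) q : ℝ))) n, ← Finset.mul_sum]
    have h5 : ∑ q ∈ Finset.range n, (ε * expQuotient ε x) ^ q *
        (Nat.choose ((j : ℕ) % n) q : ℝ) = (ε * expQuotient ε x + 1) ^ ((j : ℕ) % n) := by
      rw [add_pow, ← Finset.sum_subset (s₁ := Finset.range ((j : ℕ) % n + 1))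
        (s₂ := Finset.range n)]
      rotate_left
      · exact Finset.range_subset_range.2 (Nat.mod_lt (j : ℕ) hn)
      · intro q _ hq
        rw [Nat.choose_eq_zero_of_lt (by simpa using hq)]
        simp
      · simp
    rw [h5, h2, perturbedSource, ← Real.exp_nat_mul, ← Real.exp_add]
    congr 1
    ring
  · intro p _ hp
    refine Finset.sum_eq_zero fun q _ => if_neg fun h => hp (Fin.ext ?_)
    rw [Fin.coe_divNat, ← h]
    simp [finProdFinEquiv, Nat.add_mul_div_left _ _ hn, Nat.div_eq_of_lt q.2]
  · simp

theorem jointDet_perturbed {n : ℕ} (a : ℝ) {ε : ℝ} (hε : ε ≠ 0) (x : Fin (2 * n) → ℝ) :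
    jointDet (fun j y => Real.exp (perturbedSource n a ε j * y)) x =
      jointDet (confluentFun n a ε) x * ∏ j : Fin (2 * n), ε ^ ((j : ℕ) % n) := by
  have h : (Matrix.of fun i j => Real.exp (perturbedSource n a ε j * x i)) =
      (Matrix.of fun i j => confluentFun n a ε j (x i)) * transitionMatrix n ε := by
    ext i j
    rw [Matrix.of_apply, exp_perturbedSource_eq_sum a hε, Matrix.mul_apply]
    rfl
  rw [jointDet, jointDet, h, Matrix.det_mul, det_transitionMatrix, mul_assoc]

/-- The factors of the Vandermonde determinant of the perturbed source after division by powers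
of `ε`. -/
def confluentFactor (n : ℕ) (a ε : ℝ) (i j : Fin (2 * n)) : ℝ :=
  if (i : ℕ) / n = (j : ℕ) / n then (((j : ℕ) % n : ℕ) : ℝ) - ((i : ℕ) % n : ℕ)
  else perturbedSource n a ε j - perturbedSource n a ε i

/-- This counts the Vandermonde factors that pair index `j` with an earlier index of the same block.
Each of them carries one power of `ε`. -/
theorem card_filter_Iio_div_eq {m n : ℕ} (j : Fin m) :
    ((Finset.Iio j).filter fun i : Fin m => (i : ℕ) / n = (j : ℕ) / n).card = (j : ℕ) % n := by
  have h1 : Finset.map Fin.valEmbedding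
      ((Finset.Iio j).filter fun i : Fin m => (i : ℕ) / n = (j : ℕ) / n) =
      (Finset.range j).filter fun i => i / n = (j : ℕ) / n := by
    ext i
    simp only [Finset.mem_map, Finset.mem_filter, Finset.mem_Iio, Fin.valEmbedding_apply,
      Finset.mem_range]
    constructor
    · rintro ⟨i, ⟨h1, h2⟩, rfl⟩
      exact ⟨h1, h2⟩
    · rintro ⟨h1, h2⟩
      exact ⟨⟨i, h1.trans j.2⟩, ⟨h1, h2⟩, rfl⟩
  rw [← Finset.card_map Fin.valEmbedding, h1]
  rcases Nat.eq_zero_or_pos n with rfl | hn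
  · simp
  have h2 : ((Finset.range j).filter fun i => i / n = (j : ℕ) / n) =
      Finset.Ico (n * ((j : ℕ) / n)) j := by
    ext i
    simp only [Finset.mem_filter, Finset.mem_range, Finset.mem_Ico]
    constructor
    · rintro ⟨h3, h4⟩
      exact ⟨h4 ▸ Nat.mul_div_le i n, h3⟩
    · rintro ⟨h3, h4⟩
      refine ⟨h4, le_antisymm (Nat.div_le_div_right h4.le) ?_⟩
      rw [Nat.le_div_iff_mul_le hn, mul_comm]
      exact h3
  rw [h2, Nat.card_Ico]
  have := Nat.div_add_mod (j : ℕ) n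
  omega

/-- The power of `ε` is the one that also comes out of the determinant of exponentials. It therefore
cancels from the moment identity before the limit is taken. -/
theorem det_vandermonde_perturbedSource (n : ℕ) (a ε : ℝ) :
    (Matrix.vandermonde (perturbedSource n a ε)).det =
      (∏ j : Fin (2 * n), ε ^ ((j : ℕ) % n)) *
        ∏ j : Fin (2 * n), ∏ i ∈ Finset.Iio j, confluentFactor n a ε i j := by
  rw [Matrix.det_vandermonde, Finset.prod_comm' (t' := Finset.univ) (s' := fun j => Finset.Iio j)
    (by simp), ← Finset.prod_mul_distrib]
  refine Finset.prod_congr rfl fun j _ => ?_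
  rw [← card_filter_Iio_div_eq (n := n) j, ← Finset.prod_const, Finset.prod_filter,
    ← Finset.prod_mul_distrib]
  refine Finset.prod_congr rfl fun i _ => ?_
  unfold confluentFactor
  split_ifs with h
  · rw [perturbedSource, perturbedSource, sourceVec_eq_of_div_eq a h]
    ring
  · rw [one_mul]

theorem confluentFactor_ne_zero {n : ℕ} {a : ℝ} (ha : 0 < a) {i j : Fin (2 * n)} (hij : i < j) :
    confluentFactor n a 0 i j ≠ 0 := by
  have hn : 0 < n := by
    have := j.2
    omega
  have hij' : (i : ℕ) < j := hij
  unfold confluentFactor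
  split_ifs with h
  · have h1 := Nat.div_add_mod (i : ℕ) n
    have h2 := Nat.div_add_mod (j : ℕ) n
    rw [h] at h1
    have h3 : ((i : ℕ) % n : ℕ) < (j : ℕ) % n := by omega
    have h4 : (((i : ℕ) % n : ℕ) : ℝ) < ((j : ℕ) % n : ℕ) := by exact_mod_cast h3
    linarith
  · simp only [perturbedSource, zero_mul, add_zero, sourceVec]
    have hi : (i : ℕ) < n := by
      by_contra hi
      have e1 : (i : ℕ) / n = 1 := by
        have := i.2
        exact Nat.div_eq_of_lt_le (by omega) (by omega)
      have e2 : (j : ℕ) / n = 1 := by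
        have := j.2
        exact Nat.div_eq_of_lt_le (by omega) (by omega)
      exact h (e1.trans e2.symm)
    have hj : ¬ (j : ℕ) < n := by
      intro hj
      exact h ((Nat.div_eq_of_lt hi).trans (Nat.div_eq_of_lt hj).symm)
    rw [if_pos hi, if_neg hj]
    linarith

theorem tendsto_integral_jointDet_confluentFun (n : ℕ) (a : ℝ) (g : MvPolynomial (Fin (2 * n)) ℂ) :
    Tendsto (fun ε => ∫ x, aeval (vecEntries x) g *
        ((jointDet (confluentFun n a ε) x * vecDensity 0 x : ℝ) : ℂ)) (nhdsWithin 0 {0}ᶜ)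
      (nhds (∫ x, aeval (vecEntries x) g *
        ((jointDet (confluentFun n a 0) x * vecDensity 0 x : ℝ) : ℂ))) := by
  obtain ⟨C, c, hC⟩ := exists_norm_aeval_vecEntries_le g
  obtain ⟨D, d, hD⟩ := exists_abs_vandermonde_le (N := 2 * n)
  refine tendsto_integral_filter_of_dominated_convergence
    (fun x => C * D * Fintype.card (Equiv.Perm (Fin (2 * n))) *
      (Real.exp ((c + d + (|a| + 2 * n)) * ∑ i, |x i|) * vecDensity 0 x)) ?_ ?_ ?_ ?_
  · refine Eventually.of_forall fun ε => Continuous.aestronglyMeasurable ?_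
    refine (continuous_aeval_vecEntries g).mul (Complex.continuous_ofReal.comp ?_)
    exact (continuous_jointDet (continuous_confluentFun n a ε)).mul (continuous_vecDensity 0)
  · have : ∀ᶠ ε : ℝ in nhdsWithin 0 {0}ᶜ, |ε| ≤ 1 := by
      refine nhdsWithin_le_nhds ?_
      have := Metric.closedBall_mem_nhds (0 : ℝ) one_pos
      filter_upwards [this] with ε hε
      simpa using hε
    filter_upwards [this] with ε hε
    refine Eventually.of_forall fun x => ?_
    rw [norm_mul, Complex.norm_real, Real.norm_eq_abs, abs_mul, vecDensity, Real.abs_exp, jointDet,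
      abs_mul, add_mul, add_mul, Real.exp_add, Real.exp_add]
    have h1 := hC x
    have h2 := hD x
    have h3 := abs_det_le_of_abs_le_exp (abs_confluentFun_le n a hε) x
    calc _ ≤ (C * Real.exp (c * ∑ i, |x i|)) * ((D * Real.exp (d * ∑ i, |x i|)) *
          (Fintype.card (Equiv.Perm (Fin (2 * n))) * Real.exp ((|a| + 2 * n) * ∑ i, |x i|)) *
          Real.exp (∑ i, ((0 : Fin (2 * n) → ℝ) i * x i - x i ^ 2 / 2))) := by
          gcongr
          · exact (norm_nonneg _).trans h1
          · exact (abs_nonneg _).trans h2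
      _ = _ := by ring
  · exact (integrable_exp_sum_abs_mul_vecDensity _).const_mul _
  · refine Eventually.of_forall fun x => ?_
    refine Tendsto.const_mul _ ((Complex.continuous_ofReal.tendsto _).comp ?_)
    refine Tendsto.mul_const _ (Tendsto.const_mul _ ?_)
    have hcont : Continuous fun M : Matrix (Fin (2 * n)) (Fin (2 * n)) ℝ => M.det :=
      Continuous.matrix_det continuous_id
    refine (hcont.tendsto _).comp ?_
    refine tendsto_pi_nhds.2 fun i => tendsto_pi_nhds.2 fun j => ?_
    simp only [Matrix.of_apply, confluentFun]
    have h0 : expQuotient 0 (x i) = x i := by simp [expQuotient]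
    rw [h0]
    exact ((tendsto_expQuotient (x i)).pow _).const_mul _

theorem tendsto_integral_eigs_perturbed (n : ℕ) (a : ℝ) (g : MvPolynomial (Fin (2 * n)) ℂ) :
    Tendsto (fun ε => ∫ c : HermCoord (2 * n), aeval (vecEntries (eigs c)) g *
        (hermDensity (perturbedSource n a ε) c : ℂ)) (nhdsWithin 0 {0}ᶜ)
      (nhds (∫ c : HermCoord (2 * n), aeval (vecEntries (eigs c)) g *
        (hermDensity (sourceVec n a) c : ℂ))) := by
  obtain ⟨C, k, hC⟩ := exists_norm_aeval_vecEntries_le g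
  have hC0 : 0 ≤ C := by simpa using (norm_nonneg _).trans (hC 0)
  let B : ℝ := |a| + n
  -- The decay `1/2` is shared out: `1/4` to the exponential of the eigenvalues, `1/8` to the source
  -- through `B|t| ≤ 2B² + t²/8`, and `1/8` is left.
  refine tendsto_integral_filter_of_dominated_convergence
    (fun c => C * Real.exp ((2 * n : ℕ) * k ^ 2 + (2 * n : ℕ) * (2 * B ^ 2)) *
      Real.exp (∑ i, (0 : Fin (2 * n) → ℝ) i * c.1 i - 1 / 8 * hermNormSq c)) ?_ ?_ ?_ ?_
  · refine Eventually.of_forall fun ε => AEStronglyMeasurable.mul ?_ ?_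
    · exact ((continuous_aeval_vecEntries g).measurable.comp measurable_eigs).aestronglyMeasurable
    · exact (Complex.continuous_ofReal.comp (continuous_hermDensity _)).aestronglyMeasurable
  · have : ∀ᶠ ε : ℝ in nhdsWithin 0 {0}ᶜ, |ε| ≤ 1 := by
      refine nhdsWithin_le_nhds ?_
      have := Metric.closedBall_mem_nhds (0 : ℝ) one_pos
      filter_upwards [this] with ε hε
      simpa using hε
    filter_upwards [this] with ε hε
    refine Eventually.of_forall fun c => ?_
    have hB : ∀ j, |perturbedSource n a ε j| ≤ B := by
      intro j
      have hn : 0 < n := by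
        have := j.2
        omega
      have hb : (((j : ℕ) % n : ℕ) : ℝ) ≤ n := by exact_mod_cast (Nat.mod_lt _ hn).le
      refine (abs_add_le _ _).trans ?_
      rw [abs_sourceVec, abs_mul, Nat.abs_cast]
      have : |ε| * (((j : ℕ) % n : ℕ) : ℝ) ≤ 1 * n := by gcongr
      simp only [B]
      linarith
    have h1 : k * ∑ i, |eigs c i| ≤ (2 * n : ℕ) * k ^ 2 + 1 / 4 * hermNormSq c := by
      rw [← sum_eigs_sq, Finset.mul_sum, Finset.mul_sum]
      have : ((2 * n : ℕ) : ℝ) * k ^ 2 = ∑ _i : Fin (2 * n), k ^ 2 := by simp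
      rw [this, ← Finset.sum_add_distrib]
      refine Finset.sum_le_sum fun i _ => ?_
      nlinarith [sq_nonneg (k - |eigs c i| / 2), sq_abs (eigs c i)]
    have h2 : ∑ i, perturbedSource n a ε i * c.1 i ≤
        (2 * n : ℕ) * (2 * B ^ 2) + 1 / 8 * hermNormSq c := by
      have h3 : ∑ i, c.1 i ^ 2 ≤ hermNormSq c := by
        rw [hermNormSq_eq]
        have : 0 ≤ ∑ p, ‖c.2 p‖ ^ 2 := Finset.sum_nonneg fun p _ => by positivity
        linarith
      have : ((2 * n : ℕ) : ℝ) * (2 * B ^ 2) = ∑ _i : Fin (2 * n), (2 * B ^ 2) := by simp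
      have h4 : ∑ i, perturbedSource n a ε i * c.1 i ≤
          (2 * n : ℕ) * (2 * B ^ 2) + 1 / 8 * ∑ i, c.1 i ^ 2 := by
        rw [this, Finset.mul_sum, ← Finset.sum_add_distrib]
        refine Finset.sum_le_sum fun i _ => ?_
        have h5 : perturbedSource n a ε i * c.1 i ≤ B * |c.1 i| := by
          refine (le_abs_self _).trans ?_
          rw [abs_mul]
          gcongr
          exact hB i
        nlinarith [sq_nonneg (4 * B - |c.1 i|), sq_abs (c.1 i)]
      linarith
    rw [norm_mul, Complex.norm_real, Real.norm_eq_abs, hermDensity, Real.abs_exp]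
    calc _ ≤ (C * Real.exp (k * ∑ i, |eigs c i|)) *
          Real.exp (∑ i, perturbedSource n a ε i * c.1 i - hermNormSq c / 2) := by
          gcongr
          exact hC _
      _ ≤ _ := by
        rw [mul_assoc, mul_assoc, ← Real.exp_add, ← Real.exp_add]
        simp only [Pi.zero_apply, zero_mul, Finset.sum_const_zero]
        exact mul_le_mul_of_nonneg_left (Real.exp_le_exp.2 (by linarith)) hC0
  · exact (integrable_hermGaussian (by norm_num) 0).const_mul _
  · refine Eventually.of_forall fun c => ?_
    refine Tendsto.const_mul _ ((Complex.continuous_ofReal.tendsto _).comp ?_)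
    have hcont : Continuous fun ε : ℝ => hermDensity (perturbedSource n a ε) c := by
      unfold hermDensity perturbedSource
      fun_prop
    have := (hcont.tendsto 0).mono_left (nhdsWithin_le_nhds (s := {0}ᶜ))
    have h0 : perturbedSource n a 0 = sourceVec n a := by
      ext j
      simp [perturbedSource]
    rwa [h0] at this

/-- The symmetric moments of the eigenvalues for the source `a, …, a, -a, …, -a`. -/
theorem exists_integral_symmetric_confluent (n : ℕ) {a : ℝ} (ha : 0 < a) :
    ∃ κ : ℝ, κ ≠ 0 ∧ ∀ g : MvPolynomial (Fin (2 * n)) ℂ, g.IsSymmetric →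
      ∫ x, aeval (vecEntries x) g *
          ((jointDet (confluentFun n a 0) x * vecDensity 0 x : ℝ) : ℂ) =
        κ * ∫ c : HermCoord (2 * n), aeval (vecEntries (eigs c)) g *
          (hermDensity (sourceVec n a) c : ℂ) := by
  -- The constant of the moment identity at source parameter `ε`, after removal of the power of `ε`.
  -- It is continuous and nonzero at `0`.
  let D : ℝ → ℝ := fun ε => Fintype.card (Equiv.Perm (Fin (2 * n))) * gaussianRatio (2 * n) *
    ∏ j : Fin (2 * n), ∏ i ∈ Finset.Iio j, confluentFactor n a ε i j
  refine ⟨D 0, ?_, fun g hg => ?_⟩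
  · refine mul_ne_zero (mul_ne_zero ?_ gaussianRatio_pos.ne') ?_
    · exact_mod_cast Fintype.card_ne_zero
    · refine Finset.prod_ne_zero_iff.2 fun j _ => Finset.prod_ne_zero_iff.2 fun i hi => ?_
      exact confluentFactor_ne_zero ha (Finset.mem_Iio.1 hi)
  · have hD : Continuous D := by
      refine continuous_const.mul (continuous_finsetProd _ fun j _ =>
        continuous_finsetProd _ fun i _ => ?_)
      unfold confluentFactor perturbedSource
      split_ifs <;> fun_prop
    refine tendsto_nhds_unique (tendsto_integral_jointDet_confluentFun n a g) ?_
    have h1 := ((Complex.continuous_ofReal.comp hD).tendsto 0).mono_left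
      (nhdsWithin_le_nhds (s := {0}ᶜ))
    refine (h1.mul (tendsto_integral_eigs_perturbed n a g)).congr' ?_
    filter_upwards [self_mem_nhdsWithin] with ε hε
    have hε' : ε ≠ 0 := hε
    have h2 := integral_symmetric_jointDet_exp (perturbedSource n a ε) hg
    simp only [jointDet_perturbed a hε', det_vandermonde_perturbedSource] at h2
    have hne : (((∏ j : Fin (2 * n), ε ^ ((j : ℕ) % n) : ℝ)) : ℂ) ≠ 0 := by
      exact_mod_cast Finset.prod_ne_zero_iff.2 fun j _ => pow_ne_zero _ hε'
    have h3 : ∀ x, aeval (vecEntries x) g *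
        ((jointDet (confluentFun n a ε) x * (∏ j : Fin (2 * n), ε ^ ((j : ℕ) % n)) *
          vecDensity 0 x : ℝ) : ℂ) =
        (((∏ j : Fin (2 * n), ε ^ ((j : ℕ) % n) : ℝ)) : ℂ) * (aeval (vecEntries x) g *
        ((jointDet (confluentFun n a ε) x * vecDensity 0 x : ℝ) : ℂ)) := by
      intro x
      push_cast
      ring
    simp only [h3] at h2
    rw [integral_const_mul] at h2
    refine mul_left_cancel₀ hne ?_
    rw [h2]
    simp only [D, Function.comp_apply, Complex.ofReal_mul]
    ring

end Confluent

end EigenvalueLaw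

/-! ### Determinantal point processes of biorthonormal functions -/

section Bordered

/-- For invertible `A` this is the Schur complement. In general `A + t` is singular for only
finitely many `t`, and both sides are continuous in `t`. The adjugate form matters because kernel
matrices may be singular. -/
theorem det_fromBlocks_bordered {ι : Type*} [Fintype ι] [DecidableEq ι] (A : Matrix ι ι ℝ)
    (b c : ι → ℝ) (d : ℝ) :
    (Matrix.fromBlocks A (Matrix.of fun i (_ : Unit) => b i) (Matrix.of fun (_ : Unit) j => c j)
      (Matrix.of fun (_ _ : Unit) => d)).det = d * A.det - c ⬝ᵥ A.adjugate *ᵥ b := by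
  have hunit : ∀ B : Matrix ι ι ℝ, B.det ≠ 0 →
      (Matrix.fromBlocks B (Matrix.of fun i (_ : Unit) => b i)
        (Matrix.of fun (_ : Unit) j => c j) (Matrix.of fun (_ _ : Unit) => d)).det =
        d * B.det - c ⬝ᵥ B.adjugate *ᵥ b := by
    intro B hB
    let := B.invertibleOfIsUnitDet hB.isUnit
    rw [Matrix.det_fromBlocks₁₁, Matrix.det_unique (n := Unit),
      Matrix.invOf_eq_nonsing_inv, Matrix.inv_def, Ring.inverse_eq_inv']
    have h : ((Matrix.of fun (_ : Unit) j => c j) * B.det⁻¹ • B.adjugate *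
        (Matrix.of fun i (_ : Unit) => b i)) default default =
        B.det⁻¹ * (c ⬝ᵥ B.adjugate *ᵥ b) := by
      rw [Matrix.mul_smul, Matrix.smul_mul, Matrix.smul_apply, Matrix.mul_assoc, smul_eq_mul]
      rfl
    rw [Matrix.sub_apply, h]
    simp only [Matrix.of_apply]
    field_simp
  have hfin : {t : ℝ | (A + t • 1).det = 0}.Finite := by
    refine ((-A).charpoly.finite_setOfPred_isRoot (Matrix.charpoly_monic _).ne_zero).subset ?_
    intro t ht
    have ht' : (A + t • 1).det = 0 := ht
    rw [Set.mem_ofPred_eq, Polynomial.IsRoot, Matrix.eval_charpoly, ← ht']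
    congr 1
    rw [sub_neg_eq_add, add_comm, Matrix.smul_one_eq_diagonal]
    rfl
  have hA : Continuous fun t : ℝ => A + t • (1 : Matrix ι ι ℝ) := by fun_prop
  have h := Continuous.ext_on (hfin.countable.dense_compl ℝ)
    (f := fun t : ℝ => (Matrix.fromBlocks (A + t • (1 : Matrix ι ι ℝ))
      (Matrix.of fun i (_ : Unit) => b i) (Matrix.of fun (_ : Unit) j => c j)
      (Matrix.of fun (_ _ : Unit) => d)).det)
    (g := fun t => d * (A + t • (1 : Matrix ι ι ℝ)).det -
      c ⬝ᵥ (A + t • (1 : Matrix ι ι ℝ)).adjugate *ᵥ b)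
    (Continuous.matrix_det (Continuous.matrix_fromBlocks hA continuous_const continuous_const
      continuous_const))
    ((continuous_const.mul hA.matrix_det).sub
      (Continuous.dotProduct continuous_const (hA.matrix_adjugate.matrix_mulVec continuous_const)))
    fun t ht => hunit _ ht
  simpa using congrFun h 0

end Bordered

section Determinantal

variable {N : ℕ}

/-- The kernel of the functions `A_k` and `B_k`. -/
def pairKernel (A B : Fin N → ℝ → ℝ) (x y : ℝ) : ℝ := ∑ k, A k x * B k y

/-- The determinant of the kernel at the points `x_i`. -/
def corrDet (A B : Fin N → ℝ → ℝ) {ι : Type*} [Fintype ι] [DecidableEq ι] (x : ι → ℝ) : ℝ :=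
  (Matrix.of fun i j => pairKernel A B (x i) (x j)).det

theorem corrDet_comp_equiv (A B : Fin N → ℝ → ℝ) {ι κ : Type*} [Fintype ι] [DecidableEq ι]
    [Fintype κ] [DecidableEq κ] (e : κ ≃ ι) (x : ι → ℝ) :
    corrDet A B (x ∘ e) = corrDet A B x := by
  rw [corrDet, corrDet, ← Matrix.det_submatrix_equiv_self e]
  rfl

/-- In this expansion every term is a product of functions of one variable each, so integrability
reduces to that of the products `A k * B l`. -/
theorem corrDet_eq_sum (A B : Fin N → ℝ → ℝ) {ι : Type*} [Fintype ι] [DecidableEq ι]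
    (x : ι → ℝ) : corrDet A B x = ∑ σ : Equiv.Perm ι, ∑ f : ι → Fin N,
      ((Equiv.Perm.sign σ : ℤ) : ℝ) * ∏ i, (A (f (σ.symm i)) (x i) * B (f i) (x i)) := by
  rw [corrDet, Matrix.det_apply']
  refine Finset.sum_congr rfl fun σ _ => ?_
  rw [← Finset.mul_sum]
  congr 1
  simp only [Matrix.of_apply, pairKernel]
  rw [Fintype.prod_sum]
  refine Finset.sum_congr rfl fun f _ => ?_
  rw [Finset.prod_mul_distrib, Finset.prod_mul_distrib]
  congr 1
  conv_rhs => rw [← Equiv.prod_comp σ]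
  simp

theorem corrDet_card (A B : Fin N → ℝ → ℝ) (x : Fin N → ℝ) :
    corrDet A B x = (Matrix.of fun i k => A k (x i)).det * (Matrix.of fun i k => B k (x i)).det := by
  rw [← Matrix.det_transpose (Matrix.of fun i k => B k (x i)), ← Matrix.det_mul, corrDet]
  rfl

/-- The kernel matrix factors through an `N`-dimensional space, so its rank is at most `N < k`. -/
theorem corrDet_eq_zero (A B : Fin N → ℝ → ℝ) {k : ℕ} (hk : N < k) (x : Fin k → ℝ) :
    corrDet A B x = 0 := by
  by_contra h
  have hu : IsUnit (Matrix.of fun i j => pairKernel A B (x i) (x j)) :=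
    (Matrix.isUnit_iff_isUnit_det _).2 (isUnit_iff_ne_zero.2 h)
  have h1 := Matrix.rank_of_isUnit _ hu
  have h2 : (Matrix.of fun i j => pairKernel A B (x i) (x j)) =
      (Matrix.of fun i k => A k (x i)) * (Matrix.of fun k j => B k (x j)) := rfl
  have h3 := (Matrix.rank_mul_le_left (Matrix.of fun i k => A k (x i))
    (Matrix.of fun k j => B k (x j))).trans (Matrix.rank_le_width _)
  rw [← h2, h1, Fintype.card_fin] at h3
  omega

variable {A B : Fin N → ℝ → ℝ}

theorem integrable_corrDet (hint : ∀ k l, Integrable fun x => A k x * B l x) {ι : Type*}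
    [Fintype ι] [DecidableEq ι] : Integrable fun x : ι → ℝ => corrDet A B x := by
  simp only [corrDet_eq_sum]
  refine integrable_finsetSum _ fun σ _ => integrable_finsetSum _ fun f _ => ?_
  exact (Integrable.fintype_prod (f := fun i t => A (f (σ.symm i)) t * B (f i) t)
    fun i => hint _ _).const_mul _

theorem integrable_corrDet_elim (hint : ∀ k l, Integrable fun x => A k x * B l x) {ι κ : Type*}
    [Fintype ι] [DecidableEq ι] [Fintype κ] [DecidableEq κ] (x : ι → ℝ) :
    Integrable fun y : κ → ℝ => corrDet A B (Sum.elim x y) := by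
  simp only [corrDet_eq_sum, Fintype.prod_sum_type, Sum.elim_inl, Sum.elim_inr]
  refine integrable_finsetSum _ fun σ _ => integrable_finsetSum _ fun f _ => ?_
  exact ((Integrable.fintype_prod
    (f := fun i t => A (f (σ.symm (Sum.inr i))) t * B (f (Sum.inr i)) t)
    fun i => hint _ _).const_mul _).const_mul _

/-- Biorthonormality gives `∫ K(t,t) dt = N` and `∫ K(x,t) K(t,y) dt = K(x,y)`. In the bordered
determinant these produce `N det M - tr(adj M · M)`, and the last trace is `|ι| det M`. -/
theorem integral_corrDet_succ (hint : ∀ k l, Integrable fun x => A k x * B l x)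
    (hbi : ∀ k l, ∫ x, A k x * B l x = if k = l then 1 else 0) {ι : Type*}
    [Fintype ι] [DecidableEq ι] (x : ι → ℝ) :
    ∫ t, corrDet A B (Sum.elim x fun _ : Unit => t) = (N - Fintype.card ι) * corrDet A B x := by
  let M : Matrix ι ι ℝ := Matrix.of fun i j => pairKernel A B (x i) (x j)
  have h1 : ∀ t, corrDet A B (Sum.elim x fun _ : Unit => t) =
      (∑ k, A k t * B k t) * M.det -
        ∑ j, ∑ i, ∑ k, ∑ l, M.adjugate j i * A k (x i) * B l (x j) * (A l t * B k t) := by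
    intro t
    have h2 : (Matrix.of fun i j => pairKernel A B (Sum.elim x (fun _ : Unit => t) i)
        (Sum.elim x (fun _ : Unit => t) j)) = Matrix.fromBlocks M
        (Matrix.of fun i (_ : Unit) => pairKernel A B (x i) t)
        (Matrix.of fun (_ : Unit) j => pairKernel A B t (x j))
        (Matrix.of fun (_ _ : Unit) => pairKernel A B t t) := by
      ext i j
      rcases i with i | i <;> rcases j with j | j <;> rfl
    rw [corrDet, h2, det_fromBlocks_bordered]
    congr 1
    simp only [dotProduct, Matrix.mulVec, pairKernel, Finset.mul_sum, Finset.sum_mul]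
    refine Finset.sum_congr rfl fun j _ => Finset.sum_congr rfl fun i _ => ?_
    refine Finset.sum_congr rfl fun k _ => Finset.sum_congr rfl fun l _ => ?_
    ring
  simp only [h1]
  rw [integral_sub, integral_mul_const, integral_finsetSum _ fun k _ => hint k k]
  · simp only [hbi, if_true, Finset.sum_const, Finset.card_univ, Fintype.card_fin, nsmul_eq_mul,
      mul_one]
    have h3 : ∫ t, ∑ j, ∑ i, ∑ k, ∑ l,
        M.adjugate j i * A k (x i) * B l (x j) * (A l t * B k t) =
        ∑ j, ∑ i, M.adjugate j i * M i j := by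
      rw [integral_finsetSum]
      · refine Finset.sum_congr rfl fun j _ => ?_
        rw [integral_finsetSum]
        · refine Finset.sum_congr rfl fun i _ => ?_
          rw [integral_finsetSum]
          · simp only [M, Matrix.of_apply, pairKernel, Finset.mul_sum]
            refine Finset.sum_congr rfl fun k _ => ?_
            rw [integral_finsetSum]
            · simp only [integral_const_mul, hbi]
              simp [mul_assoc]
            · exact fun l _ => (hint l k).const_mul _
          · exact fun k _ => integrable_finsetSum _ fun l _ => (hint l k).const_mul _
        · exact fun i _ => integrable_finsetSum _ fun k _ => integrable_finsetSum _ fun l _ =>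
            (hint l k).const_mul _
      · exact fun j _ => integrable_finsetSum _ fun i _ => integrable_finsetSum _ fun k _ =>
          integrable_finsetSum _ fun l _ => (hint l k).const_mul _
    have h4 : ∑ j, ∑ i, M.adjugate j i * M i j = Fintype.card ι * M.det := by
      have : ∑ j, ∑ i, M.adjugate j i * M i j = (M.adjugate * M).trace := rfl
      rw [this, Matrix.adjugate_mul, Matrix.trace_smul, Matrix.trace_one, smul_eq_mul, mul_comm]
    rw [h3, h4, sub_mul]
    rfl
  · exact (integrable_finsetSum _ fun k _ => hint k k).mul_const _
  · exact integrable_finsetSum _ fun j _ => integrable_finsetSum _ fun i _ =>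
      integrable_finsetSum _ fun k _ => integrable_finsetSum _ fun l _ => (hint l k).const_mul _

/-- The fixed points are indexed by an arbitrary finite type so that, in the induction, the first
integrated variable can join them while the remaining ones are integrated. -/
theorem integral_corrDet_elim (hint : ∀ k l, Integrable fun x => A k x * B l x)
    (hbi : ∀ k l, ∫ x, A k x * B l x = if k = l then 1 else 0) (m : ℕ) {ι : Type}
    [Fintype ι] [DecidableEq ι] (x : ι → ℝ) :
    ∫ y : Fin m → ℝ, corrDet A B (Sum.elim x y) =
      (∏ l ∈ Finset.range m, ((N : ℝ) - Fintype.card ι - l)) * corrDet A B x := by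
  induction m generalizing ι with
  | zero =>
    have h : ∀ y : Fin 0 → ℝ, corrDet A B (Sum.elim x y) = corrDet A B x := by
      intro y
      rw [← corrDet_comp_equiv A B (Equiv.sumEmpty ι (Fin 0)).symm]
      rfl
    have h0 : (volume : Measure (Fin 0 → ℝ)) = Measure.dirac isEmptyElim := Measure.pi_of_empty _
    simp [h, h0]
  | succ m ih =>
    have hmp := (volume_preserving_piFinSuccAbove (fun _ : Fin (m + 1) => ℝ) 0).symm
    let e : (ι ⊕ Unit) ⊕ Fin m ≃ ι ⊕ Fin (m + 1) := (Equiv.sumAssoc ι Unit (Fin m)).trans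
      ((Equiv.refl ι).sumCongr ((Equiv.sumComm Unit (Fin m)).trans
        ((Equiv.optionEquivSumPUnit.{0} (Fin m)).symm.trans (finSuccEquiv m).symm)))
    have he : ∀ (t : ℝ) (y : Fin m → ℝ),
        corrDet A B (Sum.elim x ((MeasurableEquiv.piFinSuccAbove (fun _ => ℝ) 0).symm (t, y))) =
          corrDet A B (Sum.elim (Sum.elim x fun _ : Unit => t) y) := by
      intro t y
      rw [← corrDet_comp_equiv A B e]
      congr 1
      ext i
      rcases i with (i | i) | i
      · rfl
      · simp [e, MeasurableEquiv.piFinSuccAbove]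
      · simp [e, MeasurableEquiv.piFinSuccAbove]
    rw [← hmp.integral_comp', Measure.volume_eq_prod, integral_prod]
    · simp only [he, ih]
      rw [integral_const_mul, integral_corrDet_succ hint hbi, ← mul_assoc,
        Finset.prod_range_succ']
      congr 2
      · refine Finset.prod_congr rfl fun l _ => ?_
        rw [Fintype.card_sum, Fintype.card_unit]
        push_cast
        ring
      · simp
    · rw [← Measure.volume_eq_prod]
      exact (hmp.integrable_comp_emb (MeasurableEquiv.measurableEmbedding _)).2
        (integrable_corrDet_elim hint x)

theorem integrable_mul_corrDet (hint : ∀ k l, Integrable fun x => A k x * B l x) {ι : Type*}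
    [Fintype ι] [DecidableEq ι] {f : (ι → ℝ) → ℝ} (hf : Measurable f) {C : ℝ}
    (hC : ∀ x, |f x| ≤ C) : Integrable fun x => f x * corrDet A B x :=
  (integrable_corrDet hint).bdd_mul hf.aestronglyMeasurable (Eventually.of_forall hC)

/-- The coordinates split into those selected by `e` and the rest. The test function ignores the
rest, and integrating out those `N - k` variables gives the factors `N - k, …, 1`. -/
theorem integral_mul_corrDet_embedding (hint : ∀ k l, Integrable fun x => A k x * B l x)
    (hbi : ∀ k l, ∫ x, A k x * B l x = if k = l then 1 else 0) {k : ℕ} (e : Fin k ↪ Fin N)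
    {f : (Fin k → ℝ) → ℝ} (hf : Measurable f) {C : ℝ} (hC : ∀ x, |f x| ≤ C) :
    ∫ z : Fin N → ℝ, f (fun i => z (e i)) * corrDet A B z =
      ((N - k).factorial : ℝ) * ∫ x, f x * corrDet A B x := by
  have hk : k ≤ N := by simpa using Fintype.card_le_of_embedding e
  let m := N - k
  have hm : Fintype.card ((Set.range e)ᶜ : Set (Fin N)) = m := by
    rw [Fintype.card_compl_set, Set.card_range_of_injective e.injective]
    simp [m]
  let g : Fin k ⊕ Fin m ≃ Fin N :=
    (Equiv.sumCongr (Equiv.ofInjective e e.injective) (Fintype.equivFinOfCardEq hm).symm).trans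
      (Equiv.Set.sumCompl (Set.range e))
  have hg : ∀ i, g (Sum.inl i) = e i := fun i => by simp [g]
  have hmp := (volume_measurePreserving_piCongrLeft (fun _ : Fin N => ℝ) g).comp
    (volume_measurePreserving_sumPiEquivProdPi_symm (fun _ : Fin k ⊕ Fin m => ℝ))
  let E := (MeasurableEquiv.sumPiEquivProdPi (fun _ : Fin k ⊕ Fin m => ℝ)).symm.trans
    (MeasurableEquiv.piCongrLeft (fun _ : Fin N => ℝ) g)
  have hE : MeasurePreserving E volume volume := hmp
  have hEg : ∀ (x : Fin k → ℝ) (y : Fin m → ℝ), E (x, y) ∘ g = Sum.elim x y := by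
    intro x y
    ext i
    have := MeasurableEquiv.piCongrLeft_apply_apply (β := fun _ : Fin N => ℝ) g
      ((MeasurableEquiv.sumPiEquivProdPi (fun _ : Fin k ⊕ Fin m => ℝ)).symm (x, y)) i
    refine this.trans ?_
    rcases i with i | i <;> rfl
  have hEe : ∀ (x : Fin k → ℝ) (y : Fin m → ℝ), (fun i => E (x, y) (e i)) = x := by
    intro x y
    ext i
    rw [← hg]
    exact congrFun (hEg x y) (Sum.inl i)
  have hF : ∀ x y, f (fun i => E (x, y) (e i)) * corrDet A B (E (x, y)) =
      f x * corrDet A B (Sum.elim x y) := by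
    intro x y
    rw [hEe, ← corrDet_comp_equiv A B g, hEg]
  have hInt : Integrable fun z : Fin N → ℝ => f (fun i => z (e i)) * corrDet A B z :=
    integrable_mul_corrDet hint (hf.comp (measurable_pi_lambda _ fun i => measurable_pi_apply _))
      fun x => hC _
  have hInt2 := (hE.integrable_comp_emb E.measurableEmbedding).2 hInt
  rw [← hE.integral_comp', Measure.volume_eq_prod, integral_prod]
  · simp only [hF]
    rw [← integral_const_mul]
    refine integral_congr_ae (Eventually.of_forall fun x => ?_)
    simp only
    rw [integral_const_mul, integral_corrDet_elim hint hbi, Fintype.card_fin]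
    have h1 : ∏ l ∈ Finset.range m, ((N : ℝ) - k - l) = (m.factorial : ℝ) := by
      rw [← Finset.prod_range_add_one_eq_factorial, ← Finset.prod_range_reflect]
      push_cast
      refine Finset.prod_congr rfl fun l hl => ?_
      have hl' : l + 1 ≤ m := Finset.mem_range.1 hl
      rw [Nat.sub_sub, add_comm 1 l, Nat.cast_sub hl', Nat.cast_sub hk]
      push_cast
      ring
    rw [h1]
    ring
  · rw [← Measure.volume_eq_prod]
    exact hInt2

/-- A random vector whose symmetrized law has density `det (K (x_i, x_j)) / N!`, for the kernel `K`
of a biorthonormal system, has correlation kernel `K`. -/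
theorem isCorrelationKernel_pairKernel (hint : ∀ k l, Integrable fun x => A k x * B l x)
    (hbi : ∀ k l, ∫ x, A k x * B l x = if k = l then 1 else 0) {Ω : Type*} [MeasurableSpace Ω]
    (P : Measure Ω) [IsProbabilityMeasure P] {X : Ω → Fin N → ℝ} (hX : Measurable X)
    (hlaw : ∀ S : (Fin N → ℝ) → ℝ, Measurable S → (∃ C, ∀ x, |S x| ≤ C) →
      (∀ (σ : Equiv.Perm (Fin N)) x, S (x ∘ σ) = S x) →
      ∫ ω, S (X ω) ∂P = (N.factorial : ℝ)⁻¹ * ∫ x, S x * corrDet A B x) :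
    IsCorrelationKernel P X (pairKernel A B) := by
  rintro k f hf ⟨C, hC⟩
  have hfe : ∀ e : Fin k ↪ Fin N, Measurable fun x : Fin N → ℝ => f fun i => x (e i) := fun e =>
    hf.comp (measurable_pi_lambda _ fun i => measurable_pi_apply _)
  have hS : Measurable fun x : Fin N → ℝ => ∑ e : Fin k ↪ Fin N, f fun i => x (e i) :=
    Finset.measurable_fun_sum _ fun e _ => hfe e
  have hSb : ∀ x : Fin N → ℝ, |∑ e : Fin k ↪ Fin N, f fun i => x (e i)| ≤
      ∑ _e : Fin k ↪ Fin N, C := fun x =>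
    (Finset.abs_sum_le_sum_abs _ _).trans (Finset.sum_le_sum fun e _ => hC _)
  refine ⟨?_, integrable_mul_corrDet hint hf hC, ?_⟩
  · exact Integrable.of_bound (hS.comp hX).aestronglyMeasurable _
      (Eventually.of_forall fun ω => hSb (X ω))
  · rw [hlaw (fun x => ∑ e : Fin k ↪ Fin N, f fun i => x (e i)) hS ⟨_, hSb⟩]
    · simp only [Finset.sum_mul]
      rw [integral_finsetSum]
      · simp only [integral_mul_corrDet_embedding hint hbi _ hf hC, Finset.sum_const,
          Finset.card_univ, Fintype.card_embedding_eq, Fintype.card_fin, nsmul_eq_mul]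
        -- For `k ≤ N` the number of embeddings `N!/(N-k)!` cancels the other factorials. For `k >
        -- N` there are no embeddings and the determinant vanishes.
        rcases le_or_gt k N with hk | hk
        · have h1 : ((N - k).factorial : ℝ) * (N.descFactorial k : ℝ) = N.factorial := by
            exact_mod_cast Nat.factorial_mul_descFactorial hk
          have h2 : (N.factorial : ℝ) ≠ 0 := by positivity
          rw [← mul_assoc (N.descFactorial k : ℝ), mul_comm (N.descFactorial k : ℝ), h1,
            inv_mul_cancel_left₀ h2]
          rfl
        · have h1 : ∀ x : Fin k → ℝ,
              (Matrix.of fun i j => pairKernel A B (x i) (x j)).det = 0 :=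
            corrDet_eq_zero A B hk
          simp [h1, Nat.descFactorial_of_lt hk]
      · exact fun e _ => integrable_mul_corrDet hint (hfe e) fun x => hC _
    · intro σ x
      exact (Equiv.sum_comp (Equiv.embeddingCongr (Equiv.refl (Fin k)) σ)
        fun e : Fin k ↪ Fin N => f fun i => x (e i))

/-- Andréief's identity. -/
theorem integral_det_mul_det (hint : ∀ k l, Integrable fun x => A k x * B l x) :
    Integrable (fun x : Fin N → ℝ => (Matrix.of fun i k => A k (x i)).det *
      (Matrix.of fun i k => B k (x i)).det) ∧
    ∫ x : Fin N → ℝ, (Matrix.of fun i k => A k (x i)).det * (Matrix.of fun i k => B k (x i)).det =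
      N.factorial * (Matrix.of fun k l => ∫ x, A k x * B l x).det := by
  have h1 : ∀ x : Fin N → ℝ, (Matrix.of fun i k => A k (x i)).det *
      (Matrix.of fun i k => B k (x i)).det = ∑ σ : Equiv.Perm (Fin N), ∑ τ : Equiv.Perm (Fin N),
        (((Equiv.Perm.sign σ : ℤ) : ℝ) * ((Equiv.Perm.sign τ : ℤ) : ℝ)) *
          ∏ i, (A (σ i) (x i) * B (τ i) (x i)) := by
    intro x
    rw [← Matrix.det_transpose, ← Matrix.det_transpose (Matrix.of fun i k => B k (x i)),
      Matrix.det_apply', Matrix.det_apply', Finset.sum_mul_sum]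
    refine Finset.sum_congr rfl fun σ _ => Finset.sum_congr rfl fun τ _ => ?_
    rw [Finset.prod_mul_distrib]
    simp only [Matrix.transpose_apply, Matrix.of_apply]
    ring
  have h2 : ∀ σ τ : Equiv.Perm (Fin N), Integrable fun x : Fin N → ℝ =>
      ∏ i, (A (σ i) (x i) * B (τ i) (x i)) := fun σ τ =>
    Integrable.fintype_prod (f := fun i t => A (σ i) t * B (τ i) t) fun i => hint _ _
  refine ⟨?_, ?_⟩
  · simp only [h1]
    exact integrable_finsetSum _ fun σ _ => integrable_finsetSum _ fun τ _ => (h2 σ τ).const_mul _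
  · simp only [h1]
    rw [integral_finsetSum _ fun σ _ => integrable_finsetSum _ fun τ _ => (h2 σ τ).const_mul _]
    have h3 : ∀ σ : Equiv.Perm (Fin N), ∫ x : Fin N → ℝ, ∑ τ : Equiv.Perm (Fin N),
        (((Equiv.Perm.sign σ : ℤ) : ℝ) * ((Equiv.Perm.sign τ : ℤ) : ℝ)) *
          ∏ i, (A (σ i) (x i) * B (τ i) (x i)) =
        (Matrix.of fun k l => ∫ x, A k x * B l x).det := by
      intro σ
      rw [integral_finsetSum _ fun τ _ => (h2 σ τ).const_mul _]
      have h4 : ∀ τ : Equiv.Perm (Fin N), ∫ x : Fin N → ℝ,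
          ∏ i, (A (σ i) (x i) * B (τ i) (x i)) = ∏ i, ∫ x, A (σ i) x * B (τ i) x := fun τ =>
        integral_fintype_prod_volume_eq_prod fun i t => A (σ i) t * B (τ i) t
      simp only [integral_const_mul, h4]
      have h5 := Matrix.det_permute σ (Matrix.of fun k l => ∫ x, A k x * B l x)
      have h6 : (Matrix.of fun k l => ∫ x, A k x * B l x).det = (Equiv.Perm.sign σ : ℤ) *
          ((Matrix.of fun k l => ∫ x, A k x * B l x).submatrix σ id).det := by
        rw [h5, ← mul_assoc, sign_mul_sign_cast, one_mul]
      rw [h6, ← Matrix.det_transpose, Matrix.det_apply', Finset.mul_sum]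
      refine Finset.sum_congr rfl fun τ _ => ?_
      rw [mul_assoc]
      rfl
    simp [h3, Fintype.card_perm]

end Determinantal

/-! ### Reweighting by `det (w M)` -/

section Weight

variable {w : ℝ → ℝ}

/-- On a bounded interval the exponential is bounded and `w` is integrable. Outside it, `w` decays
at rate `c + 1`, which leaves `e^{-|x|}`, at most `2/(1 + x²)`. -/
theorem integrable_mul_weight (hw : IsEvenWeight w) {f : ℝ → ℝ} (hf : Measurable f) {C c : ℝ}
    (h : ∀ x, |f x| ≤ C * Real.exp (c * |x|)) : Integrable fun x => f x * w x := by
  have hC : 0 ≤ C := by simpa using (abs_nonneg _).trans (h 0)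
  obtain ⟨R, hR⟩ := (Metric.isCompact_iff_isClosed_bounded.1
    (mem_cocompact.1 (hw.decay (c + 1))).choose_spec.1).2.subset_closedBall 0
  have hdecay : ∀ x, R < |x| → w x ≤ Real.exp (-(c + 1) * |x|) := by
    intro x hx
    refine (mem_cocompact.1 (hw.decay (c + 1))).choose_spec.2 fun hx' => ?_
    have := hR hx'
    rw [Metric.mem_closedBall, dist_zero_right, Real.norm_eq_abs] at this
    linarith
  refine ((hw.integrable.const_mul (C * Real.exp (|c| * R))).add
    (integrable_inv_one_add_sq.const_mul (C * 2))).mono'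
    (hf.mul hw.measurable).aestronglyMeasurable (Eventually.of_forall fun x => ?_)
  rw [norm_mul, Real.norm_eq_abs, Real.norm_eq_abs, abs_of_nonneg (hw.nonneg x)]
  simp only [Pi.add_apply]
  have hpos : 0 ≤ C * 2 * (1 + x ^ 2)⁻¹ := by positivity
  have hpos' : 0 ≤ C * Real.exp (|c| * R) * w x := mul_nonneg (by positivity) (hw.nonneg x)
  rcases le_or_gt |x| R with hx | hx
  · have h1 : Real.exp (c * |x|) ≤ Real.exp (|c| * R) := by
      rw [Real.exp_le_exp]
      exact mul_le_mul (le_abs_self c) hx (abs_nonneg _) (abs_nonneg _)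
    have h2 : |f x| * w x ≤ C * Real.exp (|c| * R) * w x :=
      mul_le_mul_of_nonneg_right ((h x).trans (mul_le_mul_of_nonneg_left h1 hC)) (hw.nonneg x)
    linarith
  · have h1 : |f x| * w x ≤ C * Real.exp (c * |x|) * Real.exp (-(c + 1) * |x|) :=
      mul_le_mul (h x) (hdecay x hx) (hw.nonneg x) (by positivity)
    have h2 : Real.exp (c * |x|) * Real.exp (-(c + 1) * |x|) = (Real.exp |x|)⁻¹ := by
      rw [← Real.exp_add, ← Real.exp_neg]
      ring_nf
    have h3 := Real.quadratic_le_exp_of_nonneg (abs_nonneg x)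
    have h4 : (Real.exp |x|)⁻¹ ≤ 2 * (1 + x ^ 2)⁻¹ := by
      rw [← div_eq_mul_inv, inv_eq_one_div, div_le_div_iff₀ (Real.exp_pos _) (by positivity)]
      nlinarith [sq_abs x, abs_nonneg x]
    rw [mul_assoc, h2] at h1
    have h5 : C * (Real.exp |x|)⁻¹ ≤ C * (2 * (1 + x ^ 2)⁻¹) := mul_le_mul_of_nonneg_left h4 hC
    linarith

theorem abs_pow_le_exp (k : ℕ) (x : ℝ) : |x ^ k| ≤ Real.exp (k * |x|) := by
  rw [abs_pow, Real.exp_nat_mul]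
  exact pow_le_pow_left₀ (abs_nonneg _) (by linarith [Real.add_one_le_exp |x|]) _

theorem confluentFun_zero (n : ℕ) (a : ℝ) (j : Fin (2 * n)) (x : ℝ) :
    confluentFun n a 0 j x = Real.exp (sourceVec n a j * x) * x ^ ((j : ℕ) % n) := by
  simp [confluentFun, expQuotient]

theorem integrable_pow_mul_confluentFun (hw : IsEvenWeight w) (n : ℕ) (a : ℝ) (k : ℕ)
    (j : Fin (2 * n)) : Integrable fun x => x ^ k * confluentFun n a 0 j x * w x := by
  refine integrable_mul_weight hw (C := 1) (c := k + (|a| + 2 * n)) ?_ fun x => ?_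
  · exact ((continuous_pow k).mul (continuous_confluentFun n a 0 j)).measurable
  · rw [abs_mul, one_mul, add_mul, Real.exp_add]
    exact mul_le_mul (abs_pow_le_exp k x) (abs_confluentFun_le n a (by simp) j x) (abs_nonneg _)
      (Real.exp_pos _).le

end Weight

/-! ### The density of the matrix model and positivity of the partition function. -/

section Law

variable {N : ℕ} {w : ℝ → ℝ}

theorem det_cfc_hermMatrix (w : ℝ → ℝ) (c : HermCoord N) :
    ((hermMatrix_isHermitian c).cfc w).det = ((∏ i, w (eigs c i) : ℝ) : ℂ) := by
  simp only [Matrix.IsHermitian.cfc, Matrix.det_map, Matrix.det_diagonal]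
  simp [eigs]

theorem trace_sourceMatrix_mul (n : ℕ) (a : ℝ) (c : HermCoord (2 * n)) :
    (sourceMatrix n a * hermMatrix c).trace = ((∑ i, sourceVec n a i * c.1 i : ℝ) : ℂ) := by
  rw [sourceMatrix, Matrix.trace]
  push_cast
  refine Finset.sum_congr rfl fun i _ => ?_
  rw [Matrix.diag_apply, Matrix.diagonal_mul, hermMatrix_self, sourceVec]
  split_ifs <;> simp

theorem extDensity_eq (w : ℝ → ℝ) (n : ℕ) (a : ℝ) (c : HermCoord (2 * n)) :
    extDensity w n a c =
      (∏ i, w (eigs c i)) * Real.exp (∑ i, sourceVec n a i * c.1 i) := by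
  rw [extDensity, det_cfc_hermMatrix, trace_sourceMatrix_mul, ← Complex.ofReal_exp,
    ← Complex.ofReal_mul, Complex.ofReal_re]

theorem measurable_prod_weight (hw : Measurable w) :
    Measurable fun x : Fin N → ℝ => ∏ i, w (x i) :=
  Finset.measurable_fun_prod _ fun i _ => hw.comp (measurable_pi_apply i)

theorem measurable_extDensity (hw : Measurable w) (n : ℕ) (a : ℝ) :
    Measurable (extDensity w n a) := by
  have h : extDensity w n a = fun c =>
      (∏ i, w (eigs c i)) * Real.exp (∑ i, sourceVec n a i * c.1 i) :=
    funext (extDensity_eq w n a)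
  rw [h]
  exact ((measurable_prod_weight hw).comp measurable_eigs).mul (by fun_prop)

/-- Reweighting of a Gaussian matrix with source by `det (w M) e^{Tr M² / 2}`. -/
theorem lintegral_eigs_weight (hw : IsEvenWeight w) {β : Fin N → ℝ} {r : (Fin N → ℝ) → ℝ}
    (h : ∀ F : (Fin N → ℝ) → ℝ≥0∞, Measurable F →
      (∀ (σ : Equiv.Perm (Fin N)) x, F (x ∘ σ) = F x) →
      ∫⁻ c : HermCoord N, F (eigs c) * ENNReal.ofReal (hermDensity β c) =
        ∫⁻ x, F x * ENNReal.ofReal (r x * vecDensity 0 x))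
    {F : (Fin N → ℝ) → ℝ≥0∞} (hF : Measurable F)
    (hFs : ∀ (σ : Equiv.Perm (Fin N)) x, F (x ∘ σ) = F x) :
    ∫⁻ c : HermCoord N, F (eigs c) *
        ENNReal.ofReal ((∏ i, w (eigs c i)) * Real.exp (∑ i, β i * c.1 i)) =
      ∫⁻ x, F x * ENNReal.ofReal (r x * ∏ i, w (x i)) := by
  -- This is `det (w M) e^{Tr M²/2}` in terms of the eigenvalues; its exponential cancels the
  -- Gaussian on both sides.
  let D : (Fin N → ℝ) → ℝ := fun x => (∏ i, w (x i)) * Real.exp (∑ i, x i ^ 2 / 2)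
  have hD0 : ∀ x, 0 ≤ D x := fun x =>
    mul_nonneg (Finset.prod_nonneg fun i _ => hw.nonneg _) (Real.exp_pos _).le
  have hD : Measurable D := (measurable_prod_weight hw.measurable).mul (by fun_prop)
  have h1 := h (fun x => F x * ENNReal.ofReal (D x)) (hF.mul hD.ennreal_ofReal) (fun σ x => by
    simp only [D, hFs, Function.comp_apply]
    rw [Equiv.prod_comp σ fun i => w (x i), Equiv.sum_comp σ fun i => x i ^ 2 / 2])
  have h2 : ∀ c : HermCoord N, F (eigs c) * ENNReal.ofReal (D (eigs c)) *
      ENNReal.ofReal (hermDensity β c) = F (eigs c) *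
        ENNReal.ofReal ((∏ i, w (eigs c i)) * Real.exp (∑ i, β i * c.1 i)) := by
    intro c
    rw [mul_assoc, ← ENNReal.ofReal_mul (hD0 _)]
    congr 2
    simp only [D, hermDensity]
    rw [mul_assoc, ← Real.exp_add, ← Finset.sum_div, sum_eigs_sq]
    ring_nf
  have h3 : ∀ x, F x * ENNReal.ofReal (D x) * ENNReal.ofReal (r x * vecDensity 0 x) =
      F x * ENNReal.ofReal (r x * ∏ i, w (x i)) := by
    intro x
    rw [mul_assoc, ← ENNReal.ofReal_mul (hD0 _)]
    congr 2
    have h4 : Real.exp (∑ i, x i ^ 2 / 2) * vecDensity 0 x = 1 := by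
      rw [vecDensity, ← Real.exp_add, ← Finset.sum_add_distrib]
      simp
    calc D x * (r x * vecDensity 0 x) =
        r x * (∏ i, w (x i)) * (Real.exp (∑ i, x i ^ 2 / 2) * vecDensity 0 x) := by
          simp only [D]; ring
      _ = _ := by rw [h4, mul_one]
  simpa only [h2, h3] using h1

theorem ae_injective : ∀ᵐ x : Fin N → ℝ, Function.Injective x := by
  have h : ∀ i j : Fin N, i ≠ j → ∀ᵐ x : Fin N → ℝ, x i ≠ x j := by
    intro i j hij
    let L : (Fin N → ℝ) →ₗ[ℝ] ℝ :=
      LinearMap.proj (R := ℝ) (φ := fun _ => ℝ) i - LinearMap.proj (R := ℝ) (φ := fun _ => ℝ) j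
    have hL : LinearMap.ker L ≠ ⊤ := by
      intro htop
      have h1 : Pi.single i (1 : ℝ) ∈ LinearMap.ker L := htop ▸ Submodule.mem_top
      simp [L, hij.symm] at h1
    have h2 := Measure.addHaar_submodule (volume : Measure (Fin N → ℝ)) _ hL
    refine measure_mono_null (fun x hx => ?_) h2
    have hx' : x i = x j := not_not.1 hx
    simp [L, hx']
  have h' : ∀ᵐ x : Fin N → ℝ, ∀ i j : Fin N, i ≠ j → x i ≠ x j := by
    rw [ae_all_iff]
    intro i
    rw [ae_all_iff]
    intro j
    by_cases hij : i = j
    · simp [hij]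
    · filter_upwards [h i j hij] with x hx _ using hx
  filter_upwards [h'] with x hx i j hij
  by_contra hne
  exact hx i j hne hij

/-- For integer exponents `0, …, N-1` the exponential determinant is a Vandermonde determinant in
the `e^{x_i}`. -/
theorem jointDet_exp_ne_zero {x : Fin N → ℝ} (hx : Function.Injective x) :
    jointDet (fun j y => Real.exp (((j : ℕ) : ℝ) * y)) x ≠ 0 := by
  refine mul_ne_zero (Matrix.det_vandermonde_ne_zero_iff.2 hx) ?_
  have h : (Matrix.of fun i j : Fin N => Real.exp (((j : ℕ) : ℝ) * x i)) =
      Matrix.vandermonde fun i => Real.exp (x i) := by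
    ext i j
    rw [Matrix.of_apply, Matrix.vandermonde_apply, Real.exp_nat_mul]
  rw [h]
  exact Matrix.det_vandermonde_ne_zero_iff.2 (Real.exp_injective.comp hx)

/-- Whether the density vanishes almost everywhere depends only on `∏ w(λ_i)`, not on the source. It
may thus be tested with the source `0, 1, …, 2n-1`, whose joint determinant is nonzero at distinct
points. If `Z = 0`, then `∏ w(x_i) = 0` almost everywhere, contradicting `∫ w > 0`. -/
theorem partitionFn_ne_zero (hw : IsEvenWeight w) (n : ℕ) (a : ℝ) : partitionFn w n a ≠ 0 := by
  intro h0
  rw [partitionFn, lintegral_eq_zero_iff (measurable_extDensity hw.measurable n a).ennreal_ofReal]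
    at h0
  let β : Fin (2 * n) → ℝ := fun j => ((j : ℕ) : ℝ)
  have hβ : Function.Injective β := fun i j hij => Fin.ext (Nat.cast_injective (R := ℝ) hij)
  have hκ : Fintype.card (Equiv.Perm (Fin (2 * n))) * gaussianRatio (2 * n) *
      (Matrix.vandermonde β).det ≠ 0 :=
    mul_ne_zero (mul_ne_zero (by exact_mod_cast Fintype.card_ne_zero) gaussianRatio_pos.ne')
      (Matrix.det_vandermonde_ne_zero_iff.2 hβ)
  obtain ⟨hnn, hlaw⟩ := eigenvalue_law_of_jointDet β (θ := fun j y => Real.exp (β j * y))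
    (fun j => by fun_prop) (abs_exp_mul_le β) hκ fun g hg => integral_symmetric_jointDet_exp β hg
  have h1 := lintegral_eigs_weight hw hlaw (F := fun _ => 1) measurable_const fun _ _ => rfl
  have h2 : ∫⁻ c : HermCoord (2 * n), (1 : ℝ≥0∞) *
      ENNReal.ofReal ((∏ i, w (eigs c i)) * Real.exp (∑ i, β i * c.1 i)) = 0 := by
    rw [lintegral_congr_ae (g := fun _ => 0), lintegral_zero]
    filter_upwards [h0] with c hc
    have h3 : (∏ i, w (eigs c i)) = 0 := by
      have h4 : extDensity w n a c ≤ 0 := ENNReal.ofReal_eq_zero.1 hc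
      rw [extDensity_eq] at h4
      exact le_antisymm (nonpos_of_mul_nonpos_left h4 (Real.exp_pos _))
        (Finset.prod_nonneg fun i _ => hw.nonneg _)
    simp [h3]
  rw [h2] at h1
  simp only [one_mul] at h1
  have hmeas : Measurable fun x : Fin (2 * n) → ℝ =>
      ((Fintype.card (Equiv.Perm (Fin (2 * n))) * gaussianRatio (2 * n) *
        (Matrix.vandermonde β).det)⁻¹ * jointDet (fun j y => Real.exp (β j * y)) x) *
        ∏ i, w (x i) :=
    ((continuous_jointDet fun j => by fun_prop).measurable.const_mul _).mul
      (measurable_prod_weight hw.measurable)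
  have h5 := (lintegral_eq_zero_iff hmeas.ennreal_ofReal).1 h1.symm
  have h6 : ∀ᵐ x : Fin (2 * n) → ℝ, ∏ i, w (x i) = 0 := by
    filter_upwards [h5, hnn, ae_injective] with x hx1 hx2 hx3
    have hx4 := ENNReal.ofReal_eq_zero.1 hx1
    have hx5 := mul_ne_zero (inv_ne_zero hκ) (jointDet_exp_ne_zero hx3)
    exact le_antisymm (nonpos_of_mul_nonpos_right hx4 (lt_of_le_of_ne hx2 hx5.symm))
      (Finset.prod_nonneg fun i _ => hw.nonneg _)
  have h7 : ∫ x : Fin (2 * n) → ℝ, ∏ i, w (x i) = 0 := by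
    rw [integral_congr_ae h6, integral_zero]
  rw [integral_fintype_prod_volume_eq_pow] at h7
  exact (pow_pos hw.integral_pos _).ne' h7

end Law

/-! ### The external source kernel -/

section ChangeOfBasis

variable {N : ℕ} {w : ℝ → ℝ}

/-- The functions `∑ k, P j k * φ k`. -/
def transform (P : Matrix (Fin N) (Fin N) ℝ) (φ : Fin N → ℝ → ℝ) : Fin N → ℝ → ℝ :=
  fun j x => ∑ k, P j k * φ k x

theorem exists_transform_eq {φ φ' : Fin N → ℝ → ℝ} (hφ : LinearIndependent ℝ φ)
    (h : Submodule.span ℝ (Set.range φ) = Submodule.span ℝ (Set.range φ')) :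
    ∃ P : Matrix (Fin N) (Fin N) ℝ, IsUnit P.det ∧ φ = transform P φ' := by
  have h1 : ∀ j, ∃ c : Fin N → ℝ, ∑ k, c k • φ' k = φ j := fun j =>
    Submodule.mem_span_range_iff_exists_fun ℝ |>.1 (h ▸ Submodule.subset_span ⟨j, rfl⟩)
  have h2 : ∀ j, ∃ c : Fin N → ℝ, ∑ k, c k • φ k = φ' j := fun j =>
    Submodule.mem_span_range_iff_exists_fun ℝ |>.1 (h ▸ Submodule.subset_span ⟨j, rfl⟩)
  choose P hP using h1
  choose Q hQ using h2
  refine ⟨Matrix.of P, ?_, ?_⟩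
  · have h3 : Matrix.of P * Matrix.of Q = 1 := by
      ext j l
      have h4 : ∑ l, (Matrix.of P * Matrix.of Q) j l • φ l = ∑ l, (1 : Matrix _ _ ℝ) j l • φ l := by
        calc ∑ l, (Matrix.of P * Matrix.of Q) j l • φ l = ∑ k, P j k • ∑ l, Q k l • φ l := by
              simp only [Matrix.mul_apply, Matrix.of_apply, Finset.sum_smul, Finset.smul_sum,
                smul_smul]
              exact Finset.sum_comm
          _ = φ j := by simp only [hQ, hP]
          _ = _ := by simp [Matrix.one_apply]
      have h5 := Fintype.linearIndependent_iff.1 hφ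
        (fun l => (Matrix.of P * Matrix.of Q) j l - (1 : Matrix _ _ ℝ) j l)
        (by simp only [sub_smul, Finset.sum_sub_distrib, h4, sub_self]) l
      exact sub_eq_zero.1 h5
    exact Matrix.isUnit_det_of_right_inverse h3
  · ext j x
    rw [← hP j]
    simp [transform]

theorem integrable_transform {φ ψ : Fin N → ℝ → ℝ}
    (h : ∀ j k, Integrable fun x => φ j x * ψ k x * w x) (P Q : Matrix (Fin N) (Fin N) ℝ)
    (j k : Fin N) : Integrable fun x => transform P φ j x * transform Q ψ k x * w x := by
  have h1 : ∀ x, transform P φ j x * transform Q ψ k x * w x =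
      ∑ l, ∑ m, P j l * Q k m * (φ l x * ψ m x * w x) := by
    intro x
    rw [transform, transform, Finset.sum_mul_sum, Finset.sum_mul]
    refine Finset.sum_congr rfl fun l _ => ?_
    rw [Finset.sum_mul]
    exact Finset.sum_congr rfl fun m _ => by ring
  simp only [h1]
  exact integrable_finsetSum _ fun l _ => integrable_finsetSum _ fun m _ => (h l m).const_mul _

theorem momentMatrix_transform {φ ψ : Fin N → ℝ → ℝ}
    (h : ∀ j k, Integrable fun x => φ j x * ψ k x * w x) (P Q : Matrix (Fin N) (Fin N) ℝ) :
    momentMatrix w (transform P φ) (transform Q ψ) = P * momentMatrix w φ ψ * Qᵀ := by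
  ext j k
  have h1 : ∀ x, transform P φ j x * transform Q ψ k x * w x =
      ∑ m, ∑ l, P j l * Q k m * (φ l x * ψ m x * w x) := by
    intro x
    rw [transform, transform, Finset.sum_mul_sum, Finset.sum_comm, Finset.sum_mul]
    refine Finset.sum_congr rfl fun l _ => ?_
    rw [Finset.sum_mul]
    exact Finset.sum_congr rfl fun m _ => by ring
  rw [momentMatrix, Matrix.of_apply]
  simp only [h1]
  rw [integral_finsetSum _ fun m _ => integrable_finsetSum _ fun l _ => (h l m).const_mul _,
    Matrix.mul_apply]
  refine Finset.sum_congr rfl fun m _ => ?_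
  rw [integral_finsetSum _ fun l _ => (h l m).const_mul _, Matrix.mul_apply, Finset.sum_mul]
  refine Finset.sum_congr rfl fun l _ => ?_
  rw [integral_const_mul, Matrix.transpose_apply, momentMatrix, Matrix.of_apply]
  ring

/-- The Gram matrix becomes `P G Qᵀ`, whose inverse transpose undoes both changes of basis. -/
theorem extKernel_transform {φ ψ : Fin N → ℝ → ℝ}
    (h : ∀ j k, Integrable fun x => φ j x * ψ k x * w x) {P Q : Matrix (Fin N) (Fin N) ℝ}
    (hP : IsUnit P.det) (hQ : IsUnit Q.det) (x y : ℝ) :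
    extKernel w (transform P φ) (transform Q ψ) x y = extKernel w φ ψ x y := by
  rw [extKernel, extKernel, momentMatrix_transform h]
  congr 1
  have h1 : (fun j => transform P φ j y) = P *ᵥ fun k => φ k y := rfl
  have h2 : (fun j => transform Q ψ j x) = Q *ᵥ fun k => ψ k x := rfl
  rw [h1, h2, Matrix.mul_inv_rev, Matrix.mul_inv_rev, Matrix.transpose_mul, Matrix.transpose_mul,
    Matrix.transpose_nonsing_inv Qᵀ, Matrix.transpose_transpose, Matrix.mulVec_mulVec,
    Matrix.mul_assoc, Matrix.nonsing_inv_mul _ hQ, Matrix.mul_one, Matrix.transpose_nonsing_inv P,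
    ← Matrix.mulVec_mulVec, ← Matrix.vecMul_transpose, ← Matrix.dotProduct_mulVec,
    Matrix.mulVec_mulVec, Matrix.mul_nonsing_inv _ (by rwa [Matrix.det_transpose]),
    Matrix.one_mulVec]

end ChangeOfBasis

/-! ### Law of the eigenvalues for the weight `w`, and its correlation kernel in the standard bases.
-/

section Law

variable {w : ℝ → ℝ} {n : ℕ} {a : ℝ}

/-- The monomials of degree less than `2 n`. -/
def monomialFun (n : ℕ) (j : Fin (2 * n)) (x : ℝ) : ℝ := x ^ (j : ℕ)

theorem span_monomialFun (n : ℕ) : Submodule.span ℝ (Set.range (monomialFun n)) = polySpace n := by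
  rw [polySpace]
  congr 1
  ext f
  constructor
  · rintro ⟨j, rfl⟩
    exact ⟨j, j.2, rfl⟩
  · rintro ⟨j, hj, rfl⟩
    exact ⟨⟨j, hj⟩, rfl⟩

theorem span_confluentFun (n : ℕ) (a : ℝ) :
    Submodule.span ℝ (Set.range (confluentFun n a 0)) = expSpace n a := by
  rw [expSpace]
  congr 1
  ext f
  constructor
  · rintro ⟨j, rfl⟩
    have hn : 0 < n := by
      have := j.2
      omega
    by_cases hj : (j : ℕ) < n
    · refine Or.inl ⟨(j : ℕ) % n, Nat.mod_lt _ hn, ?_⟩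
      ext x
      rw [confluentFun_zero, sourceVec, if_pos hj, mul_comm]
    · refine Or.inr ⟨(j : ℕ) % n, Nat.mod_lt _ hn, ?_⟩
      ext x
      rw [confluentFun_zero, sourceVec, if_neg hj, mul_comm]
  · rintro (⟨j, hj, rfl⟩ | ⟨j, hj, rfl⟩)
    · refine ⟨⟨j, by omega⟩, ?_⟩
      ext x
      rw [confluentFun_zero, sourceVec, if_pos hj, mul_comm]
      simp [Nat.mod_eq_of_lt hj]
    · refine ⟨⟨n + j, by omega⟩, ?_⟩
      ext x
      rw [confluentFun_zero, sourceVec, if_neg (by simp), mul_comm]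
      simp [Nat.mod_eq_of_lt hj]

/-- The Gram matrix of the monomials and the functions `x^r e^{±a x}`. -/
def sourceGram (w : ℝ → ℝ) (n : ℕ) (a : ℝ) : Matrix (Fin (2 * n)) (Fin (2 * n)) ℝ :=
  momentMatrix w (monomialFun n) (confluentFun n a 0)

/-- The joint density of the eigenvalues, up to a constant. -/
def eigDensity (w : ℝ → ℝ) (n : ℕ) (a : ℝ) (x : Fin (2 * n) → ℝ) : ℝ :=
  jointDet (confluentFun n a 0) x * ∏ i, w (x i)

theorem eigDensity_eq (x : Fin (2 * n) → ℝ) : eigDensity w n a x =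
    (Matrix.of fun i k => monomialFun n k (x i)).det *
      (Matrix.of fun i k => confluentFun n a 0 k (x i) * w (x i)).det := by
  have h := Matrix.det_mul_column (fun i => w (x i))
    (Matrix.of fun i k => confluentFun n a 0 k (x i))
  have h1 : (Matrix.of fun i k => confluentFun n a 0 k (x i) * w (x i)) = Matrix.of fun i j =>
      w (x i) * (Matrix.of fun i k => confluentFun n a 0 k (x i)) i j := by
    ext i j
    simp only [Matrix.of_apply]
    ring
  rw [eigDensity, h1, h, jointDet]
  have h2 : Matrix.vandermonde x = Matrix.of fun i k => monomialFun n k (x i) := rfl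
  rw [h2]
  ring

theorem integrable_eigDensity (hw : IsEvenWeight w) :
    Integrable (eigDensity w n a) ∧
      ∫ x, eigDensity w n a x = (2 * n).factorial * (sourceGram w n a).det := by
  have h := integral_det_mul_det (A := monomialFun n)
    (B := fun k x => confluentFun n a 0 k x * w x) (fun k l => by
      simpa only [mul_assoc, monomialFun] using integrable_pow_mul_confluentFun hw n a k l)
  have h1 : eigDensity w n a = fun x => (Matrix.of fun i k => monomialFun n k (x i)).det *
      (Matrix.of fun i k => confluentFun n a 0 k (x i) * w (x i)).det := funext eigDensity_eq
  rw [h1]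
  refine ⟨h.1, h.2.trans ?_⟩
  simp only [sourceGram, momentMatrix, mul_assoc]

theorem exists_lintegral_eigs (hw : IsEvenWeight w) (n : ℕ) (ha : 0 < a) :
    ∃ κ : ℝ, (∀ᵐ x, 0 ≤ κ * eigDensity w n a x) ∧ ∀ F : (Fin (2 * n) → ℝ) → ℝ≥0∞, Measurable F →
      (∀ (σ : Equiv.Perm (Fin (2 * n))) x, F (x ∘ σ) = F x) →
      ∫⁻ c, F (eigs c) * ENNReal.ofReal (extDensity w n a c) =
        ∫⁻ x, F x * ENNReal.ofReal (κ * eigDensity w n a x) := by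
  obtain ⟨κ, hκ, hmom⟩ := exists_integral_symmetric_confluent n ha
  obtain ⟨h1, h2⟩ := eigenvalue_law_of_jointDet (sourceVec n a)
    (continuous_confluentFun n a 0) (abs_confluentFun_le n a (by simp)) hκ hmom
  refine ⟨κ⁻¹, ?_, fun F hF hFs => ?_⟩
  · filter_upwards [h1] with x hx
    rw [eigDensity, ← mul_assoc]
    exact mul_nonneg hx (Finset.prod_nonneg fun i _ => hw.nonneg _)
  · have h3 := lintegral_eigs_weight hw h2 hF hFs
    simpa only [extDensity_eq, eigDensity, ← mul_assoc] using h3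

/-- The normalization and the symmetrized law of the eigenvalues. -/
theorem exists_law_eigs (hw : IsEvenWeight w) (n : ℕ) (ha : 0 < a) :
    ∃ κ : ℝ, 0 < κ * ((2 * n).factorial * (sourceGram w n a).det) ∧
      partitionFn w n a = ENNReal.ofReal (κ * ((2 * n).factorial * (sourceGram w n a).det)) ∧
      (∀ᵐ x, 0 ≤ κ * eigDensity w n a x) ∧ ∀ F : (Fin (2 * n) → ℝ) → ℝ≥0∞, Measurable F →
      (∀ (σ : Equiv.Perm (Fin (2 * n))) x, F (x ∘ σ) = F x) →
      ∫⁻ c, F (eigs c) ∂(extLaw w n a) = (partitionFn w n a)⁻¹ *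
        ∫⁻ x, F x * ENNReal.ofReal (κ * eigDensity w n a x) := by
  obtain ⟨κ, h1, h2⟩ := exists_lintegral_eigs hw n ha
  obtain ⟨hint, hval⟩ := integrable_eigDensity (n := n) (a := a) hw
  have hZ : partitionFn w n a =
      ENNReal.ofReal (κ * ((2 * n).factorial * (sourceGram w n a).det)) := by
    have h3 := h2 (fun _ => 1) measurable_const fun _ _ => rfl
    simp only [one_mul] at h3
    rw [partitionFn, h3, ← ofReal_integral_eq_lintegral_ofReal (hint.const_mul κ) h1,
      integral_const_mul, hval]
  refine ⟨κ, ?_, hZ, h1, fun F hF hFs => ?_⟩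
  · have h4 := partitionFn_ne_zero hw n a
    rw [hZ] at h4
    exact ENNReal.ofReal_pos.1 (pos_iff_ne_zero.2 h4)
  · rw [extLaw, lintegral_smul_measure, smul_eq_mul, lintegral_withDensity_eq_lintegral_mul _
      (measurable_extDensity hw.measurable n a).ennreal_ofReal (g := fun c => F (eigs c))
      (hF.comp measurable_eigs), ← h2 F hF hFs]
    congr 1
    exact lintegral_congr fun c => mul_comm _ _

/-- By Andréief's identity this determinant is a factor of the partition function, which is nonzero.
-/
theorem det_sourceGram_ne_zero (hw : IsEvenWeight w) (n : ℕ) (ha : 0 < a) :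
    (sourceGram w n a).det ≠ 0 := by
  obtain ⟨κ, h, -⟩ := exists_law_eigs hw n ha
  intro h0
  simp [h0] at h

theorem isProbabilityMeasure_extLaw (hw : IsEvenWeight w) (n : ℕ) (ha : 0 < a) :
    IsProbabilityMeasure (extLaw w n a) := by
  obtain ⟨κ, h, hZ, -⟩ := exists_law_eigs hw n ha
  refine ⟨?_⟩
  rw [extLaw, Measure.smul_apply, withDensity_apply _ MeasurableSet.univ, Measure.restrict_univ,
    smul_eq_mul]
  exact ENNReal.inv_mul_cancel (partitionFn_ne_zero hw n a) (hZ ▸ ENNReal.ofReal_ne_top)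

/-- The unknown constant `κ` occurs both in the density and in `Z`, and cancels. -/
theorem integral_eigs_eq (hw : IsEvenWeight w) (n : ℕ) (ha : 0 < a) {S : (Fin (2 * n) → ℝ) → ℝ}
    (hS : Measurable S) {C : ℝ} (hC : ∀ x, |S x| ≤ C)
    (hSs : ∀ (σ : Equiv.Perm (Fin (2 * n))) x, S (x ∘ σ) = S x) :
    ∫ c, S (eigs c) ∂(extLaw w n a) =
      ((2 * n).factorial * (sourceGram w n a).det)⁻¹ * ∫ x, S x * eigDensity w n a x := by
  obtain ⟨κ, hpos, hZ, hnn, hlaw⟩ := exists_law_eigs hw n ha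
  have hprob := isProbabilityMeasure_extLaw hw n ha
  obtain ⟨hint, -⟩ := integrable_eigDensity (n := n) (a := a) hw
  have hκ : κ ≠ 0 := by
    rintro rfl
    simp at hpos
  have hmain : ∀ T : (Fin (2 * n) → ℝ) → ℝ, Measurable T → (∀ x, 0 ≤ T x) →
      (∃ C, ∀ x, |T x| ≤ C) → (∀ (σ : Equiv.Perm (Fin (2 * n))) x, T (x ∘ σ) = T x) →
      ∫ c, T (eigs c) ∂(extLaw w n a) =
        ((2 * n).factorial * (sourceGram w n a).det)⁻¹ * ∫ x, T x * eigDensity w n a x := by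
    rintro T hT hT0 ⟨D, hD⟩ hTs
    have hTi : Integrable fun x => T x * (κ * eigDensity w n a x) :=
      (hint.const_mul κ).bdd_mul hT.aestronglyMeasurable (Eventually.of_forall hD)
    rw [integral_eq_lintegral_of_nonneg_ae (Eventually.of_forall fun c => hT0 _)
      (hT.comp measurable_eigs).aestronglyMeasurable,
      hlaw (fun x => ENNReal.ofReal (T x)) hT.ennreal_ofReal fun σ x => by rw [hTs]]
    simp only [← ENNReal.ofReal_mul (hT0 _)]
    rw [← ofReal_integral_eq_lintegral_ofReal hTi, hZ, ENNReal.toReal_mul, ENNReal.toReal_inv,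
      ENNReal.toReal_ofReal hpos.le, ENNReal.toReal_ofReal]
    · have : ∀ x, T x * (κ * eigDensity w n a x) = κ * (T x * eigDensity w n a x) :=
        fun x => by ring
      simp only [this]
      rw [integral_const_mul, mul_inv, mul_comm κ⁻¹, mul_assoc, inv_mul_cancel_left₀ hκ]
    · refine integral_nonneg_of_ae ?_
      filter_upwards [hnn] with x hx
      exact mul_nonneg (hT0 x) hx
    · filter_upwards [hnn] with x hx
      exact mul_nonneg (hT0 x) hx
  have h0 : 0 ≤ C := (abs_nonneg _).trans (hC 0)
  -- The law is available for non-negative test functions, so `S` is written as `S + C` minus the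
  -- constant `C`.
  have h1 := hmain (fun x => S x + C) (hS.add_const C)
    (fun x => by linarith [neg_abs_le (S x), hC x])
    ⟨C + C, fun x => (abs_add_le _ _).trans (by rw [abs_of_nonneg h0]; linarith [hC x])⟩
    fun σ x => by rw [hSs]
  have h2 := hmain (fun _ => C) measurable_const (fun _ => h0) ⟨|C|, fun _ => le_rfl⟩
    fun _ _ => rfl
  have hSi : Integrable (fun c => S (eigs c)) (extLaw w n a) :=
    Integrable.of_bound (hS.comp measurable_eigs).aestronglyMeasurable C
      (Eventually.of_forall fun c => hC _)
  have hSd : Integrable fun x => S x * eigDensity w n a x :=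
    hint.bdd_mul hS.aestronglyMeasurable (Eventually.of_forall hC)
  rw [integral_add hSi (integrable_const _), h2] at h1
  simp only [add_mul] at h1
  rw [integral_add hSd (hint.const_mul C), mul_add] at h1
  exact add_right_cancel h1

/-- Applying the inverse Gram matrix to the monomials makes them biorthonormal to the weighted
exponential functions. In these functions the kernel is a plain sum of products, and its `2n`-point
determinant is the eigenvalue density divided by `det G`. -/
theorem isCorrelationKernel_extKernel (hw : IsEvenWeight w) (n : ℕ) (ha : 0 < a) :
    IsCorrelationKernel (extLaw w n a) eigs
      (extKernel w (monomialFun n) (confluentFun n a 0)) := by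
  have hprob := isProbabilityMeasure_extLaw hw n ha
  let G := sourceGram w n a
  have hG : IsUnit G.det := isUnit_iff_ne_zero.2 (det_sourceGram_ne_zero hw n ha)
  let A : Fin (2 * n) → ℝ → ℝ := fun k x => confluentFun n a 0 k x * w x
  let B : Fin (2 * n) → ℝ → ℝ := transform G⁻¹ (monomialFun n)
  have hAB : ∀ k l, ∀ x, A k x * B l x =
      ∑ j, G⁻¹ l j * (monomialFun n j x * confluentFun n a 0 k x * w x) := by
    intro k l x
    simp only [A, B, transform, Finset.mul_sum]
    exact Finset.sum_congr rfl fun j _ => by ring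
  have hi : ∀ j k, Integrable fun x => monomialFun n j x * confluentFun n a 0 k x * w x :=
    fun j k => integrable_pow_mul_confluentFun hw n a j k
  have hint : ∀ k l, Integrable fun x => A k x * B l x := by
    intro k l
    simp only [hAB]
    exact integrable_finsetSum _ fun j _ => (hi j k).const_mul _
  have hbi : ∀ k l, ∫ x, A k x * B l x = if k = l then 1 else 0 := by
    intro k l
    simp only [hAB]
    rw [integral_finsetSum _ fun j _ => (hi j k).const_mul _]
    simp only [integral_const_mul]
    have h1 : ∑ j, G⁻¹ l j * ∫ x, monomialFun n j x * confluentFun n a 0 k x * w x =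
        (G⁻¹ * G) l k := rfl
    rw [h1, Matrix.nonsing_inv_mul _ hG, Matrix.one_apply]
    simp only [eq_comm]
  have hK : extKernel w (monomialFun n) (confluentFun n a 0) = pairKernel A B := by
    ext x y
    simp only [extKernel, pairKernel, dotProduct, Matrix.mulVec, A, B, transform, Finset.mul_sum,
      Finset.sum_mul, Matrix.transpose_apply]
    rw [Finset.sum_comm]
    refine Finset.sum_congr rfl fun k _ => Finset.sum_congr rfl fun j _ => ?_
    simp only [G, sourceGram]
    ring
  have hdet : ∀ x, corrDet A B x = G.det⁻¹ * eigDensity w n a x := by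
    intro x
    have h1 : (Matrix.of fun i k => B k (x i)) =
        (Matrix.of fun i k => monomialFun n k (x i)) * (G⁻¹)ᵀ := by
      ext i k
      simp only [Matrix.of_apply, B, transform, Matrix.mul_apply, Matrix.transpose_apply]
      exact Finset.sum_congr rfl fun j _ => mul_comm _ _
    rw [corrDet_card, h1, Matrix.det_mul, Matrix.det_transpose, Matrix.det_nonsing_inv,
      Ring.inverse_eq_inv', eigDensity_eq]
    simp only [A]
    ring
  rw [hK]
  refine isCorrelationKernel_pairKernel hint hbi _ measurable_eigs fun S hS hC hSs => ?_
  obtain ⟨C, hC⟩ := hC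
  rw [integral_eigs_eq hw n ha hS hC hSs]
  have h2 : ∀ x, S x * corrDet A B x = G.det⁻¹ * (S x * eigDensity w n a x) := by
    intro x
    rw [hdet]
    ring
  simp only [h2]
  rw [integral_const_mul, mul_inv, mul_assoc]

end Law

/-! ### Biorthogonal systems of monic polynomials -/

section MonicBiorthogonal

open Polynomial

variable {B : ℝ[X] →ₗ[ℝ] ℝ[X] →ₗ[ℝ] ℝ}

/-- The leading `k × k` matrix of moments of a bilinear form on polynomials. -/
def leadingMoments (B : ℝ[X] →ₗ[ℝ] ℝ[X] →ₗ[ℝ] ℝ) (k : ℕ) : Matrix (Fin k) (Fin k) ℝ :=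
  Matrix.of fun j l => B (X ^ (j : ℕ)) (X ^ (l : ℕ))

theorem eq_sum_coeff_smul {p : ℝ[X]} {k : ℕ} (hp : p.degree < k) :
    p = ∑ i : Fin k, p.coeff i • X ^ (i : ℕ) := by
  ext m
  simp only [finsetSum_coeff, coeff_smul, coeff_X_pow, smul_eq_mul, mul_ite, mul_one, mul_zero]
  rcases lt_or_ge m k with hm | hm
  · rw [Finset.sum_eq_single ⟨m, hm⟩]
    · simp
    · intro i _ hi
      exact if_neg fun h => hi (Fin.ext h.symm)
    · simp
  · rw [coeff_eq_zero_of_degree_lt (hp.trans_le (by exact_mod_cast hm)), Finset.sum_eq_zero]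
    intro i _
    exact if_neg (by omega)

theorem eq_zero_of_forall_form_eq_zero {k : ℕ} (hdet : (leadingMoments B k).det ≠ 0) {r : ℝ[X]}
    (hr : r.degree < k) (h : ∀ p : ℝ[X], p.degree < k → B p r = 0) : r = 0 := by
  have h1 : leadingMoments B k *ᵥ (fun i : Fin k => r.coeff i) = 0 := by
    ext j
    have h2 := h (X ^ (j : ℕ)) (by rw [degree_X_pow]; exact_mod_cast j.2)
    rw [eq_sum_coeff_smul hr, map_sum] at h2
    simpa [Matrix.mulVec, dotProduct, leadingMoments, mul_comm] using h2
  have h3 := Matrix.eq_zero_of_mulVec_eq_zero hdet h1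
  rw [eq_sum_coeff_smul hr]
  exact Finset.sum_eq_zero fun i _ => by rw [congrFun h3 i, Pi.zero_apply, zero_smul]

/-- Orthogonality of `X^k - r` to the lower powers is a linear system for the coefficients of `r`,
with the moment matrix as its matrix. -/
theorem exists_monic_orthogonal {k : ℕ} (hdet : (leadingMoments B k).det ≠ 0) :
    ∃ q : ℝ[X], q.Monic ∧ q.natDegree = k ∧ ∀ p : ℝ[X], p.degree < k → B p q = 0 := by
  let c : Fin k → ℝ := (leadingMoments B k)⁻¹ *ᵥ fun j => B (X ^ (j : ℕ)) (X ^ k)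
  let r : ℝ[X] := ∑ i, c i • X ^ (i : ℕ)
  have hr : r.degree < k := by
    refine (degree_sum_le _ _).trans_lt ((Finset.sup_lt_iff (WithBot.bot_lt_coe k)).2 fun i _ => ?_)
    refine (degree_smul_le _ _).trans_lt ?_
    rw [degree_X_pow]
    exact Nat.cast_lt.2 i.2
  refine ⟨X ^ k - r, monic_X_pow_sub hr, natDegree_eq_of_degree_eq_some ?_, fun p hp => ?_⟩
  · rw [degree_sub_eq_left_of_degree_lt (by rwa [degree_X_pow]), degree_X_pow]
  · have h1 : ∀ j : Fin k, B (X ^ (j : ℕ)) (X ^ k - r) = 0 := by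
      intro j
      have h2 : leadingMoments B k *ᵥ c = fun j : Fin k => B (X ^ (j : ℕ)) (X ^ k) := by
        rw [Matrix.mulVec_mulVec, Matrix.mul_nonsing_inv _ (isUnit_iff_ne_zero.2 hdet),
          Matrix.one_mulVec]
      have h3 := congrFun h2 j
      rw [map_sub, ← h3, map_sum]
      simp [Matrix.mulVec, dotProduct, leadingMoments, mul_comm]
    rw [eq_sum_coeff_smul hp]
    simp [LinearMap.sum_apply, h1]

theorem form_eq_zero_of_degree_lt {p : ℕ → ℝ[X]} (hp : ∀ j, (p j).Monic)
    (hpd : ∀ j, (p j).natDegree = j) {k : ℕ} {q : ℝ[X]} (h : ∀ j < k, B (p j) q = 0) (r : ℝ[X])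
    (hr : r.degree < k) : B r q = 0 := by
  induction k generalizing r with
  | zero =>
    have : r = 0 := by
      rw [← degree_eq_bot]
      exact Nat.WithBot.lt_zero_iff.1 (by simpa using hr)
    simp [this]
  | succ k ih =>
    have h1 : (r - r.coeff k • p k).degree < k := by
      rw [degree_lt_iff_coeff_zero]
      intro m hm
      rcases hm.eq_or_lt with rfl | hm
      · have h2 : (p k).coeff k = 1 := by
          have := (hp k).coeff_natDegree
          rwa [hpd] at this
        simp [h2]
      · have h2 : r.coeff m = 0 :=
          coeff_eq_zero_of_degree_lt (hr.trans_le (by exact_mod_cast hm))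
        have h3 : (p k).coeff m = 0 := coeff_eq_zero_of_natDegree_lt (by rwa [hpd])
        simp [h2, h3]
    have h2 := ih (fun j hj => h j (hj.trans (Nat.lt_succ_self k))) _ h1
    rw [map_sub, map_smul, LinearMap.sub_apply, LinearMap.smul_apply, h k (Nat.lt_succ_self k),
      smul_zero, sub_zero] at h2
    exact h2

theorem leadingMoments_flip (k : ℕ) : leadingMoments B.flip k = (leadingMoments B k)ᵀ := rfl

/-- Monic polynomials of every degree, biorthogonal for the form `B`. -/
structure IsMonicBiorthogonal (B : ℝ[X] →ₗ[ℝ] ℝ[X] →ₗ[ℝ] ℝ) (p q : ℕ → ℝ[X]) : Prop where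
  monic_left : ∀ j, (p j).Monic
  natDegree_left : ∀ j, (p j).natDegree = j
  monic_right : ∀ k, (q k).Monic
  natDegree_right : ∀ k, (q k).natDegree = k
  orthogonal : ∀ j k, j ≠ k → B (p j) (q k) = 0
  norm_ne_zero : ∀ j, B (p j) (q j) ≠ 0

theorem IsMonicBiorthogonal.flip {p q : ℕ → ℝ[X]} (h : IsMonicBiorthogonal B p q) :
    IsMonicBiorthogonal B.flip q p where
  monic_left := h.monic_right
  natDegree_left := h.natDegree_right
  monic_right := h.monic_left
  natDegree_right := h.natDegree_left
  orthogonal j k hjk := h.orthogonal k j hjk.symm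
  norm_ne_zero := h.norm_ne_zero

theorem degree_lt_of_natDegree_eq {p : ℝ[X]} {j k : ℕ} (h : p.natDegree = j) (hjk : j < k) :
    p.degree < k :=
  degree_le_natDegree.trans_lt (by rw [h]; exact_mod_cast hjk)

theorem degree_sub_lt_of_monic {p q : ℝ[X]} {k : ℕ} (hp : p.Monic) (hpd : p.natDegree = k)
    (hq : q.Monic) (hqd : q.natDegree = k) : (p - q).degree < k := by
  have hp' := hp.coeff_natDegree
  have hq' := hq.coeff_natDegree
  rw [hpd] at hp'
  rw [hqd] at hq'
  rw [degree_lt_iff_coeff_zero]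
  intro m hm
  rcases hm.eq_or_lt with rfl | hm
  · simp [hp', hq']
  · rw [coeff_sub, coeff_eq_zero_of_natDegree_lt (by rwa [hpd]),
      coeff_eq_zero_of_natDegree_lt (by rwa [hqd]), sub_zero]

/-- The difference of two candidates loses its leading term and is orthogonal to all polynomials of
degree below `k`, so nondegeneracy at size `k` kills it. -/
theorem IsMonicBiorthogonal.right_unique (hdet : ∀ k, (leadingMoments B k).det ≠ 0)
    {p q p' q' : ℕ → ℝ[X]} (h : IsMonicBiorthogonal B p q) (h' : IsMonicBiorthogonal B p' q') :
    q = q' := by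
  ext1 k
  refine sub_eq_zero.1 (eq_zero_of_forall_form_eq_zero (hdet k) (degree_sub_lt_of_monic
    (h.monic_right k) (h.natDegree_right k) (h'.monic_right k) (h'.natDegree_right k))
    fun r hr => ?_)
  rw [map_sub, form_eq_zero_of_degree_lt h.monic_left h.natDegree_left
    (fun j hj => h.orthogonal j k hj.ne) r hr,
    form_eq_zero_of_degree_lt h'.monic_left h'.natDegree_left
    (fun j hj => h'.orthogonal j k hj.ne) r hr, sub_zero]

theorem exists_isMonicBiorthogonal (hdet : ∀ k, (leadingMoments B k).det ≠ 0) :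
    ∃ p q, IsMonicBiorthogonal B p q := by
  choose q hq1 hq2 hq3 using fun k => exists_monic_orthogonal (hdet k)
  choose p hp1 hp2 hp3 using fun k => exists_monic_orthogonal (B := B.flip) (k := k)
    (by rw [leadingMoments_flip, Matrix.det_transpose]; exact hdet k)
  refine ⟨p, q, hp1, hp2, hq1, hq2, fun j k hjk => ?_, fun k h0 => ?_⟩
  · rcases hjk.lt_or_gt with h | h
    · exact hq3 k _ (degree_lt_of_natDegree_eq (hp2 j) h)
    · exact hp3 j _ (degree_lt_of_natDegree_eq (hq2 k) h)
  -- If the norm were zero, `q k` would be orthogonal to all polynomials of degree at most `k`,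
  -- contradicting nondegeneracy at size `k + 1`.
  · refine (hq1 k).ne_zero (eq_zero_of_forall_form_eq_zero (hdet (k + 1))
      (degree_lt_of_natDegree_eq (hq2 k) (Nat.lt_succ_self k)) fun r hr => ?_)
    refine form_eq_zero_of_degree_lt hp1 hp2 (fun j hj => ?_) r hr
    rcases (Nat.lt_succ_iff.1 hj).eq_or_lt with rfl | hj
    · exact h0
    · exact hq3 k _ (degree_lt_of_natDegree_eq (hp2 j) hj)

end MonicBiorthogonal

/-! ### The pairings as bilinear forms on polynomials. -/

section PolyPairing

variable {W : ℝ → ℝ} {γ : ℝ}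

theorem integrable_polynomial_mul {V : ℝ → ℝ} (hV : ∀ k : ℕ, Integrable fun x => x ^ k * V x)
    (r : ℝ[X]) : Integrable fun x => r.eval x * V x := by
  simp only [Polynomial.eval_eq_sum_range, Finset.sum_mul, mul_assoc]
  exact integrable_finsetSum _ fun k _ => (hV k).const_mul _

/-- Integration of polynomials against a function with finite moments. -/
def momentFunctional (V : ℝ → ℝ) (hV : ∀ k : ℕ, Integrable fun x => x ^ k * V x) :
    ℝ[X] →ₗ[ℝ] ℝ where
  toFun r := ∫ x, r.eval x * V x
  map_add' r s := by
    simp only [Polynomial.eval_add, add_mul]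
    exact integral_add (integrable_polynomial_mul hV r) (integrable_polynomial_mul hV s)
  map_smul' c r := by
    simp only [Polynomial.eval_smul, smul_eq_mul, mul_assoc, RingHom.id_apply]
    exact integral_const_mul c _

/-- The bilinear form `(p, q) ↦ ⟨p(x), q(x²)⟩`. -/
def pairingForm (V : ℝ → ℝ) (hV : ∀ k : ℕ, Integrable fun x => x ^ k * V x) :
    ℝ[X] →ₗ[ℝ] ℝ[X] →ₗ[ℝ] ℝ :=
  ((LinearMap.mul ℝ ℝ[X]).compl₂ (Polynomial.expand ℝ 2).toLinearMap).compr₂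
    (momentFunctional V hV)

theorem pairingForm_apply {V : ℝ → ℝ} (hV : ∀ k : ℕ, Integrable fun x => x ^ k * V x)
    (p q : ℝ[X]) : pairingForm V hV p q = ∫ x, p.eval x * q.eval (x ^ 2) * V x := by
  simp [pairingForm, momentFunctional, Polynomial.expand_eval]

theorem polyPairing_eq (hV : ∀ k : ℕ, Integrable fun x => x ^ k * (halfLine γ x * W x))
    (p q : ℝ[X]) : polyPairing W γ p q = pairingForm _ hV p q := by
  rw [pairingForm_apply, polyPairing, pairing]
  simp only [mul_assoc]

theorem isBiorthogonalSystem_iff (hV : ∀ k : ℕ, Integrable fun x => x ^ k * (halfLine γ x * W x))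
    (p q : ℕ → ℝ[X]) :
    IsBiorthogonalSystem W γ p q ↔ IsMonicBiorthogonal (pairingForm _ hV) p q := by
  constructor
  · rintro ⟨h1, h2, h3, h4, -, h5, h6⟩
    exact ⟨h1, h2, h3, h4, fun j k hjk => by rw [← polyPairing_eq]; exact h5 j k hjk,
      fun j => by rw [← polyPairing_eq]; exact h6 j⟩
  · rintro ⟨h1, h2, h3, h4, h5, h6⟩
    refine ⟨h1, h2, h3, h4, fun j k => ?_, fun j k hjk => ?_,
      fun j => by rw [polyPairing_eq hV]; exact h6 j⟩
    · have := integrable_polynomial_mul hV (p j * Polynomial.expand ℝ 2 (q k))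
      simpa only [Polynomial.eval_mul, Polynomial.expand_eval, mul_assoc] using this
    · rw [polyPairing_eq hV]
      exact h5 j k hjk

theorem biorthogonalWellDefined_of_det_ne_zero
    (hV : ∀ k : ℕ, Integrable fun x => x ^ k * (halfLine γ x * W x))
    (hdet : ∀ k, (leadingMoments (pairingForm _ hV) k).det ≠ 0) :
    BiorthogonalWellDefined W γ := by
  obtain ⟨p, q, h⟩ := exists_isMonicBiorthogonal hdet
  refine ⟨(p, q), (isBiorthogonalSystem_iff hV p q).2 h, ?_⟩
  rintro ⟨p', q'⟩ h'
  have h'' := (isBiorthogonalSystem_iff hV p' q').1 h'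
  refine Prod.ext (IsMonicBiorthogonal.right_unique (B := (pairingForm _ hV).flip) (fun k => ?_)
    h''.flip h.flip) (h''.right_unique hdet h)
  rw [leadingMoments_flip, Matrix.det_transpose]
  exact hdet k

theorem BiorthogonalWellDefined.isBiorthogonalSystem (h : BiorthogonalWellDefined W γ) :
    IsBiorthogonalSystem W γ (biorthP W γ) (biorthQ W γ) :=
  Classical.epsilon_spec (p := fun pq : (ℕ → ℝ[X]) × (ℕ → ℝ[X]) =>
    IsBiorthogonalSystem W γ pq.1 pq.2) h.exists

end PolyPairing

/-! ### Splitting into even and odd functions -/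

section ParitySplit

variable {w : ℝ → ℝ} {n : ℕ} {a : ℝ}

theorem halfLine_mul_tilt (w : ℝ → ℝ) (a x : ℝ) :
    halfLine 1 x * tilt w a x = Real.exp (a * x) * w x := by
  simp [halfLine, tilt, mul_comm]

/-- The sign change on the negative half line turns `|x|` into `x`. The second system is thus the
pairing of `p(x)` with the odd functions `x q(x²)` under the same weight. -/
theorem halfLine_mul_oddWeight (w : ℝ → ℝ) (a x : ℝ) :
    halfLine (-1) x * oddWeight (tilt w a) x = x * (Real.exp (a * x) * w x) := by
  unfold halfLine oddWeight tilt
  split_ifs with h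
  · rw [abs_of_nonneg h]
    ring
  · rw [abs_of_neg (not_le.1 h)]
    ring

theorem integrable_pow_mul_exp (hw : IsEvenWeight w) (a : ℝ) (k : ℕ) :
    Integrable fun x => x ^ k * (Real.exp (a * x) * w x) := by
  simp only [← mul_assoc]
  refine integrable_mul_weight hw (C := 1) (c := k + |a|) (by fun_prop) fun x => ?_
  rw [abs_mul, one_mul, add_mul, Real.exp_add, Real.abs_exp]
  refine mul_le_mul (abs_pow_le_exp k x) (Real.exp_le_exp.2 ?_) (Real.exp_pos _).le
    (Real.exp_pos _).le
  rw [← abs_mul]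
  exact le_abs_self _

theorem integrable_pow_mul_tilt (hw : IsEvenWeight w) (a : ℝ) (k : ℕ) :
    Integrable fun x => x ^ k * (halfLine 1 x * tilt w a x) := by
  simp only [halfLine_mul_tilt]
  exact integrable_pow_mul_exp hw a k

theorem integrable_pow_mul_oddWeight (hw : IsEvenWeight w) (a : ℝ) (k : ℕ) :
    Integrable fun x => x ^ k * (halfLine (-1) x * oddWeight (tilt w a) x) := by
  simp only [halfLine_mul_oddWeight, ← mul_assoc, ← pow_succ]
  simpa only [mul_assoc] using integrable_pow_mul_exp hw a (k + 1)

/-- The monomials `x^(2 k + s)`, `k < n`, of fixed parity pair nondegenerately with the functions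
`x^j e^{a x}`, `j < n`. -/
theorem det_parity_moments_ne_zero (hw : IsEvenWeight w) (n : ℕ) (ha : 0 < a) {s : ℕ}
    (hs : s < 2) : (Matrix.of fun j k : Fin n =>
      ∫ x, x ^ ((j : ℕ) + (2 * (k : ℕ) + s)) * (Real.exp (a * x) * w x)).det ≠ 0 := by
  intro h0
  obtain ⟨v, hv, hMv⟩ := Matrix.exists_mulVec_eq_zero_iff.2 h0
  let i : Fin n → Fin (2 * n) := fun k => ⟨2 * k + s, by omega⟩
  have hi : Function.Injective i := fun k l hkl => Fin.ext (by
    have := congrArg Fin.val hkl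
    simp only [i] at this
    omega)
  let c : Fin (2 * n) → ℝ := ∑ k, v k • Pi.single (i k) 1
  have hc : c ≠ 0 := by
    obtain ⟨k, hk⟩ := Function.ne_iff.1 hv
    refine Function.ne_iff.2 ⟨i k, ?_⟩
    have : c (i k) = v k := by
      simp [c, Finset.sum_apply, Pi.single_apply, hi.eq_iff]
    rwa [this]
  -- Reflection turns the pairing of `x^(2k+s)` with `x^r e^{-ax}` into the pairing with `x^r
  -- e^{ax}`, up to a sign that does not depend on `k`. A null vector of the half-size matrix
  -- therefore annihilates all `2n` columns of the full Gram matrix.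
  have hterm : ∀ l : Fin (2 * n), ∃ t : ℝ, ∀ k : Fin n, sourceGram w n a (i k) l = t *
      ∫ x, x ^ ((l : ℕ) % n + (2 * (k : ℕ) + s)) * (Real.exp (a * x) * w x) := by
    intro l
    by_cases hl : (l : ℕ) < n
    · refine ⟨1, fun k => ?_⟩
      rw [one_mul, sourceGram, momentMatrix, Matrix.of_apply]
      refine integral_congr_ae (Eventually.of_forall fun x => ?_)
      simp only [monomialFun, confluentFun_zero, sourceVec, if_pos hl, i]
      ring
    · refine ⟨(-1) ^ ((l : ℕ) % n + s), fun k => ?_⟩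
      rw [sourceGram, momentMatrix, Matrix.of_apply, ← integral_neg_eq_self, ← integral_const_mul]
      refine integral_congr_ae (Eventually.of_forall fun x => ?_)
      simp only [monomialFun, confluentFun_zero, sourceVec, if_neg hl, i, hw.even x]
      rw [neg_pow x, neg_pow x ((l : ℕ) % n), neg_mul_neg, pow_add (-1 : ℝ) (2 * (k : ℕ)), pow_mul]
      simp only [even_two, Even.neg_pow, one_pow]
      ring
  have hcG : c ᵥ* sourceGram w n a = 0 := by
    ext l
    have hn : 0 < n := by
      have := l.2
      omega
    have h1 := congrFun hMv ⟨(l : ℕ) % n, Nat.mod_lt _ hn⟩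
    simp only [Matrix.mulVec, dotProduct, Matrix.of_apply, Pi.zero_apply] at h1
    have h2 : (c ᵥ* sourceGram w n a) l = ∑ k, v k * sourceGram w n a (i k) l := by
      simp [c, Matrix.sum_vecMul, Matrix.smul_vecMul]
    obtain ⟨t, ht⟩ := hterm l
    rw [h2, Pi.zero_apply, ← mul_zero t, ← h1, Finset.mul_sum]
    refine Finset.sum_congr rfl fun k _ => ?_
    rw [ht k]
    ring
  exact hc (Matrix.eq_zero_of_vecMul_eq_zero (det_sourceGram_ne_zero hw n ha) hcG)

theorem biorthogonalWellDefined_tilt (hw : IsEvenWeight w) (ha : 0 < a) :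
    BiorthogonalWellDefined (tilt w a) 1 := by
  refine biorthogonalWellDefined_of_det_ne_zero (integrable_pow_mul_tilt hw a) fun n => ?_
  convert det_parity_moments_ne_zero hw n ha (s := 0) (by norm_num) using 2
  ext j k
  rw [leadingMoments, Matrix.of_apply, Matrix.of_apply, pairingForm_apply]
  refine integral_congr_ae (Eventually.of_forall fun x => ?_)
  simp only [halfLine_mul_tilt, Polynomial.eval_pow, Polynomial.eval_X]
  ring

theorem biorthogonalWellDefined_oddWeight (hw : IsEvenWeight w) (ha : 0 < a) :
    BiorthogonalWellDefined (oddWeight (tilt w a)) (-1) := by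
  refine biorthogonalWellDefined_of_det_ne_zero (integrable_pow_mul_oddWeight hw a) fun n => ?_
  convert det_parity_moments_ne_zero hw n ha (s := 1) (by norm_num) using 2
  ext j k
  rw [leadingMoments, Matrix.of_apply, Matrix.of_apply, pairingForm_apply]
  refine integral_congr_ae (Eventually.of_forall fun x => ?_)
  simp only [halfLine_mul_oddWeight, Polynomial.eval_pow, Polynomial.eval_X]
  ring

/-- The substitution `x ↦ -x` turns the reflected term into `s t` times the original integral. For
`s, t = ±1` the factor `1 + s t` is 2 for equal parities and 0 for opposite ones. -/
theorem integral_mul_add_reflection (hw : IsEvenWeight w) {f g : ℝ → ℝ} {s : ℝ}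
    (hf : ∀ x, f (-x) = s * f x) (h : Integrable fun x => f x * g x * w x) (t : ℝ) :
    ∫ x, f x * (g x + t * g (-x)) * w x = (1 + s * t) * ∫ x, f x * g x * w x := by
  have h1 : ∀ x, f x * (g x + t * g (-x)) * w x =
      f x * g x * w x + t * (f x * g (-x) * w x) := fun x => by ring
  -- Reflecting twice gives `s² f = f`, which makes a hypothesis `s = ±1` unnecessary.
  have h2 : ∀ x, f x * g (-x) * w x = s * s * f x * g (-x) * w x := by
    intro x
    have := hf (-x)
    rw [neg_neg, hf x] at this
    linear_combination (g (-x) * w x) * this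
  have h3 : ∀ x, f x * g (-x) * w x = s * (f (-x) * g (-x) * w (-x)) := by
    intro x
    rw [h2, hf, hw.even x]
    ring
  simp only [h1]
  rw [integral_add h, integral_const_mul]
  · simp only [h3]
    rw [integral_const_mul, integral_neg_eq_self fun x => f x * g x * w x]
    ring
  · simp only [h3]
    exact (h.comp_neg.const_mul s).const_mul t

theorem exists_transform_of_mem {N : ℕ} {φ φ' : Fin N → ℝ → ℝ}
    (h : ∀ j, φ j ∈ Submodule.span ℝ (Set.range φ')) :
    ∃ P : Matrix (Fin N) (Fin N) ℝ, φ = transform P φ' := by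
  choose P hP using fun j => Submodule.mem_span_range_iff_exists_fun ℝ |>.1 (h j)
  refine ⟨Matrix.of P, ?_⟩
  ext j x
  rw [← hP j]
  simp [transform]

theorem extKernel_of_momentMatrix_eq_diagonal {N : ℕ} {φ ψ : Fin N → ℝ → ℝ} {d : Fin N → ℝ}
    (hd : ∀ j, d j ≠ 0) (h : momentMatrix w φ ψ = Matrix.diagonal d) (x y : ℝ) :
    extKernel w φ ψ x y = ∑ j, φ j y * ψ j x * w x / d j := by
  have h1 : (Matrix.diagonal d)⁻¹ = Matrix.diagonal fun j => (d j)⁻¹ := by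
    refine Matrix.inv_eq_right_inv ?_
    rw [Matrix.diagonal_mul_diagonal, ← Matrix.diagonal_one]
    congr 1
    ext j
    exact mul_inv_cancel₀ (hd j)
  rw [extKernel, h, h1, Matrix.diagonal_transpose, dotProduct, Finset.sum_mul]
  refine Finset.sum_congr rfl fun j _ => ?_
  rw [Matrix.mulVec_diagonal]
  ring

theorem eval_mem_polySpace {p : ℝ[X]} (hp : p.degree < (2 * n : ℕ)) :
    (fun x => p.eval x) ∈ polySpace n := by
  have h : (fun x => p.eval x) = ∑ i : Fin (2 * n), p.coeff i • fun x : ℝ => x ^ (i : ℕ) := by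
    ext x
    conv_lhs => rw [eq_sum_coeff_smul hp]
    simp [Polynomial.eval_finsetSum]
  rw [h]
  exact Submodule.sum_mem _ fun i _ =>
    Submodule.smul_mem _ _ (Submodule.subset_span ⟨i, i.2, rfl⟩)

theorem eval_mul_exp_mem_expSpace {p : ℝ[X]} (hp : p.degree < n) :
    (fun x => p.eval x * Real.exp (a * x)) ∈ expSpace n a ∧
      (fun x => p.eval x * Real.exp (-a * x)) ∈ expSpace n a := by
  have h : ∀ b : ℝ, (fun x => p.eval x * Real.exp (b * x)) =
      ∑ i : Fin n, p.coeff i • fun x : ℝ => x ^ (i : ℕ) * Real.exp (b * x) := by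
    intro b
    ext x
    conv_lhs => rw [eq_sum_coeff_smul hp]
    simp [Polynomial.eval_finsetSum, Finset.sum_mul, mul_assoc]
  rw [h, h]
  exact ⟨Submodule.sum_mem _ fun i _ => Submodule.smul_mem _ _
    (Submodule.subset_span (Or.inl ⟨i, i.2, rfl⟩)), Submodule.sum_mem _ fun i _ =>
    Submodule.smul_mem _ _ (Submodule.subset_span (Or.inr ⟨i, i.2, rfl⟩))⟩

theorem eval_mul_exp_add_reflection_mem {p : ℝ[X]} (hp : p.natDegree < n) (t : ℝ) :
    (fun x => p.eval x * Real.exp (a * x) + t * (p.eval (-x) * Real.exp (a * -x))) ∈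
      expSpace n a := by
  have h1 : (p.comp (-Polynomial.X)).degree < n := by
    refine degree_lt_of_natDegree_eq Polynomial.natDegree_comp ?_
    rwa [Polynomial.natDegree_neg, Polynomial.natDegree_X, mul_one]
  have h2 := (eval_mul_exp_mem_expSpace (a := a) h1).2
  have h3 : (fun x => (p.comp (-Polynomial.X)).eval x * Real.exp (-a * x)) =
      fun x => p.eval (-x) * Real.exp (a * -x) := by
    ext x
    rw [Polynomial.eval_comp, Polynomial.eval_neg, Polynomial.eval_X, neg_mul, mul_neg]
  rw [h3] at h2
  exact Submodule.add_mem _ (eval_mul_exp_mem_expSpace (degree_lt_of_natDegree_eq rfl hp)).1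
    (Submodule.smul_mem _ t h2)

/-- The external source kernel in terms of the kernels for the even and the odd part. -/
theorem extKernel_eq_symKernel (hw : IsEvenWeight w) (ha : 0 < a) (n : ℕ) (x y : ℝ) :
    extKernel w (monomialFun n) (confluentFun n a 0) x y =
      1 / 2 * symKernel (tilt w a) 1 n x y +
        y / (2 * x) * symKernel (oddWeight (tilt w a)) (-1) n x y := by
  have hE := (biorthogonalWellDefined_tilt hw ha).isBiorthogonalSystem
  have hO := (biorthogonalWellDefined_oddWeight hw ha).isBiorthogonalSystem
  simp only [symKernel, mbKernel]
  set pE := biorthP (tilt w a) 1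
  set qE := biorthQ (tilt w a) 1
  set pO := biorthP (oddWeight (tilt w a)) (-1)
  set qO := biorthQ (oddWeight (tilt w a)) (-1)
  set hhE := biorthH (tilt w a) 1
  set hhO := biorthH (oddWeight (tilt w a)) (-1)
  let e : Fin n ⊕ Fin n ≃ Fin (2 * n) := finSumFinEquiv.trans (finCongr (two_mul n).symm)
  -- Bases adapted to parity: the left summand is even and the right one odd, both here and in `ψ`.
  -- Cross integrals vanish, and equal parities double the pairing, whence the factor 2 in `d`.
  let φ : Fin n ⊕ Fin n → ℝ → ℝ := Sum.elim (fun i y => (qE i).eval (y ^ 2))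
    fun i y => y * (qO i).eval (y ^ 2)
  let ψ : Fin n ⊕ Fin n → ℝ → ℝ := Sum.elim
    (fun i x => (pE i).eval x * Real.exp (a * x) + 1 * ((pE i).eval (-x) * Real.exp (a * -x)))
    fun i x => (pO i).eval x * Real.exp (a * x) + -1 * ((pO i).eval (-x) * Real.exp (a * -x))
  let d : Fin n ⊕ Fin n → ℝ := Sum.elim (fun i => 2 * hhE i) fun i => 2 * hhO i
  have hd : ∀ i, d i ≠ 0 := by
    rintro (i | i)
    · exact mul_ne_zero two_ne_zero (hE.norm_ne_zero i)
    · exact mul_ne_zero two_ne_zero (hO.norm_ne_zero i)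
  have hψ : ∀ i, ψ i ∈ expSpace n a := by
    rintro (i | i)
    · exact eval_mul_exp_add_reflection_mem
        ((hE.natDegree_left i).trans_lt i.2) 1
    · exact eval_mul_exp_add_reflection_mem
        ((hO.natDegree_left i).trans_lt i.2) (-1)
  have hφ : ∀ i, φ i ∈ polySpace n := by
    rintro (i | i)
    · have h1 : (Polynomial.expand ℝ 2 (qE i)).degree < (2 * n : ℕ) :=
        degree_lt_of_natDegree_eq (Polynomial.natDegree_expand _ _)
          (by rw [hE.natDegree_right]; omega)
      have h2 := eval_mem_polySpace h1
      simp only [Polynomial.expand_eval] at h2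
      exact h2
    · have h1 : (Polynomial.X * Polynomial.expand ℝ 2 (qO i)).degree <
          ((2 * n : ℕ) : WithBot ℕ) := by
        refine degree_lt_of_natDegree_eq rfl (Polynomial.natDegree_mul_le.trans_lt ?_)
        rw [Polynomial.natDegree_X, Polynomial.natDegree_expand, hO.natDegree_right]
        omega
      have h2 := eval_mem_polySpace h1
      simp only [Polynomial.eval_mul, Polynomial.eval_X, Polynomial.expand_eval] at h2
      exact h2
  have hev : ∀ (q : ℝ[X]) (x : ℝ), q.eval ((-x) ^ 2) = 1 * q.eval (x ^ 2) := fun q x => by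
    rw [neg_sq, one_mul]
  have hod : ∀ (q : ℝ[X]) (x : ℝ), -x * q.eval ((-x) ^ 2) = -1 * (x * q.eval (x ^ 2)) :=
    fun q x => by
      rw [neg_sq]
      ring
  have hint : ∀ p q : ℝ[X], Integrable fun x =>
      q.eval (x ^ 2) * (p.eval x * Real.exp (a * x)) * w x := by
    intro p q
    have := integrable_polynomial_mul (integrable_pow_mul_exp hw a) (p * Polynomial.expand ℝ 2 q)
    refine this.congr (Eventually.of_forall fun x => ?_)
    simp only [Polynomial.eval_mul, Polynomial.expand_eval]
    ring
  have hint' : ∀ p q : ℝ[X], Integrable fun x =>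
      x * q.eval (x ^ 2) * (p.eval x * Real.exp (a * x)) * w x := by
    intro p q
    have := integrable_polynomial_mul (integrable_pow_mul_exp hw a)
      (Polynomial.X * p * Polynomial.expand ℝ 2 q)
    refine this.congr (Eventually.of_forall fun x => ?_)
    simp only [Polynomial.eval_mul, Polynomial.expand_eval, Polynomial.eval_X]
    ring
  have hvE : ∀ p q : ℝ[X], ∫ x, q.eval (x ^ 2) * (p.eval x * Real.exp (a * x)) * w x =
      polyPairing (tilt w a) 1 p q := by
    intro p q
    refine integral_congr_ae (Eventually.of_forall fun x => ?_)
    simp only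
    rw [mul_assoc (_ * _) (halfLine _ _), halfLine_mul_tilt]
    ring
  have hvO : ∀ p q : ℝ[X], ∫ x, x * q.eval (x ^ 2) * (p.eval x * Real.exp (a * x)) * w x =
      polyPairing (oddWeight (tilt w a)) (-1) p q := by
    intro p q
    refine integral_congr_ae (Eventually.of_forall fun x => ?_)
    simp only
    rw [mul_assoc (_ * _) (halfLine _ _), halfLine_mul_oddWeight]
    ring
  have hgram : ∀ i j, ∫ x, φ i x * ψ j x * w x = if i = j then d i else 0 := by
    rintro (i | i) (j | j)
    · refine (integral_mul_add_reflection hw (hev (qE i)) (hint (pE j) (qE i)) 1).trans ?_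
      rw [hvE]
      by_cases hij : i = j
      · subst hij
        rw [if_pos rfl]
        norm_num
        rfl
      · rw [if_neg (by simpa using hij), hE.orthogonal j i fun h => hij (Fin.ext h.symm), mul_zero]
    · refine (integral_mul_add_reflection hw (hev (qE i)) (hint (pO j) (qE i)) (-1)).trans ?_
      simp
    · refine (integral_mul_add_reflection hw (hod (qO i)) (hint' (pE j) (qO i)) 1).trans ?_
      simp
    · refine (integral_mul_add_reflection hw (hod (qO i)) (hint' (pO j) (qO i)) (-1)).trans ?_
      rw [hvO]
      by_cases hij : i = j
      · subst hij
        rw [if_pos rfl]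
        norm_num
        rfl
      · rw [if_neg (by simpa using hij), hO.orthogonal j i fun h => hij (Fin.ext h.symm), mul_zero]
  have hdiag : momentMatrix w (fun j => φ (e.symm j)) (fun j => ψ (e.symm j)) =
      Matrix.diagonal fun j => d (e.symm j) := by
    ext i j
    rw [momentMatrix, Matrix.of_apply, hgram, Matrix.diagonal_apply]
    simp only [e.symm.injective.eq_iff]
  obtain ⟨P, hP⟩ := exists_transform_of_mem (φ := fun j => φ (e.symm j)) (φ' := monomialFun n)
    fun j => by rw [span_monomialFun]; exact hφ _
  obtain ⟨Q, hQ⟩ := exists_transform_of_mem (φ := fun j => ψ (e.symm j))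
    (φ' := confluentFun n a 0) fun j => by rw [span_confluentFun]; exact hψ _
  have hi : ∀ j k : Fin (2 * n), Integrable fun x =>
      monomialFun n j x * confluentFun n a 0 k x * w x :=
    fun j k => integrable_pow_mul_confluentFun hw n a j k
  have hdet := congrArg Matrix.det hdiag
  rw [hP, hQ, momentMatrix_transform hi, Matrix.det_mul, Matrix.det_mul, Matrix.det_transpose,
    Matrix.det_diagonal] at hdet
  -- The diagonal Gram matrix is invertible, which forces both transition matrices to be invertible.
  -- Hence the adapted functions are bases, without a separate proof of linear independence.
  have hne : P.det * (momentMatrix w (monomialFun n) (confluentFun n a 0)).det * Q.det ≠ 0 := by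
    rw [hdet]
    exact Finset.prod_ne_zero_iff.2 fun j _ => hd _
  have hker := extKernel_of_momentMatrix_eq_diagonal (fun j => hd (e.symm j)) hdiag x y
  rw [hP, hQ, extKernel_transform hi
    (isUnit_iff_ne_zero.2 (left_ne_zero_of_mul (left_ne_zero_of_mul hne)))
    (isUnit_iff_ne_zero.2 (right_ne_zero_of_mul hne)),
    Equiv.sum_comp e.symm fun i => φ i y * ψ i x * w x / d i, Fintype.sum_sum_type] at hker
  rw [hker]
  congr 1
  · rw [← Finset.sum_add_distrib, Finset.mul_sum, Finset.sum_range]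
    refine Finset.sum_congr rfl fun i _ => ?_
    have h0 : hhE i ≠ 0 := hE.norm_ne_zero i
    simp only [φ, ψ, d, Sum.elim_inl]
    rw [mul_assoc _ (halfLine 1 x), mul_assoc _ (halfLine 1 (-x)), halfLine_mul_tilt,
      halfLine_mul_tilt, hw.even x]
    field_simp
  · rw [← Finset.sum_add_distrib, Finset.mul_sum, Finset.sum_range]
    refine Finset.sum_congr rfl fun i _ => ?_
    have h0 : hhO i ≠ 0 := hO.norm_ne_zero i
    simp only [φ, ψ, d, Sum.elim_inr]
    rw [mul_assoc _ (halfLine (-1) x), mul_assoc _ (halfLine (-1) (-x)), halfLine_mul_oddWeight,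
      halfLine_mul_oddWeight, hw.even x]
    -- At `x = 0` the antisymmetric function in `ψ` vanishes, and so does the right-hand side, since
    -- division by zero gives `0`.
    rcases eq_or_ne x 0 with rfl | hx
    · simp
    · field_simp

end ParitySplit

end ExternalSource

end

theorem proposition2p3 (w : ℝ → ℝ) (hw : ExternalSource.IsEvenWeight w) (a : ℝ) (ha : 0 < a)
    (n : ℕ) :
    ExternalSource.BiorthogonalWellDefined (ExternalSource.tilt w a) 1 ∧
    ExternalSource.BiorthogonalWellDefined
      (ExternalSource.oddWeight (ExternalSource.tilt w a)) (-1) ∧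
    MeasureTheory.IsProbabilityMeasure (ExternalSource.extLaw w n a) ∧
    (∀ φ ψ : Fin (2 * n) → ℝ → ℝ,
      LinearIndependent ℝ φ → Submodule.span ℝ (Set.range φ) = ExternalSource.polySpace n →
      LinearIndependent ℝ ψ → Submodule.span ℝ (Set.range ψ) = ExternalSource.expSpace n a →
      (∀ j k, MeasureTheory.Integrable fun x => φ j x * ψ k x * w x) ∧
      IsUnit (ExternalSource.momentMatrix w φ ψ).det ∧
      ExternalSource.IsCorrelationKernel (ExternalSource.extLaw w n a) ExternalSource.eigs
        (ExternalSource.extKernel w φ ψ) ∧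
      ∀ x y : ℝ, ExternalSource.extKernel w φ ψ x y =
        1 / 2 * ExternalSource.symKernel (ExternalSource.tilt w a) 1 n x y +
        y / (2 * x) * ExternalSource.symKernel
          (ExternalSource.oddWeight (ExternalSource.tilt w a)) (-1) n x y) := by
  refine ⟨ExternalSource.biorthogonalWellDefined_tilt hw ha,
    ExternalSource.biorthogonalWellDefined_oddWeight hw ha,
    ExternalSource.isProbabilityMeasure_extLaw hw n ha, fun φ ψ hφ hφs hψ hψs => ?_⟩
  -- Any admissible bases are invertible transforms of the monomials and of the functions `x^r
  -- e^{±ax}`. The kernel is unchanged and the Gram determinant changes by nonzero factors.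
  obtain ⟨P, hP, rfl⟩ := ExternalSource.exists_transform_eq hφ
    (hφs.trans (ExternalSource.span_monomialFun n).symm)
  obtain ⟨Q, hQ, rfl⟩ := ExternalSource.exists_transform_eq hψ
    (hψs.trans (ExternalSource.span_confluentFun n a).symm)
  have hi : ∀ j k : Fin (2 * n), Integrable fun x =>
      ExternalSource.monomialFun n j x * ExternalSource.confluentFun n a 0 k x * w x :=
    fun j k => ExternalSource.integrable_pow_mul_confluentFun hw n a j k
  have hK : ExternalSource.extKernel w (ExternalSource.transform P (ExternalSource.monomialFun n))
      (ExternalSource.transform Q (ExternalSource.confluentFun n a 0)) =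
      ExternalSource.extKernel w (ExternalSource.monomialFun n)
        (ExternalSource.confluentFun n a 0) := by
    ext x y
    exact ExternalSource.extKernel_transform hi hP hQ x y
  refine ⟨ExternalSource.integrable_transform hi P Q, ?_, ?_, fun x y => ?_⟩
  · rw [ExternalSource.momentMatrix_transform hi, Matrix.det_mul, Matrix.det_mul,
      Matrix.det_transpose]
    exact (hP.mul (isUnit_iff_ne_zero.2 (ExternalSource.det_sourceGram_ne_zero hw n ha))).mul hQ
  · rw [hK]
    exact ExternalSource.isCorrelationKernel_extKernel hw n ha
  · rw [hK]
    exact ExternalSource.extKernel_eq_symKernel hw ha n x y
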